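/- Let $\varepsilon>0$ and consider the viscous Burgers equation on the line $$\partial_t w-\varepsilon\,\partial_x^2 w+w\,\partial_x w=0\quad (t>0,\ x\in\mathbb R),\qquad w|_{t=0}=w_0, \qquad (1)$$ for real-valued functions, where the equation is understood in the sense of distributions, with $w\,\partial_x w=\partial_x(w^2/2)$. For $n\in\mathbb N$ write $\|f\|_{H^n}=\|(1-\partial_x^2)^{n/2}f\|_{L^2(\mathbb R)}$. There is a function $C=C(\varepsilon,R)>0$, non-decreasing in $R$, and for every integer $n\ge 2$ a function $M=M_n(\varepsilon,T,R)>0$, non-decreasing in $T$ and $R$, such that for every $\varepsilon>0$ and every $w_0\in H^1(\mathbb R)$ the following hold. 1. Equation (1) has a unique solution $w\in C([0,\infty);H^1(\mathbb R))$. 2. The map $t\mapsto\|w(t)\|_{L^2}$ is non-increasing on $[0,\infty)$, and for all $t\ge 0$, with $C=C(\varepsilon,\|w_0\|_{H^1})$, $$\|w(t)\|_{L^2}\le\|w_0\|_{L^2},\qquad \|\partial_x w(t)\|_{L^2}\le\|w_0'\|_{L^2}\,e^{C(t^{5/8}+t)}.$$ 3. If in addition $w_0\in H^n(\mathbb R)$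 for some integer $n\ge 2$, then $w\in C([0,\infty);H^n(\mathbb R))$, and for all $T>0$, with $M=M_n(\varepsilon,T,\|w_0\|_{H^2})$, $$\|w(t)\|_{H^n}\le\|w_0\|_{H^n}\,e^{Mt}\qquad\text{for all } t\in[0,T].$$ -/

import Mathlib

open MeasureTheory Filter Topology
open scoped NNReal ContDiff

noncomputable section

namespace ViscousBurgers

/-- The real Hilbert space `L²(ℝ)`. -/
abbrev L2 : Type := Lp ℝ 2 (volume : Measure ℝ)

/-- Smooth compactly supported test functions on the line. -/
def IsTest (ψ : ℝ → ℝ) : Prop := ContDiff ℝ ∞ ψ ∧ HasCompactSupport ψ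

/-- `g` is the `k`-th weak derivative of `f`. -/
def IsWeakDeriv (k : ℕ) (f g : L2) : Prop :=
  ∀ ψ : ℝ → ℝ, IsTest ψ →
    ∫ x, f x * iteratedDeriv k ψ x = (-1) ^ k * ∫ x, g x * ψ x

/-- Weak derivatives are unique. -/
theorem IsWeakDeriv.unique {k : ℕ} {f g h : L2} (hg : IsWeakDeriv k f g)
    (hh : IsWeakDeriv k f h) : g = h := by
  have lg : LocallyIntegrable (g : ℝ → ℝ) := (Lp.memLp g).locallyIntegrable (by norm_num)
  have lh : LocallyIntegrable (h : ℝ → ℝ) := (Lp.memLp h).locallyIntegrable (by norm_num)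
  refine Lp.ext ?_
  refine ae_eq_of_integral_contDiff_smul_eq lg lh ?_
  intro ψ hψ hc
  have e := (hg ψ ⟨hψ, hc⟩).symm.trans (hh ψ ⟨hψ, hc⟩)
  have e' := mul_left_cancel₀ (pow_ne_zero k (by norm_num : (-1 : ℝ) ≠ 0)) e
  simpa only [smul_eq_mul, mul_comm] using e'

/-- Membership in the Sobolev space `Hⁿ(ℝ)`: all weak derivatives of order at most `n` exist
and are in `L²`. -/
def MemH (n : ℕ) (f : L2) : Prop := ∀ k ≤ n, ∃ g : L2, IsWeakDeriv k f g

open Classical in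
/-- The `k`-th weak derivative (zero if there is none in `L²`). -/
def weakDeriv (k : ℕ) (f : L2) : L2 :=
  if h : ∃ g : L2, IsWeakDeriv k f g then h.choose else 0

theorem IsWeakDeriv.weakDeriv_eq {k : ℕ} {f g : L2} (h : IsWeakDeriv k f g) :
    weakDeriv k f = g := by
  have hex : ∃ g : L2, IsWeakDeriv k f g := ⟨g, h⟩
  unfold weakDeriv
  rw [dif_pos hex]
  exact hex.choose_spec.unique h

theorem weakDeriv_zero (f : L2) : weakDeriv 0 f = f := by
  apply IsWeakDeriv.weakDeriv_eq
  intro ψ _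
  simp

/-- The norm `‖f‖_{Hⁿ} = ‖(1 - ∂ₓ²)^{n/2} f‖_{L²}`. By Plancherel and the binomial formula,
`‖f‖_{Hⁿ}² = ∫ (1 + 4π²ξ²)ⁿ |𝓕 f(ξ)|² dξ = ∑_{k ≤ n} (n choose k) ‖∂ₓᵏ f‖²_{L²}`. -/
def hNorm (n : ℕ) (f : L2) : ℝ :=
  Real.sqrt (∑ k ∈ Finset.range (n + 1), (n.choose k : ℝ) * ‖weakDeriv k f‖ ^ 2)

/-- `w ∈ C([0,∞); Hⁿ(ℝ))`. -/
def ContinuousInH (n : ℕ) (w : ℝ≥0 → L2) : Prop :=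
  (∀ t, MemH n (w t)) ∧
    ∀ t₀, Tendsto (fun t => hNorm n (w t - w t₀)) (𝓝 t₀) (𝓝 0)

/-- `w ∈ C([0,∞); H¹(ℝ))` solves `∂ₜ w + ∂ₓ(w²/2) - ε ∂ₓ² w = 0`, `w(0) = w₀`. The equation holds
in the sense of distributions in `x` at every time `t > 0`; for `w ∈ C([0,∞); H¹(ℝ))` this is the
same as in the sense of distributions on `(0,∞) × ℝ`, since the spatial terms, paired with a test
function, are continuous in time. -/
structure IsSolution (ε : ℝ) (w₀ : L2) (w : ℝ≥0 → L2) : Prop where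
  continuousInH : ContinuousInH 1 w
  initial : w 0 = w₀
  equation : ∀ ψ : ℝ → ℝ, IsTest ψ → ∀ t : ℝ, 0 < t →
    HasDerivAt (fun s : ℝ => ∫ x, w s.toNNReal x * ψ x)
      (∫ x, (w t.toNNReal x ^ 2 / 2 * deriv ψ x + ε * (w t.toNNReal x * iteratedDeriv 2 ψ x))) t

end ViscousBurgers

end

open MeasureTheory Filter Topology
open scoped NNReal ContDiff

noncomputable section

namespace ViscousBurgers

/-! The whole argument runs on the Fourier side. With ⟨ξ⟩ = (1 + 4π²ξ²)^{1/2}, a function w lies in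
Hⁿ exactly when ŵ = ⟨ξ⟩⁻ⁿ v for some v in L²(ℝ; ℂ), and then ‖w‖_{Hⁿ} = ‖v‖. Reality of w means that
v is fixed by f ↦ conj f(-·). Since ⟨ξ⟩⁻² is integrable, ŵ lies in L¹ as soon as w is in H¹.
Squaring becomes a convolution, and Young's inequality gives the tame bound ‖w²‖_{Hⁿ} ≤ 2ⁿ⁺¹
‖ŵ‖_{L¹} ‖w‖_{Hⁿ} (`norm_bil_self_le`).

A priori bounds. The cubic term ∫ w² ∂ₓw vanishes, by symmetrizing over three frequencies with zero
sum (`trilinear_eq_zero`). So the L² norm decreases and 2ε ∫ ‖∂ₓw‖² dt ≤ ‖w₀‖² (`FSol.energy`). In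
any other weighted norm the dissipation absorbs the derivative falling on F = w², leaving d/dt ‖u‖²
≤ (8ε)⁻¹ ‖F‖² (`SolvesEq.norm_sq_le`). With the tame bound this is a linear Grönwall inequality,
both for ∂ₓw and in Hⁿ, whose coefficient is a multiple of ‖w‖²_{H¹}. Its time integral is first
controlled by the energy identity, so no norm blows up.

Existence. A radial retraction makes the nonlinearity globally Lipschitz on Hⁿ. The Duhamel kernel
has norm at most (εt)^{-1/2}, which is integrable at 0, so a weight e^{-λt} with λ large turns
Duhamel's formula into a contraction on the whole time axis (`exists_modified`). If the radius
exceeds the a priori bound on [0, T], the retraction never acts there (`exists_FSol_Icc`).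
Uniqueness is Grönwall for the difference of two solutions. Persistence of regularity follows by
solving directly in Hⁿ and identifying the result with the H¹ solution.

The equation occurs in three equivalent forms: distributional, integrated in time after applying (1
- ∂ₓ²)⁻¹, and integrated in time after cutting frequencies (`distribEq_iff`, `solvesEq_iff`). The
cut form involves only bounded operators and carries the energy computations. -/

/-- The complex Hilbert space `L²(ℝ; ℂ)`, in which Fourier transforms live. -/
abbrev L2c : Type := Lp ℂ 2 (volume : Measure ℝ)

/-! ### Fourier multipliers with bounded symbols -/

/-- A bounded measurable symbol. -/
structure IsSymbol (m : ℝ → ℂ) : Prop where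
  measurable : Measurable m
  bdd : ∃ C : ℝ, ∀ x, ‖m x‖ ≤ C

namespace IsSymbol

theorem of_le {m : ℝ → ℂ} (hm : Measurable m) {C : ℝ} (h : ∀ x, ‖m x‖ ≤ C) : IsSymbol m :=
  ⟨hm, C, h⟩

theorem mul {m m' : ℝ → ℂ} (h : IsSymbol m) (h' : IsSymbol m') :
    IsSymbol (fun x => m x * m' x) := by
  obtain ⟨C, hC⟩ := h.bdd
  obtain ⟨C', hC'⟩ := h'.bdd
  refine of_le (C := C * C') (h.measurable.mul h'.measurable) fun x => ?_
  rw [norm_mul]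
  exact mul_le_mul (hC x) (hC' x) (norm_nonneg _) ((norm_nonneg _).trans (hC x))

theorem memLp {m : ℝ → ℂ} (h : IsSymbol m) (f : L2c) : MemLp (fun x => m x * f x) 2 volume := by
  obtain ⟨C, hC⟩ := h.bdd
  refine MemLp.of_le_mul (c := C) (Lp.memLp f)
    (h.measurable.aestronglyMeasurable.mul (Lp.aestronglyMeasurable f)) ?_
  filter_upwards with x
  rw [norm_mul]
  exact mul_le_mul_of_nonneg_right (hC x) (norm_nonneg _)

end IsSymbol

open Classical in
/-- Multiplication by a bounded measurable symbol, as an operator on `L²`. -/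
def M (m : ℝ → ℂ) : L2c →L[ℂ] L2c :=
  if h : IsSymbol m then
    LinearMap.mkContinuousOfExistsBound
      { toFun := fun f => (h.memLp f).toLp _
        map_add' := fun f g => by
          rw [← MemLp.toLp_add, MemLp.toLp_eq_toLp_iff]
          filter_upwards [Lp.coeFn_add f g] with x hx
          simp only [hx, Pi.add_apply]; ring
        map_smul' := fun c f => by
          rw [RingHom.id_apply, ← MemLp.toLp_const_smul, MemLp.toLp_eq_toLp_iff]
          filter_upwards [Lp.coeFn_smul c f] with x hx
          simp only [hx, Pi.smul_apply, smul_eq_mul]; ring }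
      (by
        obtain ⟨C, hC⟩ := h.bdd
        refine ⟨C, fun f => Lp.norm_le_mul_norm_of_ae_le_mul ?_⟩
        filter_upwards [(h.memLp f).coeFn_toLp] with x hx
        simp only [LinearMap.coe_mk, AddHom.coe_mk, hx, norm_mul]
        exact mul_le_mul_of_nonneg_right (hC x) (norm_nonneg _))
  else 0

variable {m m' : ℝ → ℂ}

theorem coeFn_M (h : IsSymbol m) (f : L2c) : M m f =ᵐ[volume] fun x => m x * f x := by
  unfold M
  rw [dif_pos h]
  exact (h.memLp f).coeFn_toLp

theorem norm_M_le (h : IsSymbol m) {C : ℝ} (hC : ∀ x, ‖m x‖ ≤ C) (f : L2c) :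
    ‖M m f‖ ≤ C * ‖f‖ := by
  refine Lp.norm_le_mul_norm_of_ae_le_mul ?_
  filter_upwards [coeFn_M h f] with x hx
  rw [hx, norm_mul]
  exact mul_le_mul_of_nonneg_right (hC x) (norm_nonneg _)

theorem norm_M_le_norm (h : IsSymbol m) (hC : ∀ x, ‖m x‖ ≤ 1) (f : L2c) : ‖M m f‖ ≤ ‖f‖ := by
  simpa using norm_M_le h hC f

theorem opNorm_M_le (h : IsSymbol m) {C : ℝ} (hC : ∀ x, ‖m x‖ ≤ C) : ‖M m‖ ≤ C :=
  ContinuousLinearMap.opNorm_le_bound _ ((norm_nonneg _).trans (hC 0)) (norm_M_le h hC)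

theorem M_eq_of_ae (h : IsSymbol m) {f g : L2c} (e : (fun x => m x * f x) =ᵐ[volume] g) :
    M m f = g :=
  Lp.ext ((coeFn_M h f).trans e)

theorem M_M (h : IsSymbol m) (h' : IsSymbol m') (f : L2c) :
    M m (M m' f) = M (fun x => m x * m' x) f := by
  refine M_eq_of_ae h ?_
  filter_upwards [coeFn_M h' f, coeFn_M (h.mul h') f] with x h1 h2
  rw [h1, h2, mul_assoc]

theorem M_comm (h : IsSymbol m) (h' : IsSymbol m') (f : L2c) :
    M m (M m' f) = M m' (M m f) := by
  rw [M_M h h', M_M h' h]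
  simp only [mul_comm]

theorem M_congr_mul {m₁ m₂ : ℝ → ℂ} (h : IsSymbol m) (h' : IsSymbol m') (h₁ : IsSymbol m₁)
    (h₂ : IsSymbol m₂) (e : ∀ x, m x * m' x = m₁ x * m₂ x) (f : L2c) :
    M m (M m' f) = M m₁ (M m₂ f) := by
  rw [M_M h h', M_M h₁ h₂]
  simp only [e]

theorem isSymbol_one : IsSymbol (fun _ => (1 : ℂ)) :=
  .of_le (C := 1) measurable_const fun x => by simp

theorem M_one (f : L2c) : M (fun _ => 1) f = f :=
  M_eq_of_ae isSymbol_one (by simp)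

/-- Domination of symbols gives domination of norms. -/
theorem norm_M_mono (h : IsSymbol m) (h' : IsSymbol m') (e : ∀ x, ‖m x‖ ≤ ‖m' x‖) (f : L2c) :
    ‖M m f‖ ≤ ‖M m' f‖ := by
  refine Lp.norm_le_norm_of_ae_le ?_
  filter_upwards [coeFn_M h f, coeFn_M h' f] with x h1 h2
  rw [h1, h2, norm_mul, norm_mul]
  exact mul_le_mul_of_nonneg_right (e x) (norm_nonneg _)

theorem M_injective (h : IsSymbol m) (h0 : ∀ x, m x ≠ 0) : Function.Injective (M m) := by
  intro f g e
  refine Lp.ext ?_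
  filter_upwards [coeFn_M h f, coeFn_M h g] with x h1 h2
  have := h1.symm.trans ((congrFun (congrArg (fun k : L2c => (k : ℝ → ℂ)) e) x).trans h2)
  exact mul_left_cancel₀ (h0 x) this

/-- The real part of the inner product of `L²(ℝ; ℂ)`. -/
theorem inner_M_left (h : IsSymbol m) (hr : IsSymbol fun x => (starRingEnd ℂ) (m x)) (f g : L2c) :
    inner ℂ (M m f) g = inner ℂ f (M (fun x => (starRingEnd ℂ) (m x)) g) := by
  rw [L2.inner_def, L2.inner_def]
  refine integral_congr_ae ?_
  filter_upwards [coeFn_M h f, coeFn_M hr g] with x h1 h2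
  rw [h1, h2]
  simp only [RCLike.inner_apply, map_mul]
  ring

theorem IsSymbol.conj (h : IsSymbol m) : IsSymbol fun x => (starRingEnd ℂ) (m x) := by
  obtain ⟨C, hC⟩ := h.bdd
  exact .of_le (C := C) (by have := h.measurable; fun_prop) fun x => by simpa using hC x

/-- Bounded pointwise convergence of symbols gives strong convergence. -/
theorem tendsto_M {ι : Type*} {l : Filter ι} [l.IsCountablyGenerated] {s : ι → ℝ → ℂ} {C : ℝ}
    (hs : ∀ᶠ i in l, Measurable (s i) ∧ ∀ x, ‖s i x‖ ≤ C) (hm : IsSymbol m)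
    (hlim : ∀ x, Tendsto (fun i => s i x) l (𝓝 (m x))) (f : L2c) :
    Tendsto (fun i => M (s i) f) l (𝓝 (M m f)) := by
  obtain ⟨D, hD⟩ := hm.bdd
  rw [tendsto_iff_norm_sub_tendsto_zero]
  -- The squared norm of the difference is this integral, dominated by (C + D)² |f|².
  have key : Tendsto (fun i => ∫ x, ‖s i x - m x‖ ^ 2 * ‖f x‖ ^ 2) l (𝓝 (∫ _ : ℝ, (0 : ℝ))) := by
    refine tendsto_integral_filter_of_dominated_convergence
      (fun x => (C + D) ^ 2 * ‖f x‖ ^ 2) ?_ ?_ ?_ ?_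
    · filter_upwards [hs] with i hi
      exact (((hi.1.sub hm.measurable).norm.pow_const 2).aestronglyMeasurable).mul
        ((Lp.aestronglyMeasurable f).norm.pow 2)
    · filter_upwards [hs] with i hi
      filter_upwards with x
      rw [norm_mul, norm_pow, norm_norm, norm_pow, norm_norm]
      have : ‖s i x - m x‖ ≤ C + D := (norm_sub_le _ _).trans (add_le_add (hi.2 x) (hD x))
      gcongr
    · have := (Lp.memLp f).norm.integrable_sq
      exact this.const_mul _
    · filter_upwards with x
      have := ((hlim x).sub_const (m x)).norm.pow 2
      simpa using this.mul_const (‖f x‖ ^ 2)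
  rw [integral_zero] at key
  have e : ∀ᶠ i in l, Real.sqrt (∫ x, ‖s i x - m x‖ ^ 2 * ‖f x‖ ^ 2) = ‖M (s i) f - M m f‖ := by
    filter_upwards [hs] with i hi
    have hsi : IsSymbol (s i) := .of_le hi.1 hi.2
    rw [← Real.sqrt_sq (norm_nonneg (M (s i) f - M m f)), ← inner_self_eq_norm_sq (𝕜 := ℂ),
      L2.inner_def, ← integral_re (L2.integrable_inner _ _)]
    congr 1
    refine integral_congr_ae ?_
    filter_upwards [coeFn_M hsi f, coeFn_M hm f, Lp.coeFn_sub (M (s i) f) (M m f)] with x h1 h2 h3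
    rw [h3, Pi.sub_apply, h1, h2, inner_self_eq_norm_sq (𝕜 := ℂ), ← sub_mul, norm_mul, mul_pow]
  have := (Real.continuous_sqrt.tendsto 0).comp key
  rw [Real.sqrt_zero] at this
  exact this.congr' e

/-! ### Reality on the Fourier side -/

/-- The conjugate reflection `f ↦ conj f(-·)`. -/
def J : L2c →L[ℝ] L2c :=
  (Complex.conjCLE.toContinuousLinearMap.compLpL 2 (volume : Measure ℝ)).comp
    (Lp.compMeasurePreservingₗᵢ ℝ (E := ℂ) (p := 2) (fun x : ℝ => -x)
      (Measure.measurePreserving_neg (volume : Measure ℝ))).toContinuousLinearMap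

theorem coeFn_J (f : L2c) : J f =ᵐ[volume] fun x => (starRingEnd ℂ) (f (-x)) := by
  unfold J
  refine (ContinuousLinearMap.coeFn_compLpL _ _).trans ?_
  filter_upwards [Lp.coeFn_compMeasurePreserving f
    (Measure.measurePreserving_neg (volume : Measure ℝ))] with x hx
  simp only [Lp.compMeasurePreservingₗᵢ]
  exact congrArg (starRingEnd ℂ) hx

theorem ae_neg {p : ℝ → Prop} (h : ∀ᵐ x, p x) : ∀ᵐ x, p (-x) :=
  (Measure.measurePreserving_neg (volume : Measure ℝ)).quasiMeasurePreserving.ae h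

theorem norm_J (f : L2c) : ‖J f‖ = ‖f‖ := by
  have h : ∀ g : L2c, ‖J g‖ ≤ ‖g‖ := by
    intro g
    have e : ‖Lp.compMeasurePreserving (fun x : ℝ => -x)
      (Measure.measurePreserving_neg (volume : Measure ℝ)) g‖ = ‖g‖ :=
      Lp.norm_compMeasurePreserving _ _
    rw [← e]
    refine Lp.norm_le_norm_of_ae_le ?_
    filter_upwards [coeFn_J g, Lp.coeFn_compMeasurePreserving g
      (Measure.measurePreserving_neg (volume : Measure ℝ))] with x h1 h2
    rw [h1, h2]
    simp
  refine le_antisymm (h f) ?_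
  have e : J (J f) = f := by
    refine Lp.ext ?_
    filter_upwards [coeFn_J (J f), ae_neg (coeFn_J f)] with x h1 h2
    rw [h1, h2]
    simp
  calc ‖f‖ = ‖J (J f)‖ := by rw [e]
    _ ≤ ‖J f‖ := h _

/-- Fourier transforms of real functions are the fixed points of `J`, so a Hermitian symbol is that
of an operator preserving real functions. -/
theorem J_M (h : IsSymbol m) (hm : ∀ x, (starRingEnd ℂ) (m (-x)) = m x) (f : L2c) :
    J (M m f) = M m (J f) := by
  symm
  refine M_eq_of_ae h ?_
  filter_upwards [coeFn_J (M m f), ae_neg (coeFn_M h f), coeFn_J f] with x h1 h2 h3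
  rw [h1, h2, h3, map_mul, hm]

/-! ### Weights -/

/-- The Japanese bracket `(1 + 4π²ξ²)^{1/2}`. -/
def jb (ξ : ℝ) : ℝ := Real.sqrt (1 + (2 * Real.pi * ξ) ^ 2)

theorem jb_sq (ξ : ℝ) : jb ξ ^ 2 = 1 + (2 * Real.pi * ξ) ^ 2 := Real.sq_sqrt (by positivity)

theorem one_le_jb (ξ : ℝ) : 1 ≤ jb ξ := Real.one_le_sqrt.2 (by nlinarith [sq_nonneg (2 * Real.pi * ξ)])

theorem jb_pos (ξ : ℝ) : 0 < jb ξ := one_pos.trans_le (one_le_jb ξ)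

theorem abs_le_jb (ξ : ℝ) : |2 * Real.pi * ξ| ≤ jb ξ := Real.abs_le_sqrt (by linarith)

theorem jb_neg (ξ : ℝ) : jb (-ξ) = jb ξ := by simp [jb]

theorem continuous_jb : Continuous jb := by unfold jb; fun_prop

/-- ⟨ξ⟩ is the Euclidean length of (1, 2πξ). After squaring, all that is needed is that the product
of the second components is at most the product of the lengths. -/
theorem jb_add_le (a b : ℝ) : jb (a + b) ≤ jb a + jb b := by
  refine Real.sqrt_le_iff.2 ⟨(add_pos (jb_pos a) (jb_pos b)).le, ?_⟩
  have h : (2 * Real.pi * a) * (2 * Real.pi * b) ≤ jb a * jb b :=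
    (le_abs_self _).trans (by
      rw [abs_mul]
      exact mul_le_mul (abs_le_jb a) (abs_le_jb b) (abs_nonneg _) (jb_pos a).le)
  nlinarith [jb_sq a, jb_sq b]

theorem jb_pow_le (n : ℕ) (x t : ℝ) : jb x ^ n ≤ 2 ^ n * (jb t ^ n + jb (x - t) ^ n) := by
  have h1 : jb x ≤ jb t + jb (x - t) := by simpa using jb_add_le t (x - t)
  have h2 := add_pow_le (jb_pos t).le (jb_pos (x - t)).le n
  have h3 : (2 : ℝ) ^ (n - 1) ≤ 2 ^ n := pow_le_pow_right₀ (by norm_num) (Nat.sub_le n 1)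
  calc jb x ^ n ≤ (jb t + jb (x - t)) ^ n := pow_le_pow_left₀ (jb_pos x).le h1 n
    _ ≤ 2 ^ (n - 1) * (jb t ^ n + jb (x - t) ^ n) := h2
    _ ≤ _ := mul_le_mul_of_nonneg_right h3
      (add_nonneg (pow_nonneg (jb_pos t).le n) (pow_nonneg (jb_pos _).le n))

theorem integrable_jb : Integrable fun ξ => (jb ξ ^ 2)⁻¹ := by
  simp only [jb_sq]
  exact integrable_inv_one_add_sq.comp_mul_left' (by positivity : 2 * Real.pi ≠ 0)

/-- The constant of the embedding of weighted `L²` into `L¹`. -/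
def cEmb : ℝ := ∫ ξ, (jb ξ ^ 2)⁻¹

theorem cEmb_nonneg : 0 ≤ cEmb := integral_nonneg fun ξ => by positivity

/-- The symbol of `(1 - ∂ₓ²)^{-n/2}`. -/
def Wi (n : ℕ) (ξ : ℝ) : ℂ := (((jb ξ ^ n)⁻¹ : ℝ) : ℂ)

theorem norm_Wi (n : ℕ) (ξ : ℝ) : ‖Wi n ξ‖ = (jb ξ ^ n)⁻¹ := by
  rw [Wi, Complex.norm_real, Real.norm_of_nonneg (inv_nonneg.2 (pow_nonneg (jb_pos ξ).le n))]

theorem norm_Wi_le (n : ℕ) (ξ : ℝ) : ‖Wi n ξ‖ ≤ 1 := by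
  rw [norm_Wi]
  exact inv_le_one_of_one_le₀ (one_le_pow₀ (one_le_jb ξ))

theorem isSymbol_Wi (n : ℕ) : IsSymbol (Wi n) :=
  .of_le (by unfold Wi; have := continuous_jb.measurable; fun_prop) (norm_Wi_le n)

theorem Wi_ne_zero (n : ℕ) (ξ : ℝ) : Wi n ξ ≠ 0 := by
  rw [Wi, Complex.ofReal_ne_zero]
  exact inv_ne_zero (pow_ne_zero n (jb_pos ξ).ne')

theorem Wi_add (m n : ℕ) (ξ : ℝ) : Wi (m + n) ξ = Wi m ξ * Wi n ξ := by
  simp only [Wi, pow_add, mul_inv, Complex.ofReal_mul]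

theorem Wi_herm (n : ℕ) (ξ : ℝ) : (starRingEnd ℂ) (Wi n (-ξ)) = Wi n ξ := by
  simp only [Wi, jb_neg, Complex.conj_ofReal]

theorem M_Wi_add (m n : ℕ) (v : L2c) : M (Wi (m + n)) v = M (Wi m) (M (Wi n) v) := by
  rw [M_M (isSymbol_Wi m) (isSymbol_Wi n)]
  congr 2
  ext ξ
  exact Wi_add m n ξ

/-! ### Integrability of the Fourier transform of an H¹ function -/

/-- The `L¹` norm. -/
def l1 (f : L2c) : ℝ := ∫ ξ, ‖f ξ‖

theorem l1_nonneg (f : L2c) : 0 ≤ l1 f := integral_nonneg fun _ => norm_nonneg _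

/-- Cauchy–Schwarz against ⟨ξ⟩⁻¹, which is square integrable in one dimension. This replaces the
Sobolev embedding of H¹ into L^∞. -/
theorem integrable_Wi_one (v : L2c) : Integrable (M (Wi 1) v : ℝ → ℂ) ∧
    l1 (M (Wi 1) v) ≤ Real.sqrt cEmb * ‖v‖ := by
  have hw : MemLp (Wi 1) 2 (volume : Measure ℝ) := by
    refine (memLp_two_iff_integrable_sq_norm (isSymbol_Wi 1).measurable.aestronglyMeasurable).2 ?_
    simp only [norm_Wi, pow_one, inv_pow]
    exact integrable_jb
  refine ⟨(hw.integrable_mul (Lp.memLp v)).congr (coeFn_M (isSymbol_Wi 1) v).symm, ?_⟩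
  have h1 : l1 (M (Wi 1) v) = ∫ ξ, ‖Wi 1 ξ‖ * ‖v ξ‖ := by
    refine integral_congr_ae ?_
    filter_upwards [coeFn_M (isSymbol_Wi 1) v] with x hx
    rw [hx, norm_mul]
  have h2 := integral_mul_norm_le_Lp_mul_Lq (μ := (volume : Measure ℝ)) (f := Wi 1) (g := v)
    (p := 2) (q := 2) Real.HolderConjugate.two_two (by simpa using hw) (by simpa using Lp.memLp v)
  rw [h1]
  refine h2.trans (le_of_eq ?_)
  rw [← Real.sqrt_eq_rpow, ← Real.sqrt_eq_rpow]
  congr 1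
  · congr 1
    simp [norm_Wi, cEmb]
  · rw [← Real.sqrt_sq (norm_nonneg v), ← inner_self_eq_norm_sq (𝕜 := ℂ), L2.inner_def,
      ← integral_re (L2.integrable_inner _ _)]
    congr 1
    refine integral_congr_ae (ae_of_all _ fun x => ?_)
    simp only [inner_self_eq_norm_sq (𝕜 := ℂ), Real.rpow_two]

theorem integrable_Wi {n : ℕ} (hn : 1 ≤ n) (v : L2c) : Integrable (M (Wi n) v : ℝ → ℂ) := by
  obtain ⟨k, rfl⟩ := Nat.exists_eq_add_of_le hn
  rw [M_Wi_add]
  exact (integrable_Wi_one _).1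

theorem l1_Wi_le {n : ℕ} (hn : 1 ≤ n) (v : L2c) :
    l1 (M (Wi n) v) ≤ Real.sqrt cEmb * ‖v‖ := by
  obtain ⟨k, rfl⟩ := Nat.exists_eq_add_of_le hn
  rw [M_Wi_add]
  refine (integrable_Wi_one _).2.trans (mul_le_mul_of_nonneg_left ?_ (Real.sqrt_nonneg _))
  exact norm_M_le_norm (isSymbol_Wi k) (norm_Wi_le k) v

/-! ### Convolution -/

/-- Convolution of complex functions. -/
def conv (f g : ℝ → ℂ) (x : ℝ) : ℂ := ∫ t, f t * g (x - t)

theorem conv_eq (f g : ℝ → ℂ) :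
    conv f g = MeasureTheory.convolution f g (ContinuousLinearMap.mul ℂ ℂ) volume := rfl

theorem ae_sub_left (x : ℝ) {p : ℝ → Prop} (h : ∀ᵐ t, p t) : ∀ᵐ t, p (x - t) :=
  (Measure.measurePreserving_sub_left (volume : Measure ℝ) x).quasiMeasurePreserving.ae h

theorem conv_congr {f f' g g' : ℝ → ℂ} (hf : f =ᵐ[volume] f') (hg : g =ᵐ[volume] g') :
    conv f g = conv f' g' := by
  ext x
  refine integral_congr_ae ?_
  filter_upwards [hf, ae_sub_left x hg] with t h1 h2
  rw [h1, h2]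

theorem integrable_conv {f g : ℝ → ℂ} (hf : Integrable f) (hg : Integrable g) :
    Integrable (conv f g) := by
  rw [conv_eq]
  exact hf.integrable_convolution _ hg

theorem integrable_conv_integrand (f g : L2c) (x : ℝ) : Integrable fun t => f t * g (x - t) :=
  (Lp.memLp f).integrable_mul
    ((Lp.memLp g).comp_measurePreserving (Measure.measurePreserving_sub_left volume x))

theorem conv_add_left (f f' g : L2c) : conv (f + f' : L2c) g = conv f g + conv f' g := by
  rw [conv_congr (Lp.coeFn_add f f') (ae_eq_refl _)]
  ext x
  rw [Pi.add_apply, conv, conv, conv,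
    ← integral_add (integrable_conv_integrand f g x) (integrable_conv_integrand f' g x)]
  simp only [Pi.add_apply, add_mul]

theorem conv_add_right (f g g' : L2c) : conv f (g + g' : L2c) = conv f g + conv f g' := by
  rw [conv_congr (ae_eq_refl _) (Lp.coeFn_add g g')]
  ext x
  rw [Pi.add_apply, conv, conv, conv,
    ← integral_add (integrable_conv_integrand f g x) (integrable_conv_integrand f g' x)]
  simp only [Pi.add_apply, mul_add]

theorem conv_smul_left (c : ℂ) (f g : L2c) : conv (c • f : L2c) g = c • conv f g := by
  rw [conv_congr (Lp.coeFn_smul c f) (ae_eq_refl _)]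
  ext x
  simp only [conv, Pi.smul_apply, smul_eq_mul, mul_assoc, integral_const_mul]

theorem conv_smul_right (c : ℂ) (f g : L2c) : conv f (c • g : L2c) = c • conv f g := by
  rw [conv_congr (ae_eq_refl _) (Lp.coeFn_smul c g)]
  ext x
  simp only [conv, Pi.smul_apply, smul_eq_mul, mul_left_comm, integral_const_mul]

theorem conv_conj_neg (f g : L2c) (x : ℝ) :
    (starRingEnd ℂ) (conv f g (-x)) = conv (J f) (J g) x := by
  rw [conv_congr (coeFn_J f) (coeFn_J g), conv, conv, ← integral_conj, ← integral_neg_eq_self]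
  refine integral_congr_ae (ae_of_all _ fun t => ?_)
  simp only [map_mul]
  congr 3
  ring

/-- Young's inequality `L¹ * L² ⊆ L²`. -/
theorem eLpNorm_lintegral_conv_le {F G : ℝ → ENNReal} (hF : AEMeasurable F) (hG : AEMeasurable G) :
    eLpNorm (fun x => ∫⁻ t, F t * G (x - t)) 2 volume ≤ (∫⁻ t, F t) * eLpNorm G 2 volume := by
  -- Tonelli is applied to measurable representatives; changing F and G on null sets changes no
  -- inner integral.
  wlog hm : Measurable F ∧ Measurable G generalizing F G
  · have h := this (F := hF.mk F) (G := hG.mk G) hF.measurable_mk.aemeasurable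
      hG.measurable_mk.aemeasurable ⟨hF.measurable_mk, hG.measurable_mk⟩
    rw [← eLpNorm_congr_ae hG.ae_eq_mk, ← lintegral_congr_ae hF.ae_eq_mk] at h
    convert! h using 3 with x
    refine lintegral_congr_ae ?_
    filter_upwards [hF.ae_eq_mk, ae_sub_left x hG.ae_eq_mk] with t h1 h2
    rw [h1, h2]
  obtain ⟨hF, hG⟩ := hm
  -- Cauchy–Schwarz for the measure F dt, with the constant 1 as one factor.
  have cs : ∀ x, (∫⁻ t, F t * G (x - t)) ^ (2 : ℝ) ≤
      (∫⁻ t, F t) * ∫⁻ t, F t * G (x - t) ^ (2 : ℝ) := by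
    intro x
    have hGx : Measurable fun t => G (x - t) := hG.comp (measurable_const.sub measurable_id)
    have h := ENNReal.lintegral_mul_le_Lp_mul_Lq (volume.withDensity F)
      Real.HolderConjugate.two_two (f := fun _ => 1) (g := fun t => G (x - t))
      aemeasurable_const hGx.aemeasurable
    rw [lintegral_withDensity_eq_lintegral_mul _ hF (by fun_prop),
      lintegral_withDensity_eq_lintegral_mul _ hF (by fun_prop),
      lintegral_withDensity_eq_lintegral_mul _ hF (by fun_prop)] at h
    simp only [Pi.mul_apply, one_mul, ENNReal.one_rpow, mul_one] at h
    calc _ ≤ _ := ENNReal.rpow_le_rpow h (by norm_num : (0 : ℝ) ≤ 2)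
      _ = _ := by
        rw [ENNReal.mul_rpow_of_nonneg _ _ (by norm_num), ← ENNReal.rpow_mul, ← ENNReal.rpow_mul]
        norm_num
  have main : ∫⁻ x, (∫⁻ t, F t * G (x - t)) ^ (2 : ℝ) ≤
      (∫⁻ t, F t) ^ (2 : ℝ) * ∫⁻ x, G x ^ (2 : ℝ) := by
    calc _ ≤ ∫⁻ x, (∫⁻ t, F t) * ∫⁻ t, F t * G (x - t) ^ (2 : ℝ) := lintegral_mono cs
      _ = (∫⁻ t, F t) * ∫⁻ x, ∫⁻ t, F t * G (x - t) ^ (2 : ℝ) := by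
        refine lintegral_const_mul _ (Measurable.lintegral_prod_right' (f := fun p : ℝ × ℝ =>
          F p.2 * G (p.1 - p.2) ^ (2 : ℝ)) ?_)
        fun_prop
      _ = (∫⁻ t, F t) * ∫⁻ t, ∫⁻ x, F t * G (x - t) ^ (2 : ℝ) := by
        rw [lintegral_lintegral_swap]
        exact Measurable.aemeasurable (by fun_prop)
      _ = (∫⁻ t, F t) * ∫⁻ t, F t * ∫⁻ x, G x ^ (2 : ℝ) := by
        congr 2
        ext t
        rw [lintegral_const_mul _ (by fun_prop),
          lintegral_sub_right_eq_self (fun x => G x ^ (2 : ℝ)) t]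
      _ = _ := by
        rw [lintegral_mul_const _ hF, ← mul_assoc, ENNReal.rpow_two, sq]
  rw [eLpNorm_eq_lintegral_rpow_enorm_toReal (by norm_num) (by norm_num),
    eLpNorm_eq_lintegral_rpow_enorm_toReal (by norm_num) (by norm_num)]
  simp only [enorm_eq_self, ENNReal.toReal_ofNat]
  calc _ ≤ _ := ENNReal.rpow_le_rpow main (by norm_num : (0 : ℝ) ≤ 1 / 2)
    _ = _ := by
      rw [ENNReal.mul_rpow_of_nonneg _ _ (by norm_num), ← ENNReal.rpow_mul]
      norm_num

/-- The convolution estimate for a quasi-subadditive weight. -/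
theorem eLpNorm_weight_conv_le {f g : ℝ → ℂ} (hf : AEStronglyMeasurable f)
    (hg : AEStronglyMeasurable g) {θ : ℝ → ℝ} (hθ : Measurable θ) {c : ℝ} (hc : 0 ≤ c)
    (hsub : ∀ x t, ‖θ x‖ ≤ c * (‖θ t‖ + ‖θ (x - t)‖)) :
    eLpNorm (fun x => (θ x : ℂ) * conv f g x) 2 volume ≤
      ENNReal.ofReal c * (eLpNorm (fun x => (θ x : ℂ) * f x) 2 volume * (∫⁻ x, ‖g x‖ₑ) +
        (∫⁻ x, ‖f x‖ₑ) * eLpNorm (fun x => (θ x : ℂ) * g x) 2 volume) := by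
  set F : ℝ → ENNReal := fun x => ‖f x‖ₑ
  set G : ℝ → ENNReal := fun x => ‖g x‖ₑ
  set Fw : ℝ → ENNReal := fun x => ‖(θ x : ℂ) * f x‖ₑ with hFw
  set Gw : ℝ → ENNReal := fun x => ‖(θ x : ℂ) * g x‖ₑ with hGw
  have mθ : AEStronglyMeasurable (fun x => (θ x : ℂ)) (volume : Measure ℝ) :=
    (by fun_prop : Measurable fun x => (θ x : ℂ)).aestronglyMeasurable
  have mF : AEMeasurable F := hf.enorm
  have mG : AEMeasurable G := hg.enorm
  have mFw : AEMeasurable Fw := (mθ.mul hf).enorm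
  have mGw : AEMeasurable Gw := (mθ.mul hg).enorm
  -- In each product the factor without weight must come first, since it is the one measured in L¹
  -- in Young's inequality.
  have comm : ∀ x, ∫⁻ t, Fw t * G (x - t) = ∫⁻ t, G t * Fw (x - t) := by
    intro x
    rw [← lintegral_sub_left_eq_self (fun t => Fw t * G (x - t)) x]
    simp only [sub_sub_cancel, mul_comm]
  have pw : ∀ x, ‖(θ x : ℂ) * conv f g x‖ₑ ≤
      ‖ENNReal.ofReal c * ((∫⁻ t, G t * Fw (x - t)) + ∫⁻ t, F t * Gw (x - t))‖ₑ := by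
    intro x
    have msub : AEMeasurable (fun t => G (x - t)) := mG.comp_quasiMeasurePreserving
      (Measure.measurePreserving_sub_left volume x).quasiMeasurePreserving
    have mp : AEMeasurable (fun t => Fw t * G (x - t)) := mFw.mul msub
    rw [enorm_eq_self, ← comm, ← lintegral_add_left' mp, enorm_mul]
    calc _ ≤ ‖(θ x : ℂ)‖ₑ * ∫⁻ t, ‖f t * g (x - t)‖ₑ := by
          gcongr
          exact enorm_integral_le_lintegral_enorm _
      _ = ∫⁻ t, ‖(θ x : ℂ)‖ₑ * ‖f t * g (x - t)‖ₑ := (lintegral_const_mul' _ _ (by simp)).symm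
      _ ≤ ∫⁻ t, ENNReal.ofReal c * (Fw t * G (x - t) + F t * Gw (x - t)) := by
          refine lintegral_mono fun t => ?_
          have h : ‖(θ x : ℂ)‖ₑ ≤
              ENNReal.ofReal c * (‖(θ t : ℂ)‖ₑ + ‖(θ (x - t) : ℂ)‖ₑ) := by
            simp only [← ofReal_norm, Complex.norm_real]
            rw [← ENNReal.ofReal_add (norm_nonneg _) (norm_nonneg _), ← ENNReal.ofReal_mul hc]
            exact ENNReal.ofReal_le_ofReal (hsub x t)
          calc _ ≤ ENNReal.ofReal c * (‖(θ t : ℂ)‖ₑ + ‖(θ (x - t) : ℂ)‖ₑ) *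
                ‖f t * g (x - t)‖ₑ := by gcongr
            _ = _ := by
              simp only [hFw, hGw, F, G, enorm_mul]
              ring
      _ = _ := lintegral_const_mul' _ _ (by simp)
  -- The factors are only a.e. measurable, so measurability in x is obtained from representatives.
  have mc : ∀ {F G : ℝ → ENNReal}, AEMeasurable F → AEMeasurable G →
      AEStronglyMeasurable (fun x => ∫⁻ t, F t * G (x - t)) (volume : Measure ℝ) := by
    intro F G hF hG
    have e : (fun x => ∫⁻ t, F t * G (x - t)) = fun x => ∫⁻ t, hF.mk F t * hG.mk G (x - t) := by
      ext x
      refine lintegral_congr_ae ?_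
      filter_upwards [hF.ae_eq_mk, ae_sub_left x hG.ae_eq_mk] with t h1 h2
      rw [h1, h2]
    rw [e]
    refine Measurable.aestronglyMeasurable (Measurable.lintegral_prod_right' (f := fun p : ℝ × ℝ =>
          hF.mk F p.2 * hG.mk G (p.1 - p.2)) ?_)
    have h1 := hF.measurable_mk
    have h2 := hG.measurable_mk
    fun_prop
  refine (eLpNorm_mono_enorm pw).trans ?_
  have hcm : eLpNorm (fun x => ENNReal.ofReal c *
      ((∫⁻ t, G t * Fw (x - t)) + ∫⁻ t, F t * Gw (x - t))) 2 volume =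
      ENNReal.ofReal c * eLpNorm (fun x =>
        ((∫⁻ t, G t * Fw (x - t)) + ∫⁻ t, F t * Gw (x - t))) 2 volume := by
    rw [eLpNorm_eq_lintegral_rpow_enorm_toReal (by norm_num) (by norm_num),
      eLpNorm_eq_lintegral_rpow_enorm_toReal (by norm_num) (by norm_num)]
    simp only [enorm_eq_self, ENNReal.toReal_ofNat]
    simp only [ENNReal.mul_rpow_of_nonneg _ _ (by norm_num : (0 : ℝ) ≤ 2)]
    rw [lintegral_const_mul' _ _ (by simp), ENNReal.mul_rpow_of_nonneg _ _ (by norm_num),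
      ← ENNReal.rpow_mul]
    norm_num
  rw [hcm]
  gcongr
  refine (eLpNorm_add_le (mc mG mFw) (mc mF mGw) (by norm_num)).trans ?_
  have e1 : eLpNorm Fw 2 volume = eLpNorm (fun x => (θ x : ℂ) * f x) 2 volume :=
    eLpNorm_congr_enorm_ae (ae_of_all _ fun x => enorm_eq_self _)
  have e2 : eLpNorm Gw 2 volume = eLpNorm (fun x => (θ x : ℂ) * g x) 2 volume :=
    eLpNorm_congr_enorm_ae (ae_of_all _ fun x => enorm_eq_self _)
  rw [← e1, ← e2, mul_comm (eLpNorm Fw 2 volume)]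
  exact add_le_add (eLpNorm_lintegral_conv_le mG mFw) (eLpNorm_lintegral_conv_le mF mGw)

theorem memLp_weight_conv {f g : ℝ → ℂ} (hf : Integrable f) (hg : Integrable g)
    {θ : ℝ → ℝ} (hθ : Measurable θ) {c : ℝ} (hc : 0 ≤ c)
    (hsub : ∀ x t, ‖θ x‖ ≤ c * (‖θ t‖ + ‖θ (x - t)‖))
    (hf' : MemLp (fun x => (θ x : ℂ) * f x) 2 volume)
    (hg' : MemLp (fun x => (θ x : ℂ) * g x) 2 volume) :
    MemLp (fun x => (θ x : ℂ) * conv f g x) 2 volume := by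
  refine ⟨(by fun_prop : Measurable fun x => (θ x : ℂ)).aestronglyMeasurable.mul
    (integrable_conv hf hg).aestronglyMeasurable, ?_⟩
  refine (eLpNorm_weight_conv_le hf.aestronglyMeasurable hg.aestronglyMeasurable hθ hc
    hsub).trans_lt ?_
  have h1 := hf.hasFiniteIntegral
  have h2 := hg.hasFiniteIntegral
  exact ENNReal.mul_lt_top ENNReal.ofReal_lt_top (ENNReal.add_lt_top.2
    ⟨ENNReal.mul_lt_top hf'.2 h2, ENNReal.mul_lt_top h1 hg'.2⟩)

theorem norm_weight_conv_le {f g : ℝ → ℂ} (hf : Integrable f) (hg : Integrable g)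
    {θ : ℝ → ℝ} (hθ : Measurable θ) {c : ℝ} (hc : 0 ≤ c)
    (hsub : ∀ x t, ‖θ x‖ ≤ c * (‖θ t‖ + ‖θ (x - t)‖)) {a b k : L2c}
    (ha : a =ᵐ[volume] fun x => (θ x : ℂ) * f x) (hb : b =ᵐ[volume] fun x => (θ x : ℂ) * g x)
    (hk : k =ᵐ[volume] fun x => (θ x : ℂ) * conv f g x) :
    ‖k‖ ≤ c * (‖a‖ * (∫ x, ‖g x‖) + (∫ x, ‖f x‖) * ‖b‖) := by
  have h := eLpNorm_weight_conv_le hf.aestronglyMeasurable hg.aestronglyMeasurable hθ hc hsub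
  rw [← eLpNorm_congr_ae ha, ← eLpNorm_congr_ae hb, ← eLpNorm_congr_ae hk] at h
  have h1 := hf.hasFiniteIntegral
  have h2 := hg.hasFiniteIntegral
  have e1 : ∫ x, ‖f x‖ = (∫⁻ x, ‖f x‖ₑ).toReal := integral_norm_eq_lintegral_enorm hf.1
  have e2 : ∫ x, ‖g x‖ = (∫⁻ x, ‖g x‖ₑ).toReal := integral_norm_eq_lintegral_enorm hg.1
  have t1 := ENNReal.mul_ne_top (Lp.eLpNorm_ne_top a) h2.ne
  have t2 := ENNReal.mul_ne_top h1.ne (Lp.eLpNorm_ne_top b)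
  rw [Lp.norm_def, Lp.norm_def, Lp.norm_def, e1, e2, ← ENNReal.toReal_mul, ← ENNReal.toReal_mul,
    ← ENNReal.toReal_add t1 t2, ← ENNReal.toReal_ofReal hc, ← ENNReal.toReal_mul]
  exact ENNReal.toReal_mono (ENNReal.mul_ne_top ENNReal.ofReal_ne_top
    (ENNReal.add_ne_top.2 ⟨t1, t2⟩)) h

/-! ### The bilinear form -/

theorem jb_mul_Wi (n : ℕ) (v : L2c) :
    (fun x => ((jb x ^ n : ℝ) : ℂ) * M (Wi n) v x) =ᵐ[volume] v := by
  filter_upwards [coeFn_M (isSymbol_Wi n) v] with x hx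
  rw [hx, ← mul_assoc, Wi, ← Complex.ofReal_mul, mul_inv_cancel₀ (pow_ne_zero n (jb_pos x).ne'),
    Complex.ofReal_one, one_mul]

theorem measurable_jb_pow (n : ℕ) : Measurable fun x => jb x ^ n :=
  continuous_jb.measurable.pow_const n

theorem norm_jb_pow_le (n : ℕ) (x t : ℝ) :
    ‖jb x ^ n‖ ≤ 2 ^ n * (‖jb t ^ n‖ + ‖jb (x - t) ^ n‖) := by
  rw [Real.norm_of_nonneg (pow_nonneg (jb_pos _).le n),
    Real.norm_of_nonneg (pow_nonneg (jb_pos _).le n),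
    Real.norm_of_nonneg (pow_nonneg (jb_pos _).le n)]
  exact jb_pow_le n x t

theorem memLp_bil {n : ℕ} (hn : 1 ≤ n) (v v' : L2c) :
    MemLp (fun x => ((jb x ^ n : ℝ) : ℂ) * conv (M (Wi n) v) (M (Wi n) v') x) 2 volume :=
  memLp_weight_conv (integrable_Wi hn v) (integrable_Wi hn v') (measurable_jb_pow n)
    (by positivity) (norm_jb_pow_le n)
    ((memLp_congr_ae (jb_mul_Wi n v)).2 (Lp.memLp v))
    ((memLp_congr_ae (jb_mul_Wi n v')).2 (Lp.memLp v'))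

/-- Tame product estimate: in each term only one factor carries the weight ⟨ξ⟩ⁿ, while the other is
measured by the L¹ norm of its Fourier transform. This makes the later Grönwall inequalities linear
in the top norm. -/
theorem norm_bil_le {n : ℕ} (hn : 1 ≤ n) (v v' : L2c) :
    ‖(memLp_bil hn v v').toLp _‖ ≤
      2 ^ n * (‖v‖ * l1 (M (Wi n) v') + l1 (M (Wi n) v) * ‖v'‖) :=
  norm_weight_conv_le (integrable_Wi hn v) (integrable_Wi hn v') (measurable_jb_pow n)
    (by positivity) (norm_jb_pow_le n) (jb_mul_Wi n v).symm (jb_mul_Wi n v').symm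
    (memLp_bil hn v v').coeFn_toLp

/-- `(1 - ∂ₓ²)^{n/2}` applied to a product, in terms of `(1 - ∂ₓ²)^{n/2}` of the factors, on the
Fourier side. -/
def bil {n : ℕ} (hn : 1 ≤ n) : L2c →L[ℂ] L2c →L[ℂ] L2c :=
  LinearMap.mkContinuous₂
    (LinearMap.mk₂ ℂ (fun v v' => (memLp_bil hn v v').toLp _)
      (fun v v' w => by
        rw [← MemLp.toLp_add, MemLp.toLp_eq_toLp_iff]
        refine ae_of_all _ fun x => ?_
        simp only [map_add, conv_add_left, Pi.add_apply, mul_add])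
      (fun c v w => by
        rw [← MemLp.toLp_const_smul, MemLp.toLp_eq_toLp_iff]
        refine ae_of_all _ fun x => ?_
        simp only [map_smul, conv_smul_left, Pi.smul_apply, smul_eq_mul, mul_left_comm])
      (fun v w w' => by
        rw [← MemLp.toLp_add, MemLp.toLp_eq_toLp_iff]
        refine ae_of_all _ fun x => ?_
        simp only [map_add, conv_add_right, Pi.add_apply, mul_add])
      (fun c v w => by
        rw [← MemLp.toLp_const_smul, MemLp.toLp_eq_toLp_iff]
        refine ae_of_all _ fun x => ?_
        simp only [map_smul, conv_smul_right, Pi.smul_apply, smul_eq_mul, mul_left_comm]))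
    (2 ^ n * (2 * Real.sqrt cEmb)) (by
      intro v w
      simp only [LinearMap.mk₂_apply]
      refine (norm_bil_le hn v w).trans ?_
      have h1 := l1_Wi_le hn v
      have h2 := l1_Wi_le hn w
      calc _ ≤ 2 ^ n * (‖v‖ * (Real.sqrt cEmb * ‖w‖) + (Real.sqrt cEmb * ‖v‖) * ‖w‖) := by
            gcongr
        _ = _ := by ring)

variable {n : ℕ}

theorem coeFn_bil (hn : 1 ≤ n) (v v' : L2c) : bil hn v v' =ᵐ[volume]
    fun x => ((jb x ^ n : ℝ) : ℂ) * conv (M (Wi n) v) (M (Wi n) v') x :=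
  (memLp_bil hn v v').coeFn_toLp

theorem norm_bil_self_le (hn : 1 ≤ n) (v : L2c) :
    ‖bil hn v v‖ ≤ 2 ^ (n + 1) * l1 (M (Wi n) v) * ‖v‖ := by
  refine (norm_bil_le hn v v).trans (le_of_eq ?_)
  ring

theorem norm_bil_apply_le (hn : 1 ≤ n) (v v' : L2c) :
    ‖bil hn v v'‖ ≤ 2 ^ n * (2 * Real.sqrt cEmb) * ‖v‖ * ‖v'‖ := by
  refine ((bil hn).le_opNorm₂ v v').trans ?_
  have : ‖bil hn‖ ≤ 2 ^ n * (2 * Real.sqrt cEmb) :=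
    LinearMap.mkContinuous₂_norm_le _ (by positivity) _
  gcongr

/-- The convolution `u ⋆ u'`, as an element of `L²`. -/
theorem coeFn_Wi_bil (hn : 1 ≤ n) (v v' : L2c) : M (Wi n) (bil hn v v') =ᵐ[volume]
    conv (M (Wi n) v) (M (Wi n) v') := by
  filter_upwards [coeFn_M (isSymbol_Wi n) (bil hn v v'), coeFn_bil hn v v'] with x h1 h2
  rw [h1, h2, ← mul_assoc, Wi, ← Complex.ofReal_mul, inv_mul_cancel₀ (pow_ne_zero n (jb_pos x).ne'),
    Complex.ofReal_one, one_mul]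

theorem J_Wi (n : ℕ) (v : L2c) : J (M (Wi n) v) = M (Wi n) (J v) :=
  J_M (isSymbol_Wi n) (Wi_herm n) v

/-- A product of real functions is real. -/
theorem J_bil (hn : 1 ≤ n) (v v' : L2c) : J (bil hn v v') = bil hn (J v) (J v') := by
  refine Lp.ext ?_
  filter_upwards [coeFn_J (bil hn v v'), ae_neg (coeFn_bil hn v v'), coeFn_bil hn (J v) (J v')]
    with x h1 h2 h3
  rw [h1, h2, h3, map_mul, conv_conj_neg, J_Wi, J_Wi, jb_neg, Complex.conj_ofReal]

/-- Lowering the weight in the bilinear form. -/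
theorem Wi_bil (k : ℕ) (hn : 1 ≤ n) (hkn : 1 ≤ k + n) (v v' : L2c) :
    M (Wi k) (bil hkn v v') = bil hn (M (Wi k) v) (M (Wi k) v') := by
  refine Lp.ext ?_
  filter_upwards [coeFn_M (isSymbol_Wi k) (bil hkn v v'), coeFn_bil hkn v v',
    coeFn_bil hn (M (Wi k) v) (M (Wi k) v')] with x h1 h2 h3
  rw [h1, h2, h3, ← M_Wi_add, ← M_Wi_add, add_comm n k, ← mul_assoc, Wi, ← Complex.ofReal_mul,
    pow_add, ← mul_assoc, inv_mul_cancel₀ (pow_ne_zero k (jb_pos x).ne'), one_mul]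

/-! ### The derivative as a bounded multiplier -/

/-- The symbol of `∂ₓ (1 - ∂ₓ²)^{-1/2}`, up to a factor `i`. -/
def Di (ξ : ℝ) : ℂ := ((2 * Real.pi * ξ * (jb ξ)⁻¹ : ℝ) : ℂ)

theorem norm_Di_le (ξ : ℝ) : ‖Di ξ‖ ≤ 1 := by
  rw [Di, Complex.norm_real, norm_mul, norm_inv, Real.norm_eq_abs,
    Real.norm_of_nonneg (jb_pos ξ).le, ← div_eq_mul_inv, div_le_one (jb_pos ξ)]
  exact abs_le_jb ξ

theorem isSymbol_Di : IsSymbol Di :=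
  .of_le (by unfold Di; have := continuous_jb.measurable; fun_prop) norm_Di_le

theorem Di_mul (v : L2c) : M Di v =ᵐ[volume]
    fun x => ((2 * Real.pi * x : ℝ) : ℂ) * M (Wi 1) v x := by
  filter_upwards [coeFn_M isSymbol_Di v, coeFn_M (isSymbol_Wi 1) v] with x h1 h2
  rw [h1, h2, Di, Wi, pow_one, Complex.ofReal_mul (2 * Real.pi * x), mul_assoc]

/-- The Fourier form of ‖∂ₓ(w²)‖ ≤ 2 ‖ŵ‖_{L¹} ‖∂ₓw‖. The weight 2πξ is additive, so the convolution
estimate holds with constant 1 and involves the homogeneous norm alone. -/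
theorem norm_Di_bil_le (v : L2c) :
    ‖M Di (bil le_rfl v v)‖ ≤ 2 * l1 (M (Wi 1) v) * ‖M Di v‖ := by
  have h := norm_weight_conv_le (integrable_Wi le_rfl v) (integrable_Wi le_rfl v)
    (θ := fun x => 2 * Real.pi * x) (by fun_prop) zero_le_one
    (fun x t => by
      rw [one_mul]
      refine le_trans (le_of_eq ?_) (norm_add_le _ _)
      congr 1
      ring)
    (Di_mul v) (Di_mul v) (k := M Di (bil le_rfl v v)) (by
      filter_upwards [Di_mul (bil le_rfl v v), coeFn_Wi_bil le_rfl v v] with x h1 h2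
      rw [h1, h2])
  refine h.trans (le_of_eq ?_)
  simp only [l1]
  ring

/-- ‖w‖²_{H¹} = ‖w‖² + ‖∂ₓw‖², since 1 + (2πξ)² = ⟨ξ⟩². -/
theorem norm_sq_Wi_add_Di (v : L2c) : ‖v‖ ^ 2 = ‖M (Wi 1) v‖ ^ 2 + ‖M Di v‖ ^ 2 := by
  have e : ∀ f : L2c, ‖f‖ ^ 2 = ∫ x, ‖f x‖ ^ 2 := by
    intro f
    rw [← inner_self_eq_norm_sq (𝕜 := ℂ), L2.inner_def, ← integral_re (L2.integrable_inner _ _)]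
    simp only [inner_self_eq_norm_sq (𝕜 := ℂ)]
  rw [e, e, e, ← integral_add (Lp.memLp _).norm.integrable_sq (Lp.memLp _).norm.integrable_sq]
  refine integral_congr_ae ?_
  filter_upwards [coeFn_M isSymbol_Di v, coeFn_M (isSymbol_Wi 1) v] with x h1 h2
  rw [h1, h2, norm_mul, norm_mul, norm_Wi, Di, Complex.norm_real, mul_pow, mul_pow, norm_mul,
    mul_pow, norm_inv, Real.norm_of_nonneg (jb_pos x).le, Real.norm_eq_abs, sq_abs, pow_one,
    ← add_mul]
  have h3 := jb_sq x
  have h4 := jb_pos x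
  have : (jb x)⁻¹ ^ 2 + (2 * Real.pi * x) ^ 2 * (jb x)⁻¹ ^ 2 = 1 := by
    field_simp
    linarith
  rw [this, one_mul]

/-! ### The frequency-truncated equation -/

/-- The symbol of the projection to frequencies at most `K`. -/
def cut (K : ℕ) (ξ : ℝ) : ℂ := Set.indicator (Set.Icc (-(K : ℝ)) K) (fun _ => (1 : ℂ)) ξ

theorem cut_cases (K : ℕ) (ξ : ℝ) : cut K ξ = 0 ∨ (cut K ξ = 1 ∧ |ξ| ≤ K) := by
  unfold cut
  by_cases h : ξ ∈ Set.Icc (-(K : ℝ)) K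
  · exact Or.inr ⟨by simp [h], abs_le.2 h⟩
  · exact Or.inl (by simp [h])

/-- A continuous symbol is bounded on the compact set where the cut-off lives. Hence every truncated
differential operator is bounded on L². -/
theorem isSymbol_cut_mul (K : ℕ) {p : ℝ → ℂ} (hp : Continuous p) :
    IsSymbol fun ξ => cut K ξ * p ξ := by
  obtain ⟨C, hC⟩ := (isCompact_Icc (a := -(K : ℝ)) (b := K)).exists_bound_of_continuousOn
    hp.continuousOn
  refine .of_le (C := max C 0) ?_ fun ξ => ?_
  · exact (measurable_const.indicator measurableSet_Icc).mul hp.measurable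
  · rcases cut_cases K ξ with h | ⟨h, h'⟩
    · simp [h]
    · rw [h, one_mul]
      exact (hC ξ (abs_le.1 h')).trans (le_max_left _ _)

theorem isSymbol_cut (K : ℕ) : IsSymbol (cut K) := by
  simpa using isSymbol_cut_mul K (p := fun _ => 1) continuous_const

theorem norm_cut_le (K : ℕ) (ξ : ℝ) : ‖cut K ξ‖ ≤ 1 := by
  rcases cut_cases K ξ with h | ⟨h, -⟩ <;> simp [h]

theorem cut_mul_self (K : ℕ) (ξ : ℝ) : cut K ξ * cut K ξ = cut K ξ := by
  rcases cut_cases K ξ with h | ⟨h, -⟩ <;> simp [h]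

theorem tendsto_cut (ξ : ℝ) : Tendsto (fun K => cut K ξ) atTop (𝓝 1) := by
  obtain ⟨N, hN⟩ := exists_nat_ge |ξ|
  refine tendsto_const_nhds.congr' ?_
  filter_upwards [eventually_ge_atTop N] with K hK
  have : ξ ∈ Set.Icc (-(K : ℝ)) K := abs_le.1 (hN.trans (by exact_mod_cast hK))
  simp [cut, this]

theorem tendsto_M_cut (f : L2c) : Tendsto (fun K => M (cut K) f) atTop (𝓝 f) := by
  have h := tendsto_M (l := atTop) (s := cut) (C := 1) (m := fun _ => 1)
    (Eventually.of_forall fun K => ⟨(isSymbol_cut K).measurable, norm_cut_le K⟩)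
    isSymbol_one tendsto_cut f
  rwa [M_one] at h

theorem norm_M_cut_le (K : ℕ) (f : L2c) : ‖M (cut K) f‖ ≤ ‖f‖ :=
  norm_M_le_norm (isSymbol_cut K) (norm_cut_le K) f

/-- Truncated symbol of `-i∂ₓ`. -/
def symE (K : ℕ) (ξ : ℝ) : ℂ := cut K ξ * ((2 * Real.pi * ξ : ℝ) : ℂ)

/-- Truncated symbol of `ε∂ₓ²`. -/
def symA (ε : ℝ) (K : ℕ) (ξ : ℝ) : ℂ := cut K ξ * ((-(ε * (2 * Real.pi * ξ) ^ 2) : ℝ) : ℂ)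

/-- Truncated symbol of `-∂ₓ/2`. -/
def symD (K : ℕ) (ξ : ℝ) : ℂ := cut K ξ * (((-(Real.pi * ξ) : ℝ) : ℂ) * Complex.I)

theorem isSymbol_symE (K : ℕ) : IsSymbol (symE K) := isSymbol_cut_mul K (by fun_prop)

theorem isSymbol_symA (ε : ℝ) (K : ℕ) : IsSymbol (symA ε K) := isSymbol_cut_mul K (by fun_prop)

theorem isSymbol_symD (K : ℕ) : IsSymbol (symD K) := isSymbol_cut_mul K (by fun_prop)

/-- The right-hand side of the truncated equation. -/
def rhs (ε : ℝ) (K : ℕ) (u F : L2c) : L2c := M (symA ε K) u + M (symD K) F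

/-- `u_t = ε u_xx - F_x / 2` on `[0, T]`, on the Fourier side, integrated in time and truncated in
frequency. -/
def SolvesEq (ε T : ℝ) (u F : ℝ → L2c) : Prop :=
  ∀ K : ℕ, ∀ t ∈ Set.Icc 0 T,
    M (cut K) (u t) = M (cut K) (u 0) + ∫ s in (0 : ℝ)..t, rhs ε K (u s) (F s)

variable {ε T : ℝ} {u F : ℝ → L2c}

theorem continuous_rhs (ε : ℝ) (K : ℕ) (hu : Continuous u) (hF : Continuous F) :
    Continuous fun s => rhs ε K (u s) (F s) := by
  unfold rhs
  fun_prop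

theorem rhs_M (ε : ℝ) (K : ℕ) {m : ℝ → ℂ} (hm : IsSymbol m) (u F : L2c) :
    rhs ε K (M m u) (M m F) = M m (rhs ε K u F) := by
  unfold rhs
  rw [map_add, M_comm (isSymbol_symA ε K) hm, M_comm (isSymbol_symD K) hm]

theorem SolvesEq.mono {T' : ℝ} (h : SolvesEq ε T u F) (hT : T' ≤ T) : SolvesEq ε T' u F :=
  fun K t ht => h K t ⟨ht.1, ht.2.trans hT⟩

theorem SolvesEq.congr {F' : ℝ → L2c} (h : SolvesEq ε T u F)
    (e : ∀ t ∈ Set.Icc 0 T, F t = F' t) : SolvesEq ε T u F' := by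
  intro K t ht
  rw [h K t ht]
  congr 1
  refine intervalIntegral.integral_congr fun s hs => ?_
  rw [Set.uIcc_of_le ht.1] at hs
  simp only [e s ⟨hs.1, hs.2.trans ht.2⟩]

/-- The right-hand side is linear in (u, F) and multipliers commute. Together with the converse
`SolvesEq.of_map`, this moves the equation between Sobolev weights. -/
theorem SolvesEq.map (h : SolvesEq ε T u F) (hu : Continuous u) (hF : Continuous F) {m : ℝ → ℂ}
    (hm : IsSymbol m) : SolvesEq ε T (fun t => M m (u t)) (fun t => M m (F t)) := by
  intro K t ht
  simp only [rhs_M ε K hm]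
  rw [M_comm (isSymbol_cut K) hm, M_comm (isSymbol_cut K) hm, h K t ht, map_add,
    ContinuousLinearMap.intervalIntegral_comp_comm _
      ((continuous_rhs ε K hu hF).intervalIntegrable _ _)]

theorem SolvesEq.of_map {m : ℝ → ℂ} (hm : IsSymbol m) (h0 : ∀ x, m x ≠ 0) (hu : Continuous u)
    (hF : Continuous F) (h : SolvesEq ε T (fun t => M m (u t)) (fun t => M m (F t))) :
    SolvesEq ε T u F := by
  intro K t ht
  refine M_injective hm h0 ?_
  have := h K t ht
  simp only [rhs_M ε K hm] at this
  rw [M_comm hm (isSymbol_cut K), this, map_add, M_comm hm (isSymbol_cut K),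
    ContinuousLinearMap.intervalIntegral_comp_comm _
      ((continuous_rhs ε K hu hF).intervalIntegrable _ _)]

theorem SolvesEq.sub {u' F' : ℝ → L2c} (h : SolvesEq ε T u F) (h' : SolvesEq ε T u' F')
    (hu : Continuous u) (hF : Continuous F) (hu' : Continuous u') (hF' : Continuous F') :
    SolvesEq ε T (fun t => u t - u' t) (fun t => F t - F' t) := by
  intro K t ht
  have e : ∀ s, rhs ε K (u s - u' s) (F s - F' s) = rhs ε K (u s) (F s) - rhs ε K (u' s) (F' s) := by
    intro s
    simp only [rhs, map_sub]
    abel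
  simp only [e, map_sub]
  rw [h K t ht, h' K t ht, intervalIntegral.integral_sub
    ((continuous_rhs ε K hu hF).intervalIntegrable _ _)
    ((continuous_rhs ε K hu' hF').intervalIntegrable _ _)]
  abel

/-- The dissipation and production terms in the energy identity. -/
theorem re_inner_rhs (ε : ℝ) (K : ℕ) (u F : L2c) :
    2 * (inner ℂ (M (cut K) u) (rhs ε K u F)).re =
      -(2 * ε * ‖M (symE K) u‖ ^ 2) + (inner ℂ (M (symE K) u) (M (cut K) F)).im := by
  have hE := isSymbol_symE K
  have hc := isSymbol_cut K
  have conjE : (fun x => (starRingEnd ℂ) (symE K x)) = symE K := by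
    ext x
    rcases cut_cases K x with h | ⟨h, -⟩
    · simp [symE, h]
    · rw [symE, h, one_mul, Complex.conj_ofReal]
  have eA : M (symA ε K) u = (-(ε : ℂ)) • M (symE K) (M (symE K) u) := by
    rw [M_M hE hE]
    refine M_eq_of_ae (isSymbol_symA ε K) ?_
    filter_upwards [coeFn_M (hE.mul hE) u,
      Lp.coeFn_smul (-(ε : ℂ)) (M (fun x => symE K x * symE K x) u)] with x h1 h2
    rw [h2, Pi.smul_apply, h1, smul_eq_mul]
    rcases cut_cases K x with h | ⟨h, -⟩
    · simp [symE, symA, h]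
    · simp only [symE, symA, h]; push_cast; ring
  have eD : M (symD K) F = (-(Complex.I / 2)) • M (symE K) (M (cut K) F) := by
    rw [M_M hE hc]
    refine M_eq_of_ae (isSymbol_symD K) ?_
    filter_upwards [coeFn_M (hE.mul hc) F,
      Lp.coeFn_smul (-(Complex.I / 2)) (M (fun x => symE K x * cut K x) F)] with x h1 h2
    rw [h2, Pi.smul_apply, h1, smul_eq_mul]
    rcases cut_cases K x with h | ⟨h, -⟩
    · simp [symE, symD, h]
    · simp only [symE, symD, h]; push_cast; ring
  have eC : M (symE K) (M (cut K) u) = M (symE K) u := by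
    rw [M_M hE hc]
    congr 2
    ext x
    rw [symE, mul_right_comm, cut_mul_self]
  -- The truncated -i∂ₓ has a real symbol and is self-adjoint, which moves one derivative from the
  -- right-hand side onto u.
  have adj : ∀ g : L2c, inner ℂ (M (cut K) u) (M (symE K) g) = inner ℂ (M (symE K) u) g := by
    intro g
    have := inner_M_left hE hE.conj (M (cut K) u) g
    rw [conjE, eC] at this
    exact this.symm
  rw [rhs, inner_add_right, eA, eD, inner_smul_right, inner_smul_right, adj, adj,
    inner_self_eq_norm_sq_to_K]
  have e : ((‖M (symE K) u‖ : ℂ)) ^ 2 = ((‖M (symE K) u‖ ^ 2 : ℝ) : ℂ) := by push_cast; rfl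
  rw [Complex.add_re]
  have e1 : (-(ε : ℂ) * (RCLike.ofReal ‖M (symE K) u‖ : ℂ) ^ 2).re = -ε * ‖M (symE K) u‖ ^ 2 := by
    rw [show (RCLike.ofReal ‖M (symE K) u‖ : ℂ) = ((‖M (symE K) u‖ : ℝ) : ℂ) from rfl, e,
      ← Complex.ofReal_neg, ← Complex.ofReal_mul, Complex.ofReal_re]
  rw [e1]
  simp only [Complex.mul_re, Complex.neg_re, Complex.neg_im, Complex.div_ofNat_re,
    Complex.div_ofNat_im, Complex.I_re, Complex.I_im]
  ring

theorem SolvesEq.hasDerivAt (h : SolvesEq ε T u F) (hu : Continuous u) (hF : Continuous F) (K : ℕ)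
    {t : ℝ} (ht : t ∈ Set.Ioo 0 T) :
    HasDerivAt (fun s => M (cut K) (u s)) (rhs ε K (u t) (F t)) t := by
  have hc := continuous_rhs ε K hu hF
  have h1 : HasDerivAt (fun s => M (cut K) (u 0) + ∫ r in (0 : ℝ)..s, rhs ε K (u r) (F r))
      (rhs ε K (u t) (F t)) t :=
    (hc.integral_hasStrictDerivAt 0 t).hasDerivAt.const_add _
  refine h1.congr_of_eventuallyEq ?_
  filter_upwards [Ioo_mem_nhds ht.1 ht.2] with s hs
  exact h K s ⟨hs.1.le, hs.2.le⟩

/-- After truncation the equation is an ODE in L² with a continuous right-hand side, so the squared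
norm may be differentiated and integrated back. -/
theorem SolvesEq.energy_cut (h : SolvesEq ε T u F) (hu : Continuous u) (hF : Continuous F) (K : ℕ)
    {s t : ℝ} (hs : 0 ≤ s) (hst : s ≤ t) (ht : t ≤ T) :
    ‖M (cut K) (u t)‖ ^ 2 - ‖M (cut K) (u s)‖ ^ 2 =
      ∫ r in s..t, (-(2 * ε * ‖M (symE K) (u r)‖ ^ 2) +
        (inner ℂ (M (symE K) (u r)) (M (cut K) (F r))).im) := by
  symm
  have hc : Continuous fun r => (-(2 * ε * ‖M (symE K) (u r)‖ ^ 2) +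
        (inner ℂ (M (symE K) (u r)) (M (cut K) (F r))).im) := by
    have h1 : Continuous fun r => inner ℂ (M (symE K) (u r)) (M (cut K) (F r)) :=
      Continuous.inner (by fun_prop) (by fun_prop)
    have h2 := Complex.continuous_im.comp h1
    fun_prop
  refine intervalIntegral.integral_eq_sub_of_hasDerivAt_of_le hst
    (f := fun t => ‖M (cut K) (u t)‖ ^ 2) (by fun_prop) (fun r hr => ?_)
    (hc.intervalIntegrable _ _)
  have hd := h.hasDerivAt hu hF K (t := r) ⟨hs.trans_lt hr.1, hr.2.trans_le ht⟩
  have h2 := Complex.reCLM.hasFDerivAt.comp_hasDerivAt r (hd.inner ℂ hd)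
  rw [← re_inner_rhs]
  convert h2 using 1
  · ext t
    exact (inner_self_eq_norm_sq (𝕜 := ℂ) _).symm
  · rw [map_add, two_mul]
    congr 1
    exact (inner_re_symm (𝕜 := ℂ) _ _)

/-- The derivative on F is moved onto u, and the pairing is absorbed by the dissipation: X‖F‖ ≤ 2εX²
+ (8ε)⁻¹‖F‖² with X = ‖∂ₓu‖. The bound is uniform in the truncation, which is then removed. -/
theorem SolvesEq.norm_sq_le (h : SolvesEq ε T u F) (hε : 0 < ε) (hu : Continuous u)
    (hF : Continuous F) {t : ℝ} (ht : t ∈ Set.Icc 0 T) :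
    ‖u t‖ ^ 2 ≤ ‖u 0‖ ^ 2 + ∫ s in (0 : ℝ)..t, (8 * ε)⁻¹ * ‖F s‖ ^ 2 := by
  have key : ∀ K : ℕ, ‖M (cut K) (u t)‖ ^ 2 ≤
      ‖u 0‖ ^ 2 + ∫ s in (0 : ℝ)..t, (8 * ε)⁻¹ * ‖F s‖ ^ 2 := by
    intro K
    have h1 := h.energy_cut hu hF K le_rfl ht.1 ht.2
    have h2 : ‖M (cut K) (u 0)‖ ^ 2 ≤ ‖u 0‖ ^ 2 :=
      pow_le_pow_left₀ (norm_nonneg _) (norm_M_cut_le K _) 2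
    have hc : Continuous fun r => (-(2 * ε * ‖M (symE K) (u r)‖ ^ 2) +
        (inner ℂ (M (symE K) (u r)) (M (cut K) (F r))).im) := by
      have h1 : Continuous fun r => inner ℂ (M (symE K) (u r)) (M (cut K) (F r)) :=
        Continuous.inner (by fun_prop) (by fun_prop)
      have h2 := Complex.continuous_im.comp h1
      fun_prop
    have h3 := intervalIntegral.integral_mono_on ht.1 (hc.intervalIntegrable (μ := volume) _ _)
      ((by fun_prop : Continuous fun s => (8 * ε)⁻¹ * ‖F s‖ ^ 2).intervalIntegrable 0 t)
      (fun s _ => by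
        set X := ‖M (symE K) (u s)‖
        have h4 : (inner ℂ (M (symE K) (u s)) (M (cut K) (F s))).im ≤ X * ‖F s‖ :=
          ((le_abs_self _).trans (Complex.abs_im_le_norm _)).trans
            ((norm_inner_le_norm _ _).trans
              (mul_le_mul_of_nonneg_left (norm_M_cut_le K _) (norm_nonneg _)))
        -- Completing the square; this fixes the constant (8ε)⁻¹.
        have h5 : (8 * ε)⁻¹ * ‖F s‖ ^ 2 - X * ‖F s‖ + 2 * ε * X ^ 2 =
            (8 * ε)⁻¹ * (‖F s‖ - 4 * ε * X) ^ 2 := by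
          field_simp
          ring
        have h6 : 0 ≤ (8 * ε)⁻¹ * (‖F s‖ - 4 * ε * X) ^ 2 := by positivity
        show _ ≤ (8 * ε)⁻¹ * ‖F s‖ ^ 2
        linarith)
    linarith
  exact le_of_tendsto' ((tendsto_M_cut (u t)).norm.pow 2) key

/-- Grönwall's inequality in integral form. -/
theorem gronwall_integral {y b : ℝ → ℝ} (hy : Continuous y) (hb : Continuous b) (hb0 : ∀ t, 0 ≤ b t)
    {a : ℝ} (h : ∀ t ∈ Set.Icc 0 T, y t ≤ a + ∫ s in (0 : ℝ)..t, b s * y s) {t : ℝ}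
    (ht : t ∈ Set.Icc 0 T) : y t ≤ a * Real.exp (∫ s in (0 : ℝ)..t, b s) := by
  set z : ℝ → ℝ := fun t => a + ∫ s in (0 : ℝ)..t, b s * y s with hz
  set B : ℝ → ℝ := fun t => ∫ s in (0 : ℝ)..t, b s with hB
  have dz : ∀ t, HasDerivAt z (b t * y t) t := fun t =>
    ((hb.mul hy).integral_hasStrictDerivAt 0 t).hasDerivAt.const_add _
  have dB : ∀ t, HasDerivAt B (b t) t := fun t => (hb.integral_hasStrictDerivAt 0 t).hasDerivAt
  have dq : ∀ t, HasDerivAt (fun t => z t * Real.exp (-B t))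
      (b t * y t * Real.exp (-B t) + z t * (Real.exp (-B t) * -b t)) t := fun t =>
    (dz t).mul (dB t).neg.exp
  -- z e^{-B} decreases because z' = b y ≤ b z. No sign of y or a is needed.
  have anti : AntitoneOn (fun t => z t * Real.exp (-B t)) (Set.Icc 0 T) := by
    refine antitoneOn_of_deriv_nonpos (convex_Icc 0 T)
      (fun t _ => (dq t).continuousAt.continuousWithinAt)
      (fun t _ => (dq t).differentiableAt.differentiableWithinAt) fun t ht => ?_
    rw [interior_Icc] at ht
    rw [(dq t).deriv]
    have h1 := h t ⟨ht.1.le, ht.2.le⟩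
    have h2 : 0 ≤ b t * Real.exp (-B t) * (z t - y t) :=
      mul_nonneg (mul_nonneg (hb0 t) (Real.exp_nonneg _)) (by rw [hz]; linarith)
    linarith
  have h0 := anti ⟨le_rfl, ht.1.trans ht.2⟩ ht ht.1
  simp only [hz, hB, intervalIntegral.integral_same, add_zero, neg_zero, Real.exp_zero,
    mul_one] at h0
  rw [Real.exp_neg, ← div_eq_mul_inv, div_le_iff₀ (Real.exp_pos _)] at h0
  exact (h t ht).trans h0

/-! ### The cancellation `∫ w² ∂ₓw = 0` on the Fourier side -/

theorem memLp_conv_norm {f : ℝ → ℂ} (hf : Integrable f) (hf2 : MemLp f 2) :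
    MemLp (fun x => ∫ t, ‖f t‖ * ‖f (x - t)‖) 2 volume := by
  have h1 : Integrable fun x => ((‖f x‖ : ℝ) : ℂ) := hf.norm.ofReal
  have h2 : MemLp (fun x => ((1 : ℝ) : ℂ) * ((‖f x‖ : ℝ) : ℂ)) 2 (volume : Measure ℝ) := by
    simpa using hf2.norm.ofReal (K := ℂ)
  have h3 := (memLp_weight_conv h1 h1 (θ := fun _ => 1) measurable_const zero_le_one
    (fun x t => by norm_num) h2 h2).norm
  refine h3.congr_norm ?_ (ae_of_all _ fun x => ?_)
  · have := (integrable_conv h1 h1).aestronglyMeasurable.norm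
    refine this.congr (ae_of_all _ fun x => ?_)
    simp only [conv, ← Complex.ofReal_mul, integral_complex_ofReal, Complex.norm_real]
    exact Real.norm_of_nonneg (integral_nonneg fun t => by positivity)
  · simp only [conv, ← Complex.ofReal_mul, integral_complex_ofReal, Complex.norm_real,
      norm_norm, Complex.ofReal_one, one_mul]

/-- The three arguments -x, t and x - t of f sum to zero, and the product is symmetric in them. So
the integrals weighted by each argument are equal, and their sum is zero. -/
theorem trilinear_eq_zero {f : ℝ → ℂ} (hm : StronglyMeasurable f) (hf : Integrable f)
    (hf2 : MemLp f 2) (hx : MemLp (fun x : ℝ => (x : ℂ) * f x) 2) :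
    ∫ x : ℝ, ∫ t : ℝ, (x : ℂ) * (f (-x) * f t * f (x - t)) = 0 := by
  set G : ℝ → ℝ → ℂ := fun x t => f (-x) * f t * f (x - t) with hG
  have mf := hm.measurable
  have i1 : Integrable (fun p : ℝ × ℝ => (p.1 : ℂ) * G p.1 p.2) (volume.prod volume) := by
    have ms : AEStronglyMeasurable (fun p : ℝ × ℝ => (p.1 : ℂ) * G p.1 p.2)
        (volume.prod volume) := by
      refine Measurable.aestronglyMeasurable ?_
      simp only [hG]
      fun_prop
    rw [integrable_prod_iff ms]
    constructor
    · filter_upwards with x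
      have h := hf2.integrable_mul
        (hf2.comp_measurePreserving (Measure.measurePreserving_sub_left volume x))
      refine (h.const_mul ((x : ℂ) * f (-x))).congr (ae_of_all _ fun t => ?_)
      simp only [hG, Pi.mul_apply, Function.comp_apply]
      ring
    -- Integrability on the plane: x f(-x) is in L², and so is |f| ⋆ |f| by Young's inequality.
    · have h1 : MemLp (fun x : ℝ => ‖((-x : ℝ) : ℂ) * f (-x)‖) 2 volume :=
        (hx.comp_measurePreserving (Measure.measurePreserving_neg volume)).norm
      refine (h1.integrable_mul (memLp_conv_norm hf hf2)).congr (ae_of_all _ fun x => ?_)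
      simp only [Pi.mul_apply, hG]
      rw [← integral_const_mul]
      refine integral_congr_ae (ae_of_all _ fun t => ?_)
      simp only [norm_mul, Complex.ofReal_neg, norm_neg]
      ring
  have e1 : ∀ x t, G (-x) (-t) = G t x := by
    intro x t
    simp only [hG, neg_neg, neg_sub_neg, mul_comm]
  have i2 : Integrable (fun p : ℝ × ℝ => (p.1 : ℂ) * G p.2 p.1) (volume.prod volume) := by
    refine i1.comp_neg.neg.congr (ae_of_all _ fun p => ?_)
    simp only [Pi.neg_apply, Prod.fst_neg, Prod.snd_neg, e1, Complex.ofReal_neg, neg_mul, neg_neg]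
  have i3 : Integrable (fun p : ℝ × ℝ => (p.2 : ℂ) * G p.1 p.2) (volume.prod volume) := i2.swap
  -- Exchanging -x and t gives I_x = -I_t. Below, exchanging t and x - t gives I_t = I_x - I_t. The
  -- two relations force I_x = 0.
  have t12 : ∫ x : ℝ, ∫ t : ℝ, (x : ℂ) * G x t = -∫ x : ℝ, ∫ t : ℝ, (t : ℂ) * G x t := by
    rw [← integral_neg_eq_self]
    simp only [Complex.ofReal_neg, neg_mul]
    have : ∀ x : ℝ, ∫ t : ℝ, -((x : ℂ) * G (-x) t) = -∫ t : ℝ, (x : ℂ) * G t x := by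
      intro x
      rw [← integral_neg_eq_self]
      simp only [e1]
      exact integral_neg _
    simp only [this]
    rw [integral_neg, integral_integral_swap i2]
  have t23 : ∫ x : ℝ, ∫ t : ℝ, (t : ℂ) * G x t =
      ∫ x : ℝ, ∫ t : ℝ, ((x : ℂ) * G x t - (t : ℂ) * G x t) := by
    congr 1
    ext x
    rw [← integral_sub_left_eq_self (fun t : ℝ => (t : ℂ) * G x t) volume x]
    congr 1
    ext t
    simp only [hG, sub_sub_cancel, Complex.ofReal_sub]
    ring
  rw [integral_integral_sub i1 i3] at t23
  linear_combination (2 / 3 : ℂ) * t12 - (1 / 3 : ℂ) * t23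

/-- Reality replaces the conjugate of ŵ(x) by ŵ(-x), which turns the pairing of ∂ₓw with w² into the
trilinear form above. -/
theorem inner_Di_conv_self {v : L2c} (hv : J v = v) :
    inner ℂ (M Di v) (M (Wi 1) (bil le_rfl v v)) = 0 := by
  set u := M (Wi 1) v with hu
  have hJ : J u = u := by rw [hu, J_Wi, hv]
  have hx : MemLp (fun x : ℝ => (x : ℂ) * u x) 2 (volume : Measure ℝ) := by
    have h := (memLp_congr_ae (Di_mul v)).1 (Lp.memLp (M Di v))
    refine (h.const_mul ((2 * Real.pi : ℝ) : ℂ)⁻¹).congr_norm ?_ (ae_of_all _ fun x => ?_)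
    · exact (by fun_prop : Measurable fun x : ℝ => (x : ℂ)).aestronglyMeasurable.mul
        (Lp.aestronglyMeasurable u)
    · have : ((2 * Real.pi : ℝ) : ℂ) ≠ 0 := by
        rw [Complex.ofReal_ne_zero]
        positivity
      rw [Complex.ofReal_mul (2 * Real.pi) x, mul_assoc, inv_mul_cancel_left₀ this]
  have h := trilinear_eq_zero (Lp.stronglyMeasurable u) (integrable_Wi le_rfl v) (Lp.memLp u) hx
  have e : (∫ x : ℝ, ((2 * Real.pi : ℝ) : ℂ) *
      ∫ t : ℝ, (x : ℂ) * (u (-x) * u t * u (x - t))) = 0 := by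
    rw [integral_const_mul, h, mul_zero]
  rw [L2.inner_def, ← e]
  refine integral_congr_ae ?_
  filter_upwards [Di_mul v, coeFn_Wi_bil le_rfl v v, ae_neg (coeFn_J u)] with x h1 h2 h3
  rw [hJ, neg_neg] at h3
  rw [h1, h2, h3, RCLike.inner_apply, map_mul, Complex.conj_ofReal, conv]
  rw [← integral_const_mul, ← integral_mul_const]
  refine integral_congr_ae (ae_of_all _ fun t => ?_)
  simp only [← hu]
  push_cast
  ring

/-! ### A priori estimates -/

/-- A real solution with values in `Hⁿ`; `v` is `(1 - ∂ₓ²)^{n/2} w` on the Fourier side. -/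
structure FSol {n : ℕ} (hn : 1 ≤ n) (ε T : ℝ) (v : ℝ → L2c) : Prop where
  cont : Continuous v
  real : ∀ t, J (v t) = v t
  eq : SolvesEq ε T v (fun t => bil hn (v t) (v t))

variable {ε T : ℝ} {v v' : ℝ → L2c} {n : ℕ}

theorem continuous_bil_self (hn : 1 ≤ n) (hv : Continuous v) :
    Continuous fun t => bil hn (v t) (v t) := by fun_prop

theorem FSol.mono {hn : 1 ≤ n} (h : FSol hn ε T v) {T' : ℝ} (hT : T' ≤ T) : FSol hn ε T' v :=
  ⟨h.cont, h.real, h.eq.mono hT⟩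

/-- An H^{k+n} solution, reweighted, is an Hⁿ solution. The energy and H¹ bounds thereby apply to
solutions of any regularity. -/
theorem FSol.lower {k : ℕ} {hkn : 1 ≤ k + n} (hn : 1 ≤ n) (h : FSol hkn ε T v) :
    FSol hn ε T (fun t => M (Wi k) (v t)) := by
  refine ⟨(M (Wi k)).continuous.comp h.cont, fun t => by rw [J_Wi, h.real], ?_⟩
  simp only [← Wi_bil k hn hkn]
  exact h.eq.map h.cont (continuous_bil_self hkn h.cont) (isSymbol_Wi k)

theorem symE_Wi_tendsto (v : L2c) :
    Tendsto (fun K => M (symE K) (M (Wi 1) v)) atTop (𝓝 (M Di v)) := by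
  have e : ∀ K, M (symE K) (M (Wi 1) v) = M (cut K) (M Di v) := by
    intro K
    rw [M_M (isSymbol_symE K) (isSymbol_Wi 1), M_M (isSymbol_cut K) isSymbol_Di]
    congr 2
    ext x
    rw [symE, Wi, Di, pow_one, mul_assoc, ← Complex.ofReal_mul]
  simp only [e]
  exact tendsto_M_cut _

theorem norm_symE_Wi_le (K : ℕ) (v : L2c) : ‖M (symE K) (M (Wi 1) v)‖ ≤ ‖v‖ := by
  rw [M_M (isSymbol_symE K) (isSymbol_Wi 1)]
  refine norm_M_le_norm ((isSymbol_symE K).mul (isSymbol_Wi 1)) (fun x => ?_) v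
  rw [symE, mul_assoc]
  have : ((2 * Real.pi * x : ℝ) : ℂ) * Wi 1 x = Di x := by
    rw [Wi, Di, pow_one, ← Complex.ofReal_mul]
  rw [this, norm_mul]
  exact mul_le_one₀ (norm_cut_le K x) (norm_nonneg _) (norm_Di_le x)

/-- The energy identity. -/
theorem FSol.energy (h : FSol le_rfl ε T v) {s t : ℝ} (hs : 0 ≤ s) (hst : s ≤ t) (ht : t ≤ T) :
    ‖M (Wi 1) (v t)‖ ^ 2 + 2 * ε * (∫ r in s..t, ‖M Di (v r)‖ ^ 2) = ‖M (Wi 1) (v s)‖ ^ 2 := by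
  have hc := h.cont
  have hb := continuous_bil_self le_rfl hc
  have hE := h.eq.map hc hb (isSymbol_Wi 1)
  have lim1 : Tendsto (fun K => ‖M (cut K) (M (Wi 1) (v t))‖ ^ 2 -
      ‖M (cut K) (M (Wi 1) (v s))‖ ^ 2) atTop
      (𝓝 (‖M (Wi 1) (v t)‖ ^ 2 - ‖M (Wi 1) (v s)‖ ^ 2)) :=
    ((tendsto_M_cut _).norm.pow 2).sub ((tendsto_M_cut _).norm.pow 2)
  -- The symbol of ∂ₓ(1 - ∂ₓ²)^{-1/2} is bounded by 1, so the truncated integrands have a majorant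
  -- independent of K, continuous in r.
  have lim2 : Tendsto (fun K => ∫ r in s..t, (-(2 * ε * ‖M (symE K) (M (Wi 1) (v r))‖ ^ 2) +
        (inner ℂ (M (symE K) (M (Wi 1) (v r)))
          (M (cut K) (M (Wi 1) (bil le_rfl (v r) (v r))))).im)) atTop
      (𝓝 (∫ r in s..t, -(2 * ε * ‖M Di (v r)‖ ^ 2))) := by
    refine intervalIntegral.tendsto_integral_filter_of_dominated_convergence
      (fun r => 2 * |ε| * ‖v r‖ ^ 2 + ‖v r‖ * ‖bil le_rfl (v r) (v r)‖) ?_ ?_ ?_ ?_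
    · filter_upwards with K
      have h1 : Continuous fun r => inner ℂ (M (symE K) (M (Wi 1) (v r)))
          (M (cut K) (M (Wi 1) (bil le_rfl (v r) (v r)))) :=
        Continuous.inner (by fun_prop) (by fun_prop)
      have h2 := Complex.continuous_im.comp h1
      refine Continuous.aestronglyMeasurable ?_
      fun_prop
    · filter_upwards with K
      filter_upwards with r _
      have h1 := norm_symE_Wi_le K (v r)
      have h2 : ‖M (cut K) (M (Wi 1) (bil le_rfl (v r) (v r)))‖ ≤ ‖bil le_rfl (v r) (v r)‖ :=
        (norm_M_cut_le K _).trans (norm_M_le_norm (isSymbol_Wi 1) (norm_Wi_le 1) _)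
      refine (norm_add_le _ _).trans (add_le_add ?_ ?_)
      · rw [norm_neg, norm_mul, norm_mul, Real.norm_eq_abs, Real.norm_eq_abs, norm_pow, norm_norm,
          abs_two]
        gcongr
      · refine (Complex.abs_im_le_norm _).trans ((norm_inner_le_norm _ _).trans ?_)
        gcongr
    · refine Continuous.intervalIntegrable ?_ _ _
      fun_prop
    · filter_upwards with r _
      have h1 := symE_Wi_tendsto (v r)
      have h2 := tendsto_M_cut (M (Wi 1) (bil le_rfl (v r) (v r)))
      have h3 := (Complex.continuous_im.tendsto _).comp (h1.inner h2 (𝕜 := ℂ))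
      have h4 := ((h1.norm.pow 2).const_mul (2 * ε)).neg.add h3
      -- The cubic term cancels only in the limit: the truncation breaks the symmetry between the
      -- three frequencies.
      rw [inner_Di_conv_self (h.real r), Complex.zero_im, add_zero] at h4
      exact h4
  have e := tendsto_nhds_unique lim1 (lim2.congr fun K =>
    (hE.energy_cut (by fun_prop) (by fun_prop) K hs hst ht).symm)
  rw [intervalIntegral.integral_neg, intervalIntegral.integral_const_mul] at e
  linarith

theorem FSol.norm_Wi_antitone (h : FSol le_rfl ε T v) (hε : 0 < ε) {s t : ℝ} (hs : 0 ≤ s)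
    (hst : s ≤ t) (ht : t ≤ T) : ‖M (Wi 1) (v t)‖ ≤ ‖M (Wi 1) (v s)‖ := by
  refine le_of_sq_le_sq ?_ (norm_nonneg _)
  have h1 := h.energy hs hst ht
  have h2 : 0 ≤ ∫ r in s..t, ‖M Di (v r)‖ ^ 2 :=
    intervalIntegral.integral_nonneg hst fun r _ => by positivity
  have := mul_nonneg (mul_nonneg zero_le_two hε.le) h2
  linarith

theorem sq_l1_Wi_le (hn : 1 ≤ n) (v : L2c) : l1 (M (Wi n) v) ^ 2 ≤ cEmb * ‖v‖ ^ 2 := by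
  have h := pow_le_pow_left₀ (l1_nonneg _) (l1_Wi_le hn v) 2
  rwa [mul_pow, Real.sq_sqrt cEmb_nonneg] at h

/-- Grönwall for the gradient. -/
theorem FSol.gradient_le (h : FSol le_rfl ε T v) (hε : 0 < ε) {t : ℝ} (ht : t ∈ Set.Icc 0 T) :
    ‖M Di (v t)‖ ^ 2 ≤ ‖M Di (v 0)‖ ^ 2 *
      Real.exp (∫ s in (0 : ℝ)..t, cEmb / (2 * ε) * ‖v s‖ ^ 2) := by
  have hc := h.cont
  have hb := continuous_bil_self le_rfl hc
  have hE := h.eq.map hc hb isSymbol_Di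
  have hk : 0 ≤ cEmb / (2 * ε) := div_nonneg cEmb_nonneg (by positivity)
  refine gronwall_integral (T := T) (y := fun t => ‖M Di (v t)‖ ^ 2)
    (b := fun s => cEmb / (2 * ε) * ‖v s‖ ^ 2)
    (by fun_prop) (by fun_prop) (fun s => by positivity) (fun t ht => ?_) ht
  refine (hE.norm_sq_le hε (by fun_prop) (by fun_prop) ht).trans (add_le_add_right ?_ _)
  refine intervalIntegral.integral_mono_on ht.1
    (Continuous.intervalIntegrable (by fun_prop) _ _)
    (Continuous.intervalIntegrable (by fun_prop) _ _) fun s _ => ?_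
  have h1 := pow_le_pow_left₀ (norm_nonneg _) (norm_Di_bil_le (v s)) 2
  have h2 := sq_l1_Wi_le le_rfl (v s)
  calc (8 * ε)⁻¹ * ‖M Di (bil le_rfl (v s) (v s))‖ ^ 2
      ≤ (8 * ε)⁻¹ * (2 * l1 (M (Wi 1) (v s)) * ‖M Di (v s)‖) ^ 2 := by gcongr
    _ = (8 * ε)⁻¹ * (4 * l1 (M (Wi 1) (v s)) ^ 2 * ‖M Di (v s)‖ ^ 2) := by ring
    _ ≤ (8 * ε)⁻¹ * (4 * (cEmb * ‖v s‖ ^ 2) * ‖M Di (v s)‖ ^ 2) := by gcongr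
    _ = _ := by
      field_simp
      ring

/-- Growth rate in the first gradient estimate. -/
def rate (ε R : ℝ) : ℝ := cEmb / (2 * ε) * R ^ 2

theorem rate_nonneg (hε : 0 < ε) (R : ℝ) : 0 ≤ rate ε R :=
  mul_nonneg (div_nonneg cEmb_nonneg (by positivity)) (sq_nonneg R)

/-- The energy identity bounds the L² part by tR² and the gradient part by R²/(2ε). The Grönwall
exponent of the gradient is thus controlled by the initial data alone. -/
theorem FSol.integral_sq_le (h : FSol le_rfl ε T v) (hε : 0 < ε) {R : ℝ} (hR : ‖v 0‖ ≤ R) {t : ℝ}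
    (ht : t ∈ Set.Icc 0 T) :
    ∫ s in (0 : ℝ)..t, cEmb / (2 * ε) * ‖v s‖ ^ 2 ≤ rate ε R * (t + (2 * ε)⁻¹) := by
  have hc := h.cont
  have hk : 0 ≤ cEmb / (2 * ε) := div_nonneg cEmb_nonneg (by positivity)
  have h0 : ‖M (Wi 1) (v 0)‖ ^ 2 ≤ R ^ 2 := pow_le_pow_left₀ (norm_nonneg _)
    ((norm_M_le_norm (isSymbol_Wi 1) (norm_Wi_le 1) _).trans hR) 2
  have h1 := h.energy le_rfl ht.1 ht.2
  have h2 : ∫ s in (0 : ℝ)..t, ‖M (Wi 1) (v s)‖ ^ 2 ≤ t * R ^ 2 := by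
    have : ∫ s in (0 : ℝ)..t, ‖M (Wi 1) (v s)‖ ^ 2 ≤ ∫ _ in (0 : ℝ)..t, R ^ 2 :=
      intervalIntegral.integral_mono_on ht.1 (Continuous.intervalIntegrable (by fun_prop) _ _)
        (Continuous.intervalIntegrable (by fun_prop) _ _) fun s hs =>
        (pow_le_pow_left₀ (norm_nonneg _)
          (h.norm_Wi_antitone hε le_rfl hs.1 (hs.2.trans ht.2)) 2).trans h0
    simpa using this
  have h3 : ∫ s in (0 : ℝ)..t, ‖M Di (v s)‖ ^ 2 ≤ R ^ 2 * (2 * ε)⁻¹ := by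
    rw [← div_eq_mul_inv, le_div_iff₀ (by positivity)]
    nlinarith [sq_nonneg ‖M (Wi 1) (v t)‖]
  rw [intervalIntegral.integral_const_mul]
  simp only [norm_sq_Wi_add_Di (v _)]
  rw [intervalIntegral.integral_add (Continuous.intervalIntegrable (by fun_prop) _ _)
    (Continuous.intervalIntegrable (by fun_prop) _ _), rate]
  calc _ ≤ cEmb / (2 * ε) * (t * R ^ 2 + R ^ 2 * (2 * ε)⁻¹) :=
        mul_le_mul_of_nonneg_left (add_le_add h2 h3) hk
    _ = _ := by ring

/-- Bound for the square of the `H¹` norm on `[0, T]`. -/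
def hBound (ε T R : ℝ) : ℝ := R ^ 2 * (1 + Real.exp (rate ε R * (T + (2 * ε)⁻¹)))

theorem hBound_nonneg (ε T R : ℝ) : 0 ≤ hBound ε T R := by unfold hBound; positivity

theorem FSol.norm_sq_le_hBound (h : FSol le_rfl ε T v) (hε : 0 < ε) {R : ℝ} (hR : ‖v 0‖ ≤ R)
    {t : ℝ} (ht : t ∈ Set.Icc 0 T) : ‖v t‖ ^ 2 ≤ hBound ε T R := by
  have h0 : ‖M (Wi 1) (v t)‖ ^ 2 ≤ R ^ 2 := pow_le_pow_left₀ (norm_nonneg _)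
    ((h.norm_Wi_antitone hε le_rfl ht.1 ht.2).trans
      ((norm_M_le_norm (isSymbol_Wi 1) (norm_Wi_le 1) _).trans hR)) 2
  have h1 : ‖M Di (v 0)‖ ^ 2 ≤ R ^ 2 := pow_le_pow_left₀ (norm_nonneg _)
    ((norm_M_le_norm isSymbol_Di norm_Di_le _).trans hR) 2
  have h2 := h.gradient_le hε ht
  have h3 : Real.exp (∫ s in (0 : ℝ)..t, cEmb / (2 * ε) * ‖v s‖ ^ 2) ≤
      Real.exp (rate ε R * (T + (2 * ε)⁻¹)) :=
    Real.exp_le_exp.2 ((h.integral_sq_le hε hR ht).trans (mul_le_mul_of_nonneg_left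
      (add_le_add_left ht.2 _) (rate_nonneg hε R)))
  rw [norm_sq_Wi_add_Di, hBound, mul_add, mul_one]
  refine add_le_add h0 (h2.trans ?_)
  gcongr

/-- The constant in the gradient estimate. -/
def gradConst (ε R : ℝ) : ℝ :=
  (cEmb / (2 * ε) * hBound ε 1 R + rate ε R * (1 + (2 * ε)⁻¹)) / 2

theorem FSol.gradient_le_exp (h : FSol le_rfl ε T v) (hε : 0 < ε) {R : ℝ} (hR : ‖v 0‖ ≤ R) {t : ℝ}
    (ht : t ∈ Set.Icc 0 T) :
    ‖M Di (v t)‖ ≤ ‖M Di (v 0)‖ * Real.exp (gradConst ε R * t) := by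
  have hc := h.cont
  have hk : 0 ≤ cEmb / (2 * ε) := div_nonneg cEmb_nonneg (by positivity)
  have h4 : 0 ≤ cEmb / (2 * ε) * hBound ε 1 R := mul_nonneg hk (hBound_nonneg _ _ _)
  have h5 : 0 ≤ rate ε R * (1 + (2 * ε)⁻¹) := mul_nonneg (rate_nonneg hε R) (by positivity)
  have key : ∫ s in (0 : ℝ)..t, cEmb / (2 * ε) * ‖v s‖ ^ 2 ≤ 2 * (gradConst ε R * t) := by
    rw [gradConst]
    -- The exponent must be at most a constant times t. The bound `rate ε R * (t + (2 * ε)⁻¹)` does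
    -- not vanish at t = 0, so for t ≤ 1 the integrand is bounded pointwise instead; for t ≥ 1 the
    -- constant term is absorbed into t.
    rcases le_total t 1 with h1 | h1
    · have h2 : ∫ s in (0 : ℝ)..t, cEmb / (2 * ε) * ‖v s‖ ^ 2 ≤
          ∫ _ in (0 : ℝ)..t, cEmb / (2 * ε) * hBound ε 1 R := by
        refine intervalIntegral.integral_mono_on ht.1 (Continuous.intervalIntegrable (by fun_prop)
          _ _) (Continuous.intervalIntegrable (by fun_prop) _ _) fun s hs => ?_
        refine mul_le_mul_of_nonneg_left ?_ hk
        refine ((h.mono ht.2).norm_sq_le_hBound hε hR hs).trans ?_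
        unfold hBound
        have := rate_nonneg hε R
        gcongr
      rw [intervalIntegral.integral_const, sub_zero, smul_eq_mul] at h2
      nlinarith [mul_nonneg h5 ht.1]
    · refine (h.integral_sq_le hε hR ht).trans ?_
      have h2 : t + (2 * ε)⁻¹ ≤ (1 + (2 * ε)⁻¹) * t := by
        have : 0 ≤ (2 * ε)⁻¹ := by positivity
        nlinarith
      have h3 := mul_le_mul_of_nonneg_left h2 (rate_nonneg hε R)
      nlinarith [mul_nonneg h4 ht.1]
  refine le_of_sq_le_sq ?_ (mul_nonneg (norm_nonneg _) (Real.exp_nonneg _))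
  rw [mul_pow, ← Real.exp_nat_mul]
  refine (h.gradient_le hε ht).trans ?_
  push_cast
  gcongr

/-- The constant in the `Hⁿ` estimate. -/
def regConst (n : ℕ) (ε T R : ℝ) : ℝ :=
  (8 * ε)⁻¹ * (2 ^ (n + 1)) ^ 2 * cEmb * hBound ε T R / 2

/-- `M (Wi k) v` represents w in H¹, and its norm alone controls ‖ŵ‖_{L¹}. The growth rate in
H^{k+1} therefore depends only on the H¹ norm of the data. -/
theorem FSol.norm_le_exp {k : ℕ} {hk : 1 ≤ k + 1} (h : FSol hk ε T v) (hε : 0 < ε) {R : ℝ}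
    (hR : ‖M (Wi k) (v 0)‖ ≤ R) {t : ℝ} (ht : t ∈ Set.Icc 0 T) :
    ‖v t‖ ≤ ‖v 0‖ * Real.exp (regConst (k + 1) ε T R * t) := by
  have hc := h.cont
  have hb := continuous_bil_self hk hc
  have hl := h.lower (n := 1) le_rfl
  have hC := cEmb_nonneg
  set D := (8 * ε)⁻¹ * (2 ^ (k + 1 + 1)) ^ 2 * cEmb with hD
  have hD0 : 0 ≤ D := by positivity
  have g : ‖v t‖ ^ 2 ≤ ‖v 0‖ ^ 2 *
      Real.exp (∫ s in (0 : ℝ)..t, D * ‖M (Wi k) (v s)‖ ^ 2) := by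
    refine gronwall_integral (T := T) (y := fun t => ‖v t‖ ^ 2)
      (b := fun s => D * ‖M (Wi k) (v s)‖ ^ 2)
      (by fun_prop) (by fun_prop) (fun s => by positivity) (fun t ht => ?_) ht
    refine (h.eq.norm_sq_le hε (by fun_prop) (by fun_prop) ht).trans (add_le_add_right ?_ _)
    refine intervalIntegral.integral_mono_on ht.1
      (Continuous.intervalIntegrable (by fun_prop) _ _)
      (Continuous.intervalIntegrable (by fun_prop) _ _) fun s _ => ?_
    have h1 := pow_le_pow_left₀ (norm_nonneg _) (norm_bil_self_le hk (v s)) 2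
    have h2 : l1 (M (Wi (k + 1)) (v s)) ^ 2 ≤ cEmb * ‖M (Wi k) (v s)‖ ^ 2 := by
      rw [add_comm k 1, M_Wi_add]
      exact sq_l1_Wi_le le_rfl _
    calc (8 * ε)⁻¹ * ‖bil hk (v s) (v s)‖ ^ 2
        ≤ (8 * ε)⁻¹ * (2 ^ (k + 1 + 1) * l1 (M (Wi (k + 1)) (v s)) * ‖v s‖) ^ 2 := by gcongr
      _ = (8 * ε)⁻¹ * ((2 ^ (k + 1 + 1)) ^ 2 * l1 (M (Wi (k + 1)) (v s)) ^ 2 * ‖v s‖ ^ 2) := by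
        rw [mul_pow, mul_pow]
      _ ≤ (8 * ε)⁻¹ * ((2 ^ (k + 1 + 1)) ^ 2 * (cEmb * ‖M (Wi k) (v s)‖ ^ 2) * ‖v s‖ ^ 2) := by
        gcongr
      _ = _ := by rw [hD]; ring
  have key : ∫ s in (0 : ℝ)..t, D * ‖M (Wi k) (v s)‖ ^ 2 ≤
      2 * (regConst (k + 1) ε T R * t) := by
    have h2 : ∫ s in (0 : ℝ)..t, D * ‖M (Wi k) (v s)‖ ^ 2 ≤
        ∫ _ in (0 : ℝ)..t, D * hBound ε T R := by
      refine intervalIntegral.integral_mono_on ht.1 (Continuous.intervalIntegrable (by fun_prop)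
        _ _) (Continuous.intervalIntegrable (by fun_prop) _ _) fun s hs => ?_
      exact mul_le_mul_of_nonneg_left (hl.norm_sq_le_hBound hε hR ⟨hs.1, hs.2.trans ht.2⟩) hD0
    refine h2.trans (le_of_eq ?_)
    rw [intervalIntegral.integral_const, sub_zero, smul_eq_mul, regConst]
    ring
  refine le_of_sq_le_sq ?_ (mul_nonneg (norm_nonneg _) (Real.exp_nonneg _))
  rw [mul_pow, ← Real.exp_nat_mul]
  refine g.trans ?_
  push_cast
  gcongr

/-- Uniqueness. -/
theorem SolvesEq.unique {hn : 1 ≤ n} (hε : 0 < ε) (hv : Continuous v) (hv' : Continuous v')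
    (h : SolvesEq ε T v fun t => bil hn (v t) (v t))
    (h' : SolvesEq ε T v' fun t => bil hn (v' t) (v' t)) (h0 : v 0 = v' 0) {t : ℝ}
    (ht : t ∈ Set.Icc 0 T) : v t = v' t := by
  set L := 2 ^ n * (2 * Real.sqrt cEmb) with hL
  -- a² - b² = (a - b)a + b(a - b), so the difference obeys a linear inequality with zero initial
  -- value.
  have e : ∀ a b : L2c, bil hn a a - bil hn b b = bil hn (a - b) a + bil hn b (a - b) := by
    intro a b
    simp only [map_sub, sub_apply]
    abel
  have hs := h.sub h' hv (continuous_bil_self hn hv) hv' (continuous_bil_self hn hv')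
  have g : ‖v t - v' t‖ ^ 2 ≤ 0 * Real.exp
      (∫ s in (0 : ℝ)..t, (8 * ε)⁻¹ * (L * (‖v s‖ + ‖v' s‖)) ^ 2) := by
    refine gronwall_integral (T := T) (y := fun t => ‖v t - v' t‖ ^ 2)
      (b := fun s => (8 * ε)⁻¹ * (L * (‖v s‖ + ‖v' s‖)) ^ 2)
      (by fun_prop) (by fun_prop) (fun s => by positivity) (fun t ht => ?_) ht
    have h1 := hs.norm_sq_le hε (by fun_prop) (by fun_prop) ht
    rw [h0, sub_self, norm_zero, zero_pow two_ne_zero] at h1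
    refine h1.trans (add_le_add_right ?_ _)
    refine intervalIntegral.integral_mono_on ht.1
      (Continuous.intervalIntegrable (by fun_prop) _ _)
      (Continuous.intervalIntegrable (by fun_prop) _ _) fun s _ => ?_
    have h2 : ‖bil hn (v s) (v s) - bil hn (v' s) (v' s)‖ ≤
        L * (‖v s‖ + ‖v' s‖) * ‖v s - v' s‖ := by
      rw [e]
      refine (norm_add_le _ _).trans ((add_le_add (norm_bil_apply_le hn _ _)
        (norm_bil_apply_le hn _ _)).trans (le_of_eq ?_))
      rw [hL]
      ring
    calc _ ≤ (8 * ε)⁻¹ * (L * (‖v s‖ + ‖v' s‖) * ‖v s - v' s‖) ^ 2 := by gcongr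
      _ = _ := by ring
  rw [zero_mul] at g
  have : ‖v t - v' t‖ = 0 := by
    have := sq_nonneg ‖v t - v' t‖
    exact pow_eq_zero_iff two_ne_zero |>.1 (le_antisymm g this)
  exact sub_eq_zero.1 (norm_eq_zero.1 this)

/-! ### A Volterra equation with integrable kernel -/

section Volterra

open BoundedContinuousFunction

/-- The integrand of the Volterra operator. -/
def volterra (k : ℝ → L2c →L[ℂ] L2c) (N : ℝ → L2c → L2c) (z : ℝ → L2c) (t r : ℝ) : L2c :=
  Set.indicator (Set.Iio t) (fun r => k r (N (t - r) (z (t - r)))) r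

/-- Hypotheses on the kernel and on the nonlinearity. -/
structure VolterraData (k : ℝ → L2c →L[ℂ] L2c) (κ : ℝ → ℝ) (N : ℝ → L2c → L2c) (q : ℝ) : Prop where
  integrable : IntegrableOn κ (Set.Ioi 0)
  bound : ∀ r > 0, ‖k r‖ ≤ κ r
  kcont : ∀ g : ℝ → L2c, Continuous g → ContinuousOn (fun r => k r (g r)) (Set.Ioi 0)
  q_nonneg : 0 ≤ q
  lip : ∀ s x y, ‖N s x - N s y‖ ≤ q * ‖x - y‖
  zero : ∀ s, N s 0 = 0
  ncont : ∀ g : ℝ → L2c, Continuous g → Continuous fun s => N s (g s)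

variable {k : ℝ → L2c →L[ℂ] L2c} {κ : ℝ → ℝ} {N : ℝ → L2c → L2c} {q : ℝ}

namespace VolterraData

theorem kappa_nonneg (h : VolterraData k κ N q) {r : ℝ} (hr : 0 < r) : 0 ≤ κ r :=
  (norm_nonneg _).trans (h.bound r hr)

theorem aestronglyMeasurable (h : VolterraData k κ N q) {z : ℝ → L2c} (hz : Continuous z) (t : ℝ) :
    AEStronglyMeasurable (volterra k N z t) (volume.restrict (Set.Ioi 0)) := by
  refine AEStronglyMeasurable.indicator ?_ measurableSet_Iio
  refine ContinuousOn.aestronglyMeasurable ?_ measurableSet_Ioi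
  exact h.kcont (fun r => N (t - r) (z (t - r)))
    ((h.ncont z hz).comp (continuous_const.sub continuous_id))

theorem norm_volterra_le (h : VolterraData k κ N q) (z : ℝ →ᵇ L2c) (t : ℝ) {r : ℝ} (hr : 0 < r) :
    ‖volterra k N z t r‖ ≤ κ r * (q * ‖z‖) := by
  refine (norm_indicator_le_norm_self _ _).trans (((k r).le_opNorm _).trans ?_)
  have h1 : ‖N (t - r) (z (t - r))‖ ≤ q * ‖z‖ := by
    have := h.lip (t - r) (z (t - r)) 0
    rw [h.zero, sub_zero, sub_zero] at this
    exact this.trans (mul_le_mul_of_nonneg_left (z.norm_coe_le_norm _) h.q_nonneg)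
  exact mul_le_mul (h.bound r hr) h1 (norm_nonneg _) (h.kappa_nonneg hr)

theorem integrable_volterra (h : VolterraData k κ N q) (z : ℝ →ᵇ L2c) (t : ℝ) :
    IntegrableOn (volterra k N z t) (Set.Ioi 0) := by
  refine (h.integrable.mul_const (q * ‖z‖)).mono' (h.aestronglyMeasurable z.continuous t) ?_
  filter_upwards [ae_restrict_mem measurableSet_Ioi] with r hr
  exact h.norm_volterra_le z t hr

theorem continuous_integral (h : VolterraData k κ N q) (z : ℝ →ᵇ L2c) :
    Continuous fun t => ∫ r in Set.Ioi (0 : ℝ), volterra k N z t r := by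
  refine continuous_iff_continuousAt.2 fun t₀ => ?_
  refine continuousAt_of_dominated (bound := fun r => κ r * (q * ‖z‖))
    (Eventually.of_forall fun t => h.aestronglyMeasurable z.continuous t)
    (Eventually.of_forall fun t => ?_) (h.integrable.mul_const _) ?_
  · filter_upwards [ae_restrict_mem measurableSet_Ioi] with r hr
    exact h.norm_volterra_le z t hr
  · filter_upwards [ae_restrict_of_ae (Measure.ae_ne volume t₀)] with r hr
    have hc : Continuous fun t => k r (N (t - r) (z (t - r))) :=
      (k r).continuous.comp ((h.ncont z z.continuous).comp (continuous_id.sub continuous_const))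
    rcases lt_or_gt_of_ne hr with h1 | h1
    · refine hc.continuousAt.congr ?_
      filter_upwards [lt_mem_nhds h1] with t ht
      rw [volterra, Set.indicator_of_mem]
      exact ht
    · refine (continuousAt_const (y := (0 : L2c))).congr ?_
      filter_upwards [gt_mem_nhds h1] with t ht
      rw [volterra, Set.indicator_of_notMem]
      exact not_lt.2 (le_of_lt ht)

theorem norm_integral_sub_le (h : VolterraData k κ N q) (z z' : ℝ →ᵇ L2c) (t : ℝ) :
    ‖(∫ r in Set.Ioi (0 : ℝ), volterra k N z t r) - ∫ r in Set.Ioi (0 : ℝ), volterra k N z' t r‖ ≤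
      (∫ r in Set.Ioi (0 : ℝ), κ r) * q * ‖z - z'‖ := by
  rw [← integral_sub (h.integrable_volterra z t) (h.integrable_volterra z' t)]
  have e : (∫ r in Set.Ioi (0 : ℝ), κ r) * q * ‖z - z'‖ =
      ∫ r in Set.Ioi (0 : ℝ), κ r * (q * ‖z - z'‖) := by
    rw [integral_mul_const, mul_assoc]
  rw [e]
  refine norm_integral_le_of_norm_le (h.integrable.mul_const _) ?_
  filter_upwards [ae_restrict_mem measurableSet_Ioi] with r hr
  rw [volterra, volterra, ← Pi.sub_apply (Set.indicator _ _), ← Set.indicator_sub']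
  refine (norm_indicator_le_norm_self _ _).trans ?_
  rw [Pi.sub_apply, ← map_sub]
  refine ((k r).le_opNorm _).trans (mul_le_mul (h.bound r hr) ?_ (norm_nonneg _)
    (h.kappa_nonneg hr))
  exact (h.lip _ _ _).trans (mul_le_mul_of_nonneg_left ((z - z').norm_coe_le_norm _) h.q_nonneg)

/-- Banach's fixed point theorem in the bounded continuous functions on ℝ; the contraction factor is
the L¹ norm of the kernel bound times the Lipschitz constant. -/
theorem exists_solution (h : VolterraData k κ N q) (hq : (∫ r in Set.Ioi (0 : ℝ), κ r) * q < 1)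
    (a : ℝ →ᵇ L2c) :
    ∃ z : ℝ →ᵇ L2c, ∀ t, z t = a t + ∫ r in Set.Ioi (0 : ℝ), volterra k N z t r := by
  have hI : 0 ≤ ∫ r in Set.Ioi (0 : ℝ), κ r :=
    setIntegral_nonneg measurableSet_Ioi fun r hr => h.kappa_nonneg hr
  let Ψ : (ℝ →ᵇ L2c) → (ℝ →ᵇ L2c) := fun z =>
    a + BoundedContinuousFunction.ofNormedAddCommGroup
      (fun t => ∫ r in Set.Ioi (0 : ℝ), volterra k N z t r) (h.continuous_integral z)
      ((∫ r in Set.Ioi (0 : ℝ), κ r) * (q * ‖z‖)) (fun t => by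
        rw [← integral_mul_const]
        refine norm_integral_le_of_norm_le (h.integrable.mul_const _) ?_
        filter_upwards [ae_restrict_mem measurableSet_Ioi] with r hr
        exact h.norm_volterra_le z t hr)
  have hc : ContractingWith ⟨_, mul_nonneg hI h.q_nonneg⟩ Ψ := by
    refine ⟨by exact_mod_cast hq, LipschitzWith.of_dist_le_mul fun z z' => ?_⟩
    rw [dist_eq_norm, dist_eq_norm]
    refine (BoundedContinuousFunction.norm_le
      (mul_nonneg (mul_nonneg hI h.q_nonneg) (norm_nonneg _))).2 fun t => ?_
    simp only [Ψ, add_sub_add_left_eq_sub]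
    exact h.norm_integral_sub_le z z' t
  refine ⟨hc.fixedPoint, fun t => ?_⟩
  exact (congrFun (congrArg (fun z : ℝ →ᵇ L2c => (z : ℝ → L2c)) hc.fixedPoint_isFixedPt) t).symm

theorem solution_unique (h : VolterraData k κ N q) (hq : (∫ r in Set.Ioi (0 : ℝ), κ r) * q < 1)
    {a : ℝ → L2c} {z z' : ℝ →ᵇ L2c}
    (hz : ∀ t, z t = a t + ∫ r in Set.Ioi (0 : ℝ), volterra k N z t r)
    (hz' : ∀ t, z' t = a t + ∫ r in Set.Ioi (0 : ℝ), volterra k N z' t r) : z = z' := by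
  have hI : 0 ≤ ∫ r in Set.Ioi (0 : ℝ), κ r :=
    setIntegral_nonneg measurableSet_Ioi fun r hr => h.kappa_nonneg hr
  have h1 : ‖z - z'‖ ≤ (∫ r in Set.Ioi (0 : ℝ), κ r) * q * ‖z - z'‖ := by
    refine (BoundedContinuousFunction.norm_le
      (mul_nonneg (mul_nonneg hI h.q_nonneg) (norm_nonneg _))).2 fun t => ?_
    rw [BoundedContinuousFunction.sub_apply, hz, hz', add_sub_add_left_eq_sub]
    exact h.norm_integral_sub_le z z' t
  have h2 : ‖z - z'‖ = 0 := by nlinarith [norm_nonneg (z - z')]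
  exact sub_eq_zero.1 (norm_eq_zero.1 h2)

end VolterraData

end Volterra

/-! ### The radial retraction -/

/-- The retraction onto the ball of radius `R`. -/
def retr (R : ℝ) (v : L2c) : L2c := min 1 (R / ‖v‖) • v

variable {R : ℝ}

theorem retr_of_le {v : L2c} (h : ‖v‖ ≤ R) : retr R v = v := by
  by_cases h0 : v = 0
  · simp [retr, h0]
  · have : 1 ≤ R / ‖v‖ := (one_le_div (norm_pos_iff.2 h0)).2 h
    rw [retr, min_eq_left this, one_smul]

theorem norm_retr_le (hR : 0 ≤ R) (v : L2c) : ‖retr R v‖ ≤ R := by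
  rcases le_total ‖v‖ R with h | h
  · rwa [retr_of_le h]
  · rw [retr, norm_smul, Real.norm_of_nonneg (le_min zero_le_one (by positivity))]
    calc _ ≤ R / ‖v‖ * ‖v‖ := by gcongr; exact min_le_right _ _
      _ ≤ R := by
        rcases (norm_nonneg v).eq_or_lt with h0 | h0
        · simpa [← h0] using hR
        · rw [div_mul_cancel₀ _ h0.ne']

/-- With scaling factors c, d and ‖w‖ ≤ ‖v‖, the difference is c(v - w) + (c - d)w. The second term
has norm at most ‖v‖ - ‖w‖, whence the constant 2. -/
theorem norm_retr_sub_le (hR : 0 ≤ R) (v w : L2c) : ‖retr R v - retr R w‖ ≤ 2 * ‖v - w‖ := by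
  wlog hvw : ‖w‖ ≤ ‖v‖ generalizing v w
  · rw [norm_sub_rev, norm_sub_rev v]
    exact this w v (le_of_not_ge hvw)
  rcases le_total ‖v‖ R with h | h
  · rw [retr_of_le h, retr_of_le (hvw.trans h)]
    linarith [norm_nonneg (v - w)]
  · by_cases h0 : v = 0
    · have : w = 0 := norm_le_zero_iff.1 (by simpa [h0] using hvw)
      simp [h0, this]
    have hv : 0 < ‖v‖ := norm_pos_iff.2 h0
    set c := min 1 (R / ‖v‖) with hc
    set d := min 1 (R / ‖w‖) with hd
    have hc0 : 0 ≤ c := le_min zero_le_one (by positivity)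
    have hc1 : c ≤ 1 := min_le_left _ _
    have hce : c = R / ‖v‖ := min_eq_right ((div_le_one hv).2 h)
    have e : retr R v - retr R w = c • (v - w) + (c - d) • w := by
      simp only [retr, ← hc, ← hd, smul_sub, sub_smul]
      abel
    have h2 : ‖(c - d) • w‖ ≤ ‖v‖ - ‖w‖ := by
      rw [norm_smul, Real.norm_eq_abs]
      by_cases hw0 : w = 0
      · simp [hw0]
      have hw : 0 < ‖w‖ := norm_pos_iff.2 hw0
      have hcd : c ≤ d := by
        rw [hc, hd]
        gcongr
      rw [abs_of_nonpos (by linarith), neg_sub, sub_mul]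
      have h3 : c * ‖v‖ = R := by rw [hce]; field_simp
      have h4 : d * ‖w‖ ≤ ‖w‖ := by nlinarith [min_le_left 1 (R / ‖w‖)]
      have h5 : d * ‖w‖ ≤ R := by
        calc _ ≤ R / ‖w‖ * ‖w‖ := by gcongr; exact min_le_right _ _
          _ = R := by field_simp
      nlinarith
    rw [e]
    refine (norm_add_le _ _).trans ?_
    rw [norm_smul, Real.norm_of_nonneg hc0]
    have h6 : ‖v‖ - ‖w‖ ≤ ‖v - w‖ := norm_sub_norm_le v w
    nlinarith [norm_nonneg (v - w)]

theorem retr_J (v : L2c) : retr R (J v) = J (retr R v) := by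
  rw [retr, retr, norm_J, map_smul]

/-- The globally Lipschitz nonlinearity. -/
def nonlin {n : ℕ} (hn : 1 ≤ n) (R : ℝ) (v : L2c) : L2c := bil hn (retr R v) (retr R v)

variable {n : ℕ} {hn : 1 ≤ n}

theorem nonlin_of_le {v : L2c} (h : ‖v‖ ≤ R) : nonlin hn R v = bil hn v v := by
  rw [nonlin, retr_of_le h]

theorem nonlin_zero (hR : 0 ≤ R) : nonlin hn R 0 = 0 := by
  rw [nonlin_of_le (by simpa using hR), map_zero]

theorem nonlin_J (v : L2c) : nonlin hn R (J v) = J (nonlin hn R v) := by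
  rw [nonlin, nonlin, J_bil, retr_J]

/-- A Lipschitz constant for `nonlin`. -/
def lipConst (n : ℕ) (R : ℝ) : ℝ := 2 ^ n * (2 * Real.sqrt cEmb) * (4 * R)

theorem lipConst_nonneg (hR : 0 ≤ R) : 0 ≤ lipConst n R := by unfold lipConst; positivity

theorem nonlin_lip (hR : 0 ≤ R) (v w : L2c) :
    ‖nonlin hn R v - nonlin hn R w‖ ≤ lipConst n R * ‖v - w‖ := by
  set a := retr R v with ha
  set b := retr R w with hb
  have e : nonlin hn R v - nonlin hn R w = bil hn (a - b) a + bil hn b (a - b) := by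
    rw [nonlin, nonlin, ← ha, ← hb]
    simp only [map_sub, sub_apply]
    abel
  have h1 := norm_retr_sub_le hR v w
  have h2 : ‖a‖ ≤ R := norm_retr_le hR v
  have h3 : ‖b‖ ≤ R := norm_retr_le hR w
  rw [e]
  set L := 2 ^ n * (2 * Real.sqrt cEmb) with hL
  have hL0 : 0 ≤ L := by positivity
  calc _ ≤ L * ‖a - b‖ * ‖a‖ + L * ‖b‖ * ‖a - b‖ :=
        (norm_add_le _ _).trans (add_le_add (norm_bil_apply_le hn _ _) (norm_bil_apply_le hn _ _))
    _ ≤ L * (2 * ‖v - w‖) * R + L * R * (2 * ‖v - w‖) := by gcongr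
    _ = _ := by rw [lipConst, ← hL]; ring

theorem continuous_nonlin (hR : 0 ≤ R) : Continuous (nonlin hn R) :=
  (LipschitzWith.of_dist_le_mul (K := ⟨_, lipConst_nonneg hR⟩) fun v w => by
    rw [dist_eq_norm, dist_eq_norm]
    exact nonlin_lip hR v w).continuous

/-! ### The heat semigroup and the mild formulation -/

/-- The symbol of the heat semigroup. -/
def symH (ε t ξ : ℝ) : ℂ := ((Real.exp (-(ε * (2 * Real.pi * ξ) ^ 2) * t) : ℝ) : ℂ)

/-- The symbol of `-∂ₓ/2` composed with the heat semigroup. -/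
def symK (ε t ξ : ℝ) : ℂ :=
  ((-(Real.pi * ξ) : ℝ) : ℂ) * Complex.I * symH ε t ξ

/-- The truncated heat group. -/
def symG (ε : ℝ) (K : ℕ) (t ξ : ℝ) : ℂ := cut K ξ * symH ε t ξ

theorem norm_symH (ε t ξ : ℝ) : ‖symH ε t ξ‖ = Real.exp (-(ε * (2 * Real.pi * ξ) ^ 2) * t) := by
  rw [symH, Complex.norm_real, Real.norm_of_nonneg (Real.exp_nonneg _)]

theorem continuous_symH (ε t : ℝ) : Continuous (symH ε t) := by unfold symH; fun_prop

theorem symH_add (ε s t ξ : ℝ) : symH ε (s + t) ξ = symH ε s ξ * symH ε t ξ := by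
  rw [symH, symH, symH, ← Complex.ofReal_mul, ← Real.exp_add, mul_add]

theorem symH_zero (ε ξ : ℝ) : symH ε 0 ξ = 1 := by simp [symH]

variable {ε : ℝ}

theorem norm_symH_le (hε : 0 < ε) {t : ℝ} (ht : 0 ≤ t) (ξ : ℝ) : ‖symH ε t ξ‖ ≤ 1 := by
  rw [norm_symH]
  exact Real.exp_le_one_iff.2 (by rw [neg_mul]; exact neg_nonpos.2 (by positivity))

theorem isSymbol_symH (hε : 0 < ε) {t : ℝ} (ht : 0 ≤ t) : IsSymbol (symH ε t) :=
  .of_le (continuous_symH ε t).measurable (norm_symH_le hε ht)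

/-- Parabolic smoothing: one derivative of the heat semigroup costs (εt)^{-1/2}, because z ≤ 1 + z²
≤ exp(z²) with z = (εt)^{1/2} |2πξ|. The singularity at t = 0 is integrable. -/
theorem norm_symK_le (hε : 0 < ε) {t : ℝ} (ht : 0 < t) (ξ : ℝ) :
    ‖symK ε t ξ‖ ≤ (Real.sqrt (ε * t))⁻¹ := by
  have h0 : 0 < Real.sqrt (ε * t) := Real.sqrt_pos.2 (by positivity)
  rw [symK, norm_mul, norm_symH, norm_mul, Complex.norm_I, mul_one, Complex.norm_real, norm_neg,
    Real.norm_eq_abs]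
  set y := |2 * Real.pi * ξ| with hy
  have h1 : |Real.pi * ξ| ≤ y := by
    rw [hy, mul_assoc, abs_mul 2, abs_two]
    linarith [abs_nonneg (Real.pi * ξ)]
  have h2 : (2 * Real.pi * ξ) ^ 2 = y ^ 2 := (sq_abs _).symm
  have h3 : (Real.sqrt (ε * t) * y) ^ 2 = ε * y ^ 2 * t := by
    rw [mul_pow, Real.sq_sqrt (by positivity)]
    ring
  have h4 : Real.sqrt (ε * t) * y ≤ Real.exp (ε * y ^ 2 * t) := by
    rw [← h3]
    have := Real.add_one_le_exp ((Real.sqrt (ε * t) * y) ^ 2)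
    nlinarith [sq_nonneg (Real.sqrt (ε * t) * y - 1)]
  rw [h2, neg_mul, Real.exp_neg, ← div_eq_mul_inv, div_le_iff₀ (Real.exp_pos _),
    ← div_eq_inv_mul, le_div_iff₀ h0]
  calc _ ≤ y * Real.sqrt (ε * t) := by gcongr
    _ ≤ _ := by rwa [mul_comm]

theorem continuous_symK (ε t : ℝ) : Continuous (symK ε t) := by
  have := continuous_symH ε t
  unfold symK
  fun_prop

theorem isSymbol_symK (hε : 0 < ε) {t : ℝ} (ht : 0 < t) : IsSymbol (symK ε t) :=
  .of_le (continuous_symK ε t).measurable (norm_symK_le hε ht)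

theorem symH_herm (ε t ξ : ℝ) : (starRingEnd ℂ) (symH ε t (-ξ)) = symH ε t ξ := by
  simp only [symH, mul_neg, neg_sq, Complex.conj_ofReal]

theorem symK_herm (ε t ξ : ℝ) : (starRingEnd ℂ) (symK ε t (-ξ)) = symK ε t ξ := by
  simp only [symK, map_mul, symH_herm, Complex.conj_ofReal, Complex.conj_I]
  push_cast
  ring

theorem isSymbol_symG (ε : ℝ) (K : ℕ) (t : ℝ) : IsSymbol (symG ε K t) :=
  isSymbol_cut_mul K (continuous_symH ε t)

/-- With frequencies bounded, the heat flow is a group and may also be run backwards in time. -/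
theorem M_symG_add (K : ℕ) (s t : ℝ) (f : L2c) :
    M (symG ε K (s + t)) f = M (symG ε K s) (M (symG ε K t) f) := by
  rw [M_M (isSymbol_symG ε K s) (isSymbol_symG ε K t)]
  congr 2
  ext ξ
  rw [symG, symG, symG, symH_add, mul_mul_mul_comm, cut_mul_self]

/-- The truncated generator is bounded, so the flow is differentiable in operator norm; the Taylor
remainder of the symbol is O(h²) uniformly in frequency. -/
theorem hasDerivAt_M_symG (hε : 0 < ε) (K : ℕ) (t : ℝ) :
    HasDerivAt (fun t => M (symG ε K t)) ((M (symA ε K)).comp (M (symG ε K t))) t := by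
  set B := ε * (2 * Real.pi * K) ^ 2 with hB
  have hB0 : 0 ≤ B := by positivity
  rw [hasDerivAt_iff_isLittleO_nhds_zero]
  have big : (fun h : ℝ => M (symG ε K (t + h)) - M (symG ε K t) -
      h • (M (symA ε K)).comp (M (symG ε K t))) =O[𝓝 0] fun h : ℝ => h ^ 2 := by
    refine Asymptotics.IsBigO.of_bound (Real.exp (B * |t|) * B ^ 2) ?_
    -- On this ball B|h| < 1, as the quadratic bound for exp(x) - 1 - x requires.
    filter_upwards [Metric.ball_mem_nhds (0 : ℝ) (by positivity : 0 < (B + 1)⁻¹)] with h hh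
    have hh' : |h| * (B + 1) < 1 := by
      rw [Metric.mem_ball, dist_zero_right, Real.norm_eq_abs] at hh
      rwa [← lt_div_iff₀ (by positivity), one_div]
    refine ContinuousLinearMap.opNorm_le_bound _ (by positivity) fun f => ?_
    refine Lp.norm_le_mul_norm_of_ae_le_mul ?_
    have hG := isSymbol_symG ε K t
    have hA := isSymbol_symA ε K
    filter_upwards [coeFn_M (isSymbol_symG ε K (t + h)) f, coeFn_M hG f,
      coeFn_M hA (M (symG ε K t) f),
      Lp.coeFn_sub (M (symG ε K (t + h)) f - M (symG ε K t) f)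
        (h • M (symA ε K) (M (symG ε K t) f)),
      Lp.coeFn_sub (M (symG ε K (t + h)) f) (M (symG ε K t) f),
      Lp.coeFn_smul h (M (symA ε K) (M (symG ε K t) f))] with x h1 h2 h3 h4 h5 h6
    simp only [sub_apply, smul_apply, ContinuousLinearMap.coe_comp, Function.comp_apply]
    rw [h4, Pi.sub_apply, h5, Pi.sub_apply, h6, Pi.smul_apply, h1, h3, h2]
    rcases cut_cases K x with hc | ⟨hc, hx⟩
    · simp only [symG, symA, hc]
      simp only [zero_mul, sub_self, smul_zero, norm_zero]
      positivity
    · set b := ε * (2 * Real.pi * x) ^ 2 with hb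
      have hb0 : 0 ≤ b := by positivity
      have hbB : b ≤ B := by
        rw [hb, hB]
        refine mul_le_mul_of_nonneg_left ?_ hε.le
        rw [mul_pow, mul_pow _ (K : ℝ), ← sq_abs x]
        gcongr
      have e : symG ε K (t + h) x * f x - symG ε K t x * f x -
          h • (symA ε K x * (symG ε K t x * f x)) =
          ((Real.exp (-b * t) * (Real.exp (-b * h) - 1 - (-b * h)) : ℝ) : ℂ) * f x := by
        simp only [symG, symA, hc, symH_add, Complex.real_smul]
        simp only [symH, ← hb]
        push_cast
        ring
      rw [e, norm_mul, Complex.norm_real, norm_mul, Real.norm_of_nonneg (Real.exp_nonneg _),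
        Real.norm_eq_abs]
      refine mul_le_mul_of_nonneg_right ?_ (norm_nonneg _)
      have hbh : |-b * h| ≤ B * |h| := by
        rw [abs_mul, abs_neg, abs_of_nonneg hb0]
        gcongr
      have h7 : |Real.exp (-b * h) - 1 - -b * h| ≤ (-b * h) ^ 2 :=
        Real.abs_exp_sub_one_sub_id_le (by nlinarith [abs_nonneg h])
      have h8 : (-b * h) ^ 2 ≤ B ^ 2 * h ^ 2 := by
        rw [← sq_abs, ← sq_abs h, ← mul_pow]
        gcongr
      have h9 : Real.exp (-b * t) ≤ Real.exp (B * |t|) := by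
        refine Real.exp_le_exp.2 ((le_abs_self _).trans ?_)
        rw [abs_mul, abs_neg, abs_of_nonneg hb0]
        gcongr
      rw [Real.norm_eq_abs, abs_of_nonneg (sq_nonneg h), mul_assoc]
      exact mul_le_mul h9 (h7.trans h8) (abs_nonneg _) (Real.exp_nonneg _)
  refine big.trans_isLittleO ?_
  exact Asymptotics.isLittleO_pow_id (by norm_num)

theorem continuous_M_symG (hε : 0 < ε) (K : ℕ) : Continuous fun t => M (symG ε K t) :=
  continuous_iff_continuousAt.2 fun t => (hasDerivAt_M_symG hε K t).continuousAt

/-- Duhamel's formula gives the truncated equation. -/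
theorem SolvesEq.of_mild (hε : 0 < ε) {v G : ℝ → L2c} (hG : Continuous G) {v₀ : L2c}
    (hint : ∀ t, 0 ≤ t → IntervalIntegrable (fun r => M (symK ε r) (G (t - r))) volume 0 t)
    (h : ∀ t, 0 ≤ t → v t = M (symH ε t) v₀ + ∫ r in (0 : ℝ)..t, M (symK ε r) (G (t - r)))
    (T : ℝ) : SolvesEq ε T v G := by
  intro K
  -- Variation of constants: g is the truncated solution pulled back to time 0 by the inverse flow,
  -- so `y` can be differentiated by the product rule.
  set g : ℝ → L2c := fun t => M (cut K) v₀ +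
    ∫ s in (0 : ℝ)..t, M (symG ε K (-s)) (M (symD K) (G s)) with hg
  set y : ℝ → L2c := fun t => M (symG ε K t) (g t) with hy
  have hcont : Continuous fun s => M (symG ε K (-s)) (M (symD K) (G s)) :=
    ((continuous_M_symG hε K).comp continuous_neg).clm_apply (by fun_prop)
  have cutG : ∀ t f, M (symG ε K t) (M (cut K) f) = M (symG ε K t) f := by
    intro t f
    rw [M_M (isSymbol_symG ε K t) (isSymbol_cut K)]
    congr 2
    ext ξ
    rw [symG, mul_right_comm, cut_mul_self]
  have yv : ∀ t, 0 ≤ t → y t = M (cut K) (v t) := by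
    intro t ht
    rw [h t ht, map_add, ← ContinuousLinearMap.intervalIntegral_comp_comm _ (hint t ht), hy]
    simp only [hg]
    rw [map_add, cutG, ← ContinuousLinearMap.intervalIntegral_comp_comm _
      (hcont.intervalIntegrable _ _), M_M (isSymbol_cut K) (isSymbol_symH hε ht)]
    congr 1
    have e := intervalIntegral.integral_comp_sub_left (a := 0) (b := t)
      (fun r => M (symG ε K r) (M (symD K) (G (t - r)))) t
    simp only [sub_sub_cancel, sub_zero, sub_self] at e
    have e2 : ∀ s, M (symG ε K t) (M (symG ε K (-s)) (M (symD K) (G s))) =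
        M (symG ε K (t - s)) (M (symD K) (G s)) := by
      intro s
      rw [← M_symG_add, ← sub_eq_add_neg]
    simp only [e2]
    rw [e]
    refine intervalIntegral.integral_congr_ae (ae_of_all _ fun r hr => ?_)
    rw [Set.uIoc_of_le ht] at hr
    refine M_congr_mul (isSymbol_symG ε K r) (isSymbol_symD K) (isSymbol_cut K)
      (isSymbol_symK hε hr.1) (fun ξ => ?_) _
    rcases cut_cases K ξ with hc | ⟨hc, -⟩
    · simp [symG, hc]
    · simp only [symG, symD, symK, hc]
      ring
  have dy : ∀ t, HasDerivAt y (M (symA ε K) (y t) + M (symD K) (G t)) t := by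
    intro t
    have h1 : HasDerivAt g (M (symG ε K (-t)) (M (symD K) (G t))) t :=
      (hcont.integral_hasStrictDerivAt 0 t).hasDerivAt.const_add _
    have h2 := ((ContinuousLinearMap.restrictScalarsL ℂ L2c L2c ℝ ℝ).hasFDerivAt.comp_hasDerivAt t
      (hasDerivAt_M_symG hε K t)).clm_apply h1
    change HasDerivAt y (M (symA ε K) (y t) +
      M (symG ε K t) (M (symG ε K (-t)) (M (symD K) (G t)))) t at h2
    rw [← M_symG_add, add_neg_cancel] at h2
    have e : M (symG ε K 0) (M (symD K) (G t)) = M (symD K) (G t) := by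
      rw [M_M (isSymbol_symG ε K 0) (isSymbol_symD K)]
      congr 2
      ext ξ
      rw [symG, symH_zero, mul_one, symD, ← mul_assoc, cut_mul_self]
    rw [e] at h2
    exact h2
  have yc : Continuous y := continuous_iff_continuousAt.2 fun t => (dy t).continuousAt
  intro t ht
  have h1 := intervalIntegral.integral_eq_sub_of_hasDerivAt (a := 0) (b := t)
    (fun s _ => dy s) (Continuous.intervalIntegrable (by fun_prop) _ _)
  rw [yv t ht.1, yv 0 le_rfl] at h1
  rw [← sub_eq_iff_eq_add', ← h1]
  refine intervalIntegral.integral_congr fun s hs => ?_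
  rw [Set.uIcc_of_le ht.1] at hs
  simp only [rhs]
  rw [yv s hs.1, M_M (isSymbol_symA ε K) (isSymbol_cut K)]
  congr 3
  ext ξ
  rw [symA, mul_right_comm, cut_mul_self]

/-! ### Existence for the modified equation -/

/-- The Duhamel kernel with an exponential weight. -/
def kern (ε lam r : ℝ) : L2c →L[ℂ] L2c := Real.exp (-(lam * r)) • M (symK ε r)

variable {n : ℕ} {hn : 1 ≤ n} {R : ℝ}

/-- Near r₀ > 0 the symbols are uniformly bounded. Strong continuity at the fixed vector g(r₀)
combines with a uniform bound on the error g(r) - g(r₀). -/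
theorem continuousAt_symK_apply (hε : 0 < ε) {g : ℝ → L2c} (hg : Continuous g) {r₀ : ℝ}
    (hr : 0 < r₀) : ContinuousAt (fun r => M (symK ε r) (g r)) r₀ := by
  set C := (Real.sqrt (ε * (r₀ / 2)))⁻¹ with hC
  have hev : ∀ᶠ r in 𝓝 r₀, IsSymbol (symK ε r) ∧ ∀ x, ‖symK ε r x‖ ≤ C := by
    filter_upwards [lt_mem_nhds (half_lt_self hr)] with r hr'
    have h0 : 0 < r := (half_pos hr).trans hr'
    refine ⟨isSymbol_symK hε h0, fun x => (norm_symK_le hε h0 x).trans ?_⟩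
    have : 0 < Real.sqrt (ε * (r₀ / 2)) := Real.sqrt_pos.2 (by positivity)
    rw [hC]
    gcongr
  have h1 : Tendsto (fun r => M (symK ε r) (g r₀)) (𝓝 r₀) (𝓝 (M (symK ε r₀) (g r₀))) := by
    refine tendsto_M (C := C) (hev.mono fun r h => ⟨h.1.measurable, h.2⟩) (isSymbol_symK hε hr)
      (fun x => ?_) _
    have : Continuous fun r => symK ε r x := by
      unfold symK symH
      fun_prop
    exact this.tendsto r₀
  have h2 : Tendsto (fun r => M (symK ε r) (g r - g r₀)) (𝓝 r₀) (𝓝 0) := by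
    refine squeeze_zero_norm' (hev.mono fun r h => norm_M_le h.1 h.2 _) ?_
    have : Continuous fun r => C * ‖g r - g r₀‖ := by fun_prop
    simpa using this.tendsto r₀
  have h3 := h2.add h1
  rw [zero_add] at h3
  refine h3.congr fun r => ?_
  rw [← map_add, sub_add_cancel]

/-- The bound for `kern`. -/
def kernBound (ε lam r : ℝ) : ℝ :=
  (Real.sqrt ε)⁻¹ * (r ^ ((1 / 2 : ℝ) - 1) * Real.exp (-(lam * r)))

theorem norm_kern_le (hε : 0 < ε) (lam : ℝ) {r : ℝ} (hr : 0 < r) :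
    ‖kern ε lam r‖ ≤ kernBound ε lam r := by
  rw [kern, norm_smul, Real.norm_of_nonneg (Real.exp_nonneg _)]
  have h1 := opNorm_M_le (isSymbol_symK hε hr) (norm_symK_le hε hr)
  have e : kernBound ε lam r = Real.exp (-(lam * r)) * (Real.sqrt (ε * r))⁻¹ := by
    rw [kernBound, Real.sqrt_mul hε.le, mul_inv, Real.sqrt_eq_rpow r, ← Real.rpow_neg hr.le]
    norm_num
    ring
  rw [e]
  gcongr

theorem integrableOn_kernBound (ε : ℝ) {lam : ℝ} (hl : 0 < lam) :
    IntegrableOn (kernBound ε lam) (Set.Ioi 0) := by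
  have h := integrableOn_rpow_mul_exp_neg_mul_rpow (p := 1) (s := (1 / 2 : ℝ) - 1) (b := lam)
    (by norm_num) one_pos hl
  refine (h.congr_fun (fun r _ => ?_) measurableSet_Ioi).const_mul _
  simp only [Real.rpow_one, neg_mul]

/-- The integral equals (ελ)^{-1/2} Γ(1/2), which tends to 0 as λ grows. -/
theorem exists_kernBound_small (ε q : ℝ) :
    ∃ lam, 0 < lam ∧ (∫ r in Set.Ioi (0 : ℝ), kernBound ε lam r) * q < 1 := by
  have e : ∀ lam, 0 < lam → (∫ r in Set.Ioi (0 : ℝ), kernBound ε lam r) * q =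
      (Real.sqrt ε)⁻¹ * ((1 / lam) ^ (1 / 2 : ℝ) * Real.Gamma (1 / 2)) * q := by
    intro lam hl
    simp only [kernBound]
    rw [integral_const_mul, Real.integral_rpow_mul_exp_neg_mul_Ioi (by norm_num) hl]
  have h1 : Tendsto (fun lam : ℝ => (1 / lam) ^ (1 / 2 : ℝ)) atTop (𝓝 0) := by
    have h := (tendsto_inv_atTop_zero (𝕜 := ℝ)).rpow_const (p := (1 / 2 : ℝ))
      (Or.inr (by norm_num))
    rw [Real.zero_rpow (by norm_num)] at h
    simpa only [one_div] using h
  have h2 := ((h1.mul_const (Real.Gamma (1 / 2))).const_mul (Real.sqrt ε)⁻¹).mul_const q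
  rw [zero_mul, mul_zero, zero_mul] at h2
  obtain ⟨lam, h3, h4⟩ := ((h2.eventually (gt_mem_nhds one_pos)).and
    (eventually_gt_atTop (0 : ℝ))).exists
  exact ⟨lam, h4, by rwa [e lam h4]⟩

/-- The nonlinearity conjugated by the exponential weight. -/
def weightedNonlin (hn : 1 ≤ n) (R lam s : ℝ) (x : L2c) : L2c :=
  Real.exp (-(lam * s)) • nonlin hn R (Real.exp (lam * s) • x)

/-- Conjugating by the exponential weight leaves the Lipschitz constant unchanged, while the kernel
gains e^{-λr}. -/
theorem volterraData (hn : 1 ≤ n) (hε : 0 < ε) (hR : 0 ≤ R) {lam : ℝ} (hl : 0 < lam) :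
    VolterraData (kern ε lam) (kernBound ε lam) (weightedNonlin hn R lam) (lipConst n R) where
  integrable := integrableOn_kernBound ε hl
  bound r hr := norm_kern_le hε lam hr
  kcont g hg r hr := by
    refine ContinuousAt.continuousWithinAt ?_
    have h1 := continuousAt_symK_apply hε hg hr
    have h2 : ContinuousAt (fun r : ℝ => Real.exp (-(lam * r))) r := by fun_prop
    exact h2.smul h1
  q_nonneg := lipConst_nonneg hR
  lip s x y := by
    rw [weightedNonlin, weightedNonlin, ← smul_sub, norm_smul,
      Real.norm_of_nonneg (Real.exp_nonneg _)]
    have h := nonlin_lip (hn := hn) hR (Real.exp (lam * s) • x) (Real.exp (lam * s) • y)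
    rw [← smul_sub, norm_smul, Real.norm_of_nonneg (Real.exp_nonneg _)] at h
    calc _ ≤ Real.exp (-(lam * s)) * (lipConst n R * (Real.exp (lam * s) * ‖x - y‖)) := by gcongr
      _ = (Real.exp (-(lam * s)) * Real.exp (lam * s)) * (lipConst n R * ‖x - y‖) := by ring
      _ = _ := by rw [← Real.exp_add, neg_add_cancel, Real.exp_zero, one_mul]
  zero s := by rw [weightedNonlin, smul_zero, nonlin_zero hR, smul_zero]
  ncont g hg := by
    have := continuous_nonlin (hn := hn) hR
    unfold weightedNonlin
    fun_prop

theorem J_weightedNonlin (lam s : ℝ) (x : L2c) :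
    J (weightedNonlin hn R lam s x) = weightedNonlin hn R lam s (J x) := by
  rw [weightedNonlin, weightedNonlin, map_smul, ← nonlin_J, map_smul]

theorem J_kern (hε : 0 < ε) (lam : ℝ) {r : ℝ} (hr : 0 < r) (x : L2c) :
    J (kern ε lam r x) = kern ε lam r (J x) := by
  rw [kern, smul_apply, smul_apply, map_smul,
    J_M (isSymbol_symK hε hr) (symK_herm ε r)]

/-- Duhamel's formula is solved for z = e^{-λt} v, where λ makes the map a contraction on all times
at once. The radius R is arbitrary, so no smallness of data or time is needed. -/
theorem exists_modified (hn : 1 ≤ n) (hε : 0 < ε) (hR : 0 ≤ R) {v₀ : L2c} (hv₀ : J v₀ = v₀) :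
    ∃ v : ℝ → L2c, Continuous v ∧ v 0 = v₀ ∧ (∀ t, J (v t) = v t) ∧
      ∀ T, SolvesEq ε T v fun t => nonlin hn R (v t) := by
  obtain ⟨lam, hl, hq⟩ := exists_kernBound_small ε (lipConst n R)
  have D := volterraData hn hε hR hl
  have hpos : ∀ t : ℝ, 0 ≤ max t 0 := fun t => le_max_right _ _
  -- The forcing is frozen at its initial value for t < 0, since the fixed point is sought among
  -- functions on all of ℝ.
  have acont : Continuous fun t : ℝ =>
      Real.exp (-(lam * max t 0)) • M (symH ε (max t 0)) v₀ := by
    have h1 : Continuous fun t : ℝ => Real.exp (-(lam * max t 0)) := by fun_prop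
    refine h1.smul (continuous_iff_continuousAt.2 fun t₀ => ?_)
    refine tendsto_M (C := 1) (Eventually.of_forall fun t =>
      ⟨(continuous_symH ε _).measurable, norm_symH_le hε (hpos t)⟩) (isSymbol_symH hε (hpos t₀))
      (fun x => ?_) v₀
    have : Continuous fun t => symH ε (max t 0) x := by unfold symH; fun_prop
    exact this.tendsto t₀
  let a : BoundedContinuousFunction ℝ L2c := BoundedContinuousFunction.ofNormedAddCommGroup
    (fun t : ℝ => Real.exp (-(lam * max t 0)) • M (symH ε (max t 0)) v₀) acont ‖v₀‖ (fun t => by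
      rw [norm_smul, Real.norm_of_nonneg (Real.exp_nonneg _)]
      have h1 : Real.exp (-(lam * max t 0)) ≤ 1 :=
        Real.exp_le_one_iff.2 (neg_nonpos.2 (mul_nonneg hl.le (hpos t)))
      have h2 := norm_M_le_norm (isSymbol_symH hε (hpos t)) (norm_symH_le hε (hpos t)) v₀
      nlinarith [norm_nonneg (M (symH ε (max t 0)) v₀)])
  have ha : ∀ t, a t = Real.exp (-(lam * max t 0)) • M (symH ε (max t 0)) v₀ := fun t => rfl
  obtain ⟨z, hz⟩ := D.exists_solution hq a
  let z' : BoundedContinuousFunction ℝ L2c := BoundedContinuousFunction.ofNormedAddCommGroup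
    (fun t => J (z t)) (J.continuous.comp z.continuous) ‖z‖
    (fun t => (norm_J (z t)).le.trans (z.norm_coe_le_norm t))
  have hz' : ∀ t, z' t = a t + ∫ r in Set.Ioi (0 : ℝ),
      volterra (kern ε lam) (weightedNonlin hn R lam) z' t r := by
    intro t
    show J (z t) = _
    rw [hz t, map_add, ← ContinuousLinearMap.integral_comp_comm _ (D.integrable_volterra z t), ha,
      map_smul, J_M (isSymbol_symH hε (hpos t)) (symH_herm ε _), hv₀]
    congr 1
    refine setIntegral_congr_fun measurableSet_Ioi fun r hr => ?_
    simp only [volterra]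
    by_cases h : r < t
    · rw [Set.indicator_of_mem (show r ∈ Set.Iio t from h),
        Set.indicator_of_mem (show r ∈ Set.Iio t from h), J_kern hε lam hr, J_weightedNonlin]
      rfl
    · rw [Set.indicator_of_notMem (show r ∉ Set.Iio t from h),
        Set.indicator_of_notMem (show r ∉ Set.Iio t from h), map_zero]
  -- `J` maps the fixed point to another fixed point of the same equation, so uniqueness makes it
  -- real.
  have hJz : z' = z := D.solution_unique hq (a := a) hz' hz
  have hJ : ∀ t, J (z t) = z t := fun t =>
    congrFun (congrArg (fun z : BoundedContinuousFunction ℝ L2c => (z : ℝ → L2c)) hJz) t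
  set v : ℝ → L2c := fun t => Real.exp (lam * t) • z t with hv
  have vc : Continuous v := by
    have h1 : Continuous fun t : ℝ => Real.exp (lam * t) := by fun_prop
    exact h1.smul z.continuous
  have hexp : ∀ t, Real.exp (lam * t) * Real.exp (-(lam * t)) = 1 := fun t => by
    rw [← Real.exp_add, add_neg_cancel, Real.exp_zero]
  have pw : ∀ t r, Real.exp (lam * t) •
      volterra (kern ε lam) (weightedNonlin hn R lam) z t r =
      Set.indicator (Set.Iio t) (fun r => M (symK ε r) (nonlin hn R (v (t - r)))) r := by
    intro t r
    rw [volterra]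
    by_cases h : r < t
    · rw [Set.indicator_of_mem (show r ∈ Set.Iio t from h),
        Set.indicator_of_mem (show r ∈ Set.Iio t from h), kern, smul_apply,
        weightedNonlin, ContinuousLinearMap.map_smul_of_tower, smul_smul, smul_smul,
        ← Real.exp_add, ← Real.exp_add]
      rw [show lam * t + -(lam * r) + -(lam * (t - r)) = 0 by ring, Real.exp_zero, one_smul]
    · rw [Set.indicator_of_notMem (show r ∉ Set.Iio t from h),
        Set.indicator_of_notMem (show r ∉ Set.Iio t from h), smul_zero]
  have hIoo : ∀ t, Set.Ioi (0 : ℝ) ∩ Set.Iio t = Set.Ioo 0 t := fun t => rfl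
  have hint : ∀ t, 0 ≤ t →
      IntervalIntegrable (fun r => M (symK ε r) (nonlin hn R (v (t - r)))) volume 0 t := by
    intro t ht
    have h1 := (D.integrable_volterra z t).smul (Real.exp (lam * t))
    have h2 : IntegrableOn (Set.indicator (Set.Iio t)
        (fun r => M (symK ε r) (nonlin hn R (v (t - r))))) (Set.Ioi 0) :=
      h1.congr (ae_of_all _ fun r => pw t r)
    rw [intervalIntegrable_iff_integrableOn_Ioo_of_le ht]
    rw [IntegrableOn, integrable_indicator_iff measurableSet_Iio, IntegrableOn,
      Measure.restrict_restrict measurableSet_Iio, Set.inter_comm, hIoo] at h2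
    exact h2
  have mild : ∀ t, 0 ≤ t → v t = M (symH ε t) v₀ +
      ∫ r in (0 : ℝ)..t, M (symK ε r) (nonlin hn R (v (t - r))) := by
    intro t ht
    have h1 : v t = Real.exp (lam * t) • z t := rfl
    rw [h1, hz t, smul_add, ← integral_smul, ha, max_eq_left ht, smul_smul, hexp, one_smul]
    congr 1
    rw [integral_congr_ae (ae_of_all _ fun r => pw t r), setIntegral_indicator measurableSet_Iio,
      hIoo, intervalIntegral.integral_of_le ht, integral_Ioc_eq_integral_Ioo]
  refine ⟨v, vc, ?_, fun t => ?_, fun T => ?_⟩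
  · rw [mild 0 le_rfl, intervalIntegral.integral_same, add_zero]
    have : symH ε 0 = fun _ => 1 := funext fun ξ => symH_zero ε ξ
    rw [this, M_one]
  · simp only [hv, map_smul, hJ]
  · exact SolvesEq.of_mild hε ((continuous_nonlin hR).comp vc) hint mild T

/-! ### Global existence -/

variable {T : ℝ}

theorem hBound_mono (hε : 0 < ε) {T' : ℝ} (hT : T ≤ T') (R : ℝ) :
    hBound ε T R ≤ hBound ε T' R := by
  have := rate_nonneg hε R
  unfold hBound
  gcongr

theorem regConst_mono (n : ℕ) (hε : 0 < ε) {T' : ℝ} (hT : T ≤ T') (R : ℝ) :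
    regConst n ε T R ≤ regConst n ε T' R := by
  have h1 := hBound_mono hε hT R
  have h2 := cEmb_nonneg
  unfold regConst
  gcongr

theorem regConst_nonneg (n : ℕ) (hε : 0 < ε) (T R : ℝ) : 0 ≤ regConst n ε T R := by
  have h1 := hBound_nonneg ε T R
  have h2 := cEmb_nonneg
  unfold regConst
  positivity

/-- Continuation argument: the modified equation is the true one as long as the norm is at most A +
1, and while it is, the a priori estimate gives the better bound A. -/
theorem exists_FSol_Icc {k : ℕ} (hk : 1 ≤ k + 1) (hε : 0 < ε) {v₀ : L2c} (hv₀ : J v₀ = v₀)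
    (hT : 0 ≤ T) : ∃ v : ℝ → L2c, v 0 = v₀ ∧ FSol hk ε T v := by
  set R₀ := ‖M (Wi k) v₀‖ with hR₀
  set A := ‖v₀‖ * Real.exp (regConst (k + 1) ε T R₀ * T) with hA
  have hA0 : 0 ≤ A := by positivity
  obtain ⟨v, vc, v0, vJ, hv⟩ := exists_modified hk hε (by positivity : 0 ≤ A + 1) hv₀
  have sol : ∀ S, S ≤ T → (∀ t ∈ Set.Icc 0 S, ‖v t‖ ≤ A + 1) → FSol hk ε S v := fun S _ h =>
    ⟨vc, vJ, (hv S).congr fun t ht => nonlin_of_le (h t ht)⟩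
  have key : ∀ t ∈ Set.Icc 0 T, ‖v t‖ < A + 1 := by
    -- At the first time τ with norm at least A + 1, the true equation holds on [0, τ], and the a
    -- priori bound contradicts the choice of τ.
    by_contra! hcon
    set E := Set.Icc 0 T ∩ {t | A + 1 ≤ ‖v t‖} with hE
    have Ecl : IsClosed E := isClosed_Icc.inter (isClosed_le continuous_const vc.norm)
    have Ene : E.Nonempty := by
      obtain ⟨t, ht, h⟩ := hcon
      exact ⟨t, ht, h⟩
    have Ebdd : BddBelow E := ⟨0, fun t ht => ht.1.1⟩
    have hmem := Ecl.csInf_mem Ene Ebdd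
    set τ := sInf E with hτ
    have hle : ∀ t ∈ Set.Icc 0 τ, ‖v t‖ ≤ A + 1 := by
      have hlt : ∀ t ∈ Set.Ico 0 τ, ‖v t‖ ≤ A + 1 := by
        intro t ht
        by_contra! h
        exact (notMem_of_lt_csInf ht.2 Ebdd) ⟨⟨ht.1, ht.2.le.trans hmem.1.2⟩, h.le⟩
      intro t ht
      rcases ht.2.lt_or_eq with h | h
      · exact hlt t ⟨ht.1, h⟩
      -- For τ = 0 the interval [0, τ) is empty and its closure gives nothing; there the bound is
      -- read off the initial value.
      · rcases hmem.1.1.eq_or_lt with h0 | h0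
        · rw [h, ← h0, v0]
          have : ‖v₀‖ ≤ A := le_mul_of_one_le_right (norm_nonneg _)
            (Real.one_le_exp (mul_nonneg (regConst_nonneg _ hε _ _) hT))
          linarith
        · have hc : closure (Set.Ico 0 τ) ⊆ {t | ‖v t‖ ≤ A + 1} :=
            closure_minimal hlt (isClosed_le vc.norm continuous_const)
          rw [closure_Ico h0.ne] at hc
          exact hc ht
    have h1 := (sol τ hmem.1.2 hle).norm_le_exp hε (R := R₀) (by rw [v0])
      (t := τ) ⟨hmem.1.1, le_rfl⟩
    have h2 : ‖v τ‖ ≤ A := by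
      rw [v0] at h1
      refine h1.trans ?_
      rw [hA]
      have h3 := regConst_mono (k + 1) hε hmem.1.2 R₀
      have h4 := regConst_nonneg (k + 1) hε T R₀
      have h5 := hmem.1.1
      have h6 := hmem.1.2
      gcongr
    have h3 : A + 1 ≤ ‖v τ‖ := hmem.2
    linarith
  exact ⟨v, v0, sol T le_rfl fun t ht => (key t ht).le⟩

theorem FSol.congr {v v' : ℝ → L2c} (h : FSol hn ε T v) (hv' : Continuous v')
    (hJ : ∀ t, J (v' t) = v' t) (e : ∀ t ∈ Set.Icc 0 T, v t = v' t) : FSol hn ε T v' := by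
  refine ⟨hv', hJ, fun K t ht => ?_⟩
  rw [← e t ht, ← e 0 ⟨le_rfl, ht.1.trans ht.2⟩, h.eq K t ht]
  congr 1
  refine intervalIntegral.integral_congr fun s hs => ?_
  rw [Set.uIcc_of_le ht.1] at hs
  simp only [e s ⟨hs.1, hs.2.trans ht.2⟩]

theorem exists_FSol {k : ℕ} (hk : 1 ≤ k + 1) (hε : 0 < ε) {v₀ : L2c} (hv₀ : J v₀ = v₀) :
    ∃ v : ℝ → L2c, v 0 = v₀ ∧ ∀ T, FSol hk ε T v := by
  choose s s0 hs using fun N : ℕ => exists_FSol_Icc hk hε hv₀ (Nat.cast_nonneg (α := ℝ) N)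
  have agree : ∀ (N N' : ℕ) (t : ℝ), 0 ≤ t → t ≤ N → t ≤ N' → s N t = s N' t := by
    intro N N' t h0 h1 h2
    exact SolvesEq.unique hε (hs N).cont (hs N').cont ((hs N).mono h1).eq ((hs N').mono h2).eq
      ((s0 N).trans (s0 N').symm) ⟨h0, le_rfl⟩
  -- The solutions on [0, N] agree on overlaps by uniqueness and are glued, extended by the initial
  -- value for t < 0.
  set v : ℝ → L2c := fun t => s ⌈max t 0⌉₊ (max t 0) with hv
  have vs : ∀ (N : ℕ) (t : ℝ), t ≤ N → v t = s N (max t 0) := fun N t h =>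
    agree _ _ _ (le_max_right _ _) (Nat.le_ceil _) (max_le h (Nat.cast_nonneg N))
  have vc : Continuous v := by
    refine continuous_iff_continuousAt.2 fun t₀ => ?_
    obtain ⟨N, hN⟩ := exists_nat_gt t₀
    have h1 : Continuous fun t => s N (max t 0) := (hs N).cont.comp (by fun_prop)
    refine h1.continuousAt.congr ?_
    filter_upwards [gt_mem_nhds hN] with t ht
    exact (vs N t ht.le).symm
  refine ⟨v, ?_, fun T => ?_⟩
  · rw [vs 0 0 (by simp), max_self, s0]
  · obtain ⟨N, hN⟩ := exists_nat_ge T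
    refine ((hs N).mono hN).congr vc (fun t => (hs _).real _) fun t ht => ?_
    rw [vs N t (ht.2.trans hN), max_eq_left ht.1]

section Bridge

open FourierTransform
open scoped SchwartzMap

/-! ### Test functions and their inverse Fourier transforms -/

namespace IsTest

variable {ψ : ℝ → ℝ}

theorem deriv (h : IsTest ψ) : IsTest (deriv ψ) :=
  ⟨(contDiff_infty_iff_deriv.1 h.1).2, h.2.deriv⟩

theorem iteratedDeriv (h : IsTest ψ) (k : ℕ) : IsTest (iteratedDeriv k ψ) := by
  induction k with
  | zero => simpa using h
  | succ k ih => rw [iteratedDeriv_succ]; exact ih.deriv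

theorem sub {φ : ℝ → ℝ} (h : IsTest ψ) (h' : IsTest φ) : IsTest (ψ - φ) :=
  ⟨h.1.sub h'.1, h.2.sub h'.2⟩

theorem comp_sub_right (h : IsTest ψ) (y : ℝ) : IsTest fun x => ψ (x - y) :=
  ⟨h.1.comp (contDiff_id.sub contDiff_const),
    h.2.comp_homeomorph (Homeomorph.subRight y)⟩

/-- A test function as a complex Schwartz function. -/
def sch (h : IsTest ψ) : 𝓢(ℝ, ℂ) :=
  HasCompactSupport.toSchwartzMap (f := fun x => (ψ x : ℂ)) (h.2.comp_left Complex.ofReal_zero)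
    (Complex.ofRealCLM.contDiff.comp h.1)

theorem sch_apply (h : IsTest ψ) (x : ℝ) : h.sch x = (ψ x : ℂ) := rfl

theorem integrable (h : IsTest ψ) : Integrable fun x => (ψ x : ℂ) := h.sch.integrable

end IsTest

/-- The inverse Fourier transform of a real function. -/
def chk (ψ : ℝ → ℝ) (ξ : ℝ) : ℂ := 𝓕⁻ (fun x => (ψ x : ℂ)) ξ

theorem chk_eq_fourier (ψ : ℝ → ℝ) (ξ : ℝ) : chk ψ ξ = 𝓕 (fun x => (ψ x : ℂ)) (-ξ) :=
  Real.fourierInv_eq_fourier_neg _ _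

theorem sch_chk {ψ : ℝ → ℝ} (h : IsTest ψ) (ξ : ℝ) : (𝓕⁻ h.sch) ξ = chk ψ ξ := by
  rw [SchwartzMap.fourierInv_coe]
  rfl

theorem memLp_chk {ψ : ℝ → ℝ} (h : IsTest ψ) : MemLp (chk ψ) 2 volume := by
  have := (𝓕⁻ h.sch).memLp 2 volume
  refine this.ae_eq (ae_of_all _ fun ξ => sch_chk h ξ)

theorem chk_deriv {ψ : ℝ → ℝ} (h : IsTest ψ) (ξ : ℝ) :
    chk (deriv ψ) ξ = ((-(2 * Real.pi * ξ) : ℝ) : ℂ) * Complex.I * chk ψ ξ := by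
  have hd : ∀ x, HasDerivAt (fun x => (ψ x : ℂ)) ((deriv ψ x : ℝ) : ℂ) x := fun x =>
    ((h.1.differentiable (by simp)) x).hasDerivAt.ofReal_comp
  have e : deriv (fun x => (ψ x : ℂ)) = fun x => ((deriv ψ x : ℝ) : ℂ) :=
    funext fun x => (hd x).deriv
  have key := Real.fourier_deriv h.integrable (fun x => (hd x).differentiableAt)
    (by rw [e]; exact h.deriv.integrable)
  rw [e] at key
  rw [chk_eq_fourier, chk_eq_fourier, key]
  simp only [smul_eq_mul]
  push_cast
  ring

theorem chk_iteratedDeriv {ψ : ℝ → ℝ} (h : IsTest ψ) (k : ℕ) (ξ : ℝ) :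
    chk (iteratedDeriv k ψ) ξ = (((-(2 * Real.pi * ξ) : ℝ) : ℂ) * Complex.I) ^ k * chk ψ ξ := by
  induction k with
  | zero => simp
  | succ k ih => rw [iteratedDeriv_succ, chk_deriv (h.iteratedDeriv k), ih, pow_succ']; ring

theorem chk_comp_sub (ψ : ℝ → ℝ) (y ξ : ℝ) :
    chk (fun x => ψ (x - y)) ξ = Real.fourierChar (y * ξ) • chk ψ ξ := by
  rw [chk, chk, Real.fourierInv_eq, Real.fourierInv_eq,
    ← integral_add_right_eq_self _ y, Circle.smul_def, ← integral_smul]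
  congr 1
  ext x
  rw [add_sub_cancel_right, ← Circle.smul_def, smul_smul, ← AddChar.map_add_eq_mul]
  congr 2
  simp only [RCLike.inner_apply, conj_trivial]
  ring

/-- A bump supported in |x| < 1/(8(N+1)) has |2πxξ| ≤ π/4 on its support for |ξ| ≤ N. The cosine is
positive there, hence so is the real part of the transform. -/
theorem exists_chk_ne_zero (N : ℕ) : ∃ ψ : ℝ → ℝ, IsTest ψ ∧ ∀ ξ : ℝ, |ξ| ≤ N → chk ψ ξ ≠ 0 := by
  let b : ContDiffBump (0 : ℝ) := ⟨(16 * ((N : ℝ) + 1))⁻¹, (8 * ((N : ℝ) + 1))⁻¹, by positivity, by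
    gcongr
    norm_num⟩
  have hb : IsTest b := ⟨b.contDiff, b.hasCompactSupport⟩
  refine ⟨b, hb, fun ξ hξ h0 => ?_⟩
  have hre : (chk b ξ).re = ∫ x, b x * Real.cos (2 * Real.pi * (x * ξ)) := by
    rw [chk, Real.fourierInv_eq']
    have hi : Integrable fun x : ℝ =>
        Complex.exp (((2 * Real.pi * inner ℝ x ξ : ℝ) : ℂ) * Complex.I) • ((b x : ℝ) : ℂ) := by
      refine hb.integrable.mono ?_ (ae_of_all _ fun x => ?_)
      · have hc : Continuous fun x : ℝ =>
            Complex.exp (((2 * Real.pi * inner ℝ x ξ : ℝ) : ℂ) * Complex.I) := by fun_prop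
        exact (hc.smul (Complex.continuous_ofReal.comp b.continuous)).aestronglyMeasurable
      · rw [norm_smul, Complex.norm_exp_ofReal_mul_I, one_mul]
    have := integral_re hi
    simp only [RCLike.re_to_complex] at this
    rw [← this]
    congr 1
    ext x
    rw [smul_eq_mul, mul_comm, Complex.re_ofReal_mul, Complex.exp_ofReal_mul_I_re]
    congr 3
    simp only [RCLike.inner_apply, conj_trivial]
    ring
  have hcos : ∀ x, b x ≠ 0 → 0 < Real.cos (2 * Real.pi * (x * ξ)) := by
    intro x hx
    have hx' : x ∈ Function.support b := hx
    rw [b.support_eq, mem_ball_zero_iff, Real.norm_eq_abs] at hx'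
    have h1 : |x| * |ξ| ≤ 1 / 8 := by
      calc |x| * |ξ| ≤ (8 * ((N : ℝ) + 1))⁻¹ * ((N : ℝ) + 1) := by
            gcongr
            linarith
        _ = 1 / 8 := by field_simp
    have h2 : |2 * Real.pi * (x * ξ)| < Real.pi / 2 := by
      rw [abs_mul, abs_mul x, abs_of_pos (by positivity : 0 < 2 * Real.pi)]
      nlinarith [Real.pi_pos]
    exact Real.cos_pos_of_mem_Ioo (abs_lt.1 h2)
  have hpos : 0 < ∫ x, b x * Real.cos (2 * Real.pi * (x * ξ)) := by
    refine Continuous.integral_pos_of_hasCompactSupport_nonneg_nonzero (x := 0)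
      (b.continuous.mul (by fun_prop)) (b.hasCompactSupport.mul_right) (fun x => ?_) ?_
    · by_cases hx : b x = 0
      · simp [hx]
      · exact mul_nonneg b.nonneg (hcos x hx).le
    · have : b 0 = 1 := b.one_of_mem_closedBall (by simp [b.rIn_pos.le])
      simp [this]
  rw [← hre, h0] at hpos
  simp at hpos

/-- By self-adjointness of the Fourier transform, pairing f with a test function g equals pairing
its transform, which is zero, with the inverse transform of g. -/
theorem ae_zero_of_fourier_zero {f : ℝ → ℂ} (hf : Integrable f) (h : ∀ y, 𝓕 f y = 0) :
    f =ᵐ[volume] 0 := by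
  refine ae_eq_zero_of_integral_contDiff_smul_eq_zero hf.locallyIntegrable fun g hg hc => ?_
  have ht : IsTest g := ⟨hg, hc⟩
  have key := VectorFourier.integral_fourierIntegral_smul_eq_flip (L := innerₗ ℝ)
    (f := f) (g := ((𝓕⁻ ht.sch : 𝓢(ℝ, ℂ)) : ℝ → ℂ)) (μ := volume) (ν := volume) Real.continuous_fourierChar
    continuous_inner hf (SchwartzMap.integrable _)
  have e1 : ∀ ξ, VectorFourier.fourierIntegral Real.fourierChar volume (innerₗ ℝ) f ξ = 0 := h
  have e2 : ∀ x, VectorFourier.fourierIntegral Real.fourierChar volume (innerₗ ℝ).flip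
      ((𝓕⁻ ht.sch : 𝓢(ℝ, ℂ)) : ℝ → ℂ) x = (g x : ℂ) := by
    intro x
    rw [flip_innerₗ]
    have : (𝓕 (𝓕⁻ ht.sch)) x = (g x : ℂ) := by
      rw [FourierTransform.fourier_fourierInv_eq]
      rfl
    exact this
  simp only [e1, e2, zero_mul, integral_zero, smul_eq_mul] at key
  rw [key]
  refine integral_congr_ae (ae_of_all _ fun x => ?_)
  simp only [Complex.real_smul, mul_comm]

/-- Functions that annihilate all inverse Fourier transforms of test functions vanish. -/
theorem ae_zero_of_chk {h : ℝ → ℂ} (hi : ∀ ψ, IsTest ψ → Integrable fun ξ => h ξ * chk ψ ξ)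
    (h0 : ∀ ψ, IsTest ψ → ∫ ξ, h ξ * chk ψ ξ = 0) : h =ᵐ[volume] 0 := by
  -- Translating ψ multiplies its transform by a character, so the hypothesis makes the whole
  -- Fourier transform of h times that of ψ vanish.
  have key : ∀ ψ, IsTest ψ → (fun ξ => h ξ * chk ψ ξ) =ᵐ[volume] 0 := by
    intro ψ hψ
    refine ae_zero_of_fourier_zero (hi ψ hψ) fun y => ?_
    rw [← h0 _ (hψ.comp_sub_right (-y)), Real.fourier_eq]
    congr 1
    ext ξ
    rw [chk_comp_sub, mul_smul_comm]
    congr 2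
    simp only [RCLike.inner_apply, conj_trivial]
    ring
  choose ψ hψ hne using exists_chk_ne_zero
  have := ae_all_iff.2 fun N => key (ψ N) (hψ N)
  filter_upwards [this] with ξ hξ
  obtain ⟨N, hN⟩ := exists_nat_ge |ξ|
  exact (mul_eq_zero.1 (hξ N)).resolve_right (hne N ξ hN)

/-! ### The Fourier transform of real `L²` functions -/

/-- Real `L²` functions as complex ones. -/
def emb : L2 →L[ℝ] L2c := Complex.ofRealCLM.compLpL 2 (volume : Measure ℝ)

theorem coeFn_emb (f : L2) : emb f =ᵐ[volume] fun x => (f x : ℂ) :=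
  ContinuousLinearMap.coeFn_compLpL _ _

theorem norm_emb (f : L2) : ‖emb f‖ = ‖f‖ := by
  refine le_antisymm (Lp.norm_le_norm_of_ae_le ?_) (Lp.norm_le_norm_of_ae_le ?_) <;>
  · filter_upwards [coeFn_emb f] with x hx
    rw [hx, Complex.norm_real]

/-- The Fourier transform of a real `L²` function. -/
def hat (f : L2) : L2c := 𝓕 (emb f)

theorem hat_sub (f g : L2) : hat (f - g) = hat f - hat g := by
  unfold hat
  rw [map_sub]
  exact (Lp.fourierTransformₗᵢ ℝ ℂ).map_sub _ _

theorem norm_hat (f : L2) : ‖hat f‖ = ‖f‖ := by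
  rw [hat, Lp.norm_fourier_eq, norm_emb]

theorem hat_injective : Function.Injective hat := by
  intro f g h
  have : ‖f - g‖ = 0 := by rw [← norm_hat, hat_sub, h, sub_self, norm_zero]
  exact sub_eq_zero.1 (norm_eq_zero.1 this)

/-- Parseval's formula, read off from the agreement of the L² Fourier transform with that of
tempered distributions. -/
theorem integral_mul_test (f : L2) {ψ : ℝ → ℝ} (hψ : IsTest ψ) :
    ((∫ x, f x * ψ x : ℝ) : ℂ) = ∫ ξ, hat f ξ * chk ψ ξ := by
  have h := congrArg (fun T : 𝓢'(ℝ, ℂ) => T (𝓕⁻ hψ.sch))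
    (Lp.fourier_toTemperedDistribution_eq (emb f))
  simp only [TemperedDistribution.fourier_apply, Lp.toTemperedDistribution_apply] at h
  rw [FourierTransform.fourier_fourierInv_eq] at h
  rw [← integral_complex_ofReal]
  refine Eq.trans ?_ (h.trans ?_)
  · refine integral_congr_ae ?_
    filter_upwards [coeFn_emb f] with x hx
    rw [hx, hψ.sch_apply, smul_eq_mul]
    push_cast
    ring
  · refine integral_congr_ae (ae_of_all _ fun ξ => ?_)
    simp only [sch_chk hψ, smul_eq_mul, hat, mul_comm]

/-- Complex conjugation on `L²`. -/
def conjL : L2c →L[ℝ] L2c := Complex.conjCLE.toContinuousLinearMap.compLpL 2 (volume : Measure ℝ)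

theorem coeFn_conjL (f : L2c) : conjL f =ᵐ[volume] fun x => (starRingEnd ℂ) (f x) :=
  ContinuousLinearMap.coeFn_compLpL _ _

/-- Both sides are continuous in a, so it suffices to compute on the dense Schwartz functions. -/
theorem J_fourier (a : L2c) : J (𝓕 a) = 𝓕 (conjL a) := by
  have hc : Continuous fun a : L2c => (𝓕 a : L2c) := (Lp.fourierTransformₗᵢ ℝ ℂ).continuous
  refine DenseRange.induction_on (p := fun a : L2c => J (𝓕 a) = 𝓕 (conjL a))
    (SchwartzMap.denseRange_toLpCLM (p := 2)
      ENNReal.ofNat_ne_top) a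
    (isClosed_eq (J.continuous.comp hc) (hc.comp conjL.continuous)) fun f => ?_
  rw [SchwartzMap.toLpCLM_apply]
  set g : 𝓢(ℝ, ℂ) := f.postcompCLM (Complex.conjCLE.toContinuousLinearMap) with hg
  have e : conjL (f.toLp 2) = g.toLp 2 := by
    refine Lp.ext ?_
    filter_upwards [coeFn_conjL (f.toLp 2), f.coeFn_toLp 2, g.coeFn_toLp 2] with x h1 h2 h3
    rw [h1, h2, h3]
    rfl
  rw [e, SchwartzMap.toLp_fourier_eq, SchwartzMap.toLp_fourier_eq]
  refine Lp.ext ?_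
  have hf : ∀ᵐ x : ℝ, ((𝓕 f).toLp 2 : L2c) x = 𝓕 f x := (𝓕 f).coeFn_toLp 2 volume
  filter_upwards [coeFn_J ((𝓕 f).toLp 2), ae_neg hf, (𝓕 g).coeFn_toLp 2]
    with x h1 h2 h3
  rw [h1, h2, h3, SchwartzMap.fourier_coe, SchwartzMap.fourier_coe, Real.fourier_eq,
    Real.fourier_eq, ← integral_conj]
  congr 1
  ext y
  have : g y = (starRingEnd ℂ) (f y) := rfl
  rw [this, Circle.smul_def, Circle.smul_def, smul_eq_mul, smul_eq_mul, map_mul,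
    ← Circle.coe_inv_eq_conj, ← AddChar.map_neg_eq_inv, inner_neg_right, neg_neg]

theorem J_hat (f : L2) : J (hat f) = hat f := by
  rw [hat, J_fourier]
  congr 1
  refine Lp.ext ?_
  filter_upwards [coeFn_conjL (emb f), coeFn_emb f] with x h1 h2
  rw [h1, h2, Complex.conj_ofReal]

theorem exists_hat_eq {g : L2c} (hg : J g = g) : ∃ f : L2, hat f = g := by
  set a : L2c := (Lp.fourierTransformₗᵢ ℝ ℂ).symm g with ha
  have h𝓕 : 𝓕 a = g := (Lp.fourierTransformₗᵢ ℝ ℂ).apply_symm_apply g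
  have hc : conjL a = a := by
    refine (Lp.fourierTransformₗᵢ ℝ ℂ).injective ?_
    show 𝓕 (conjL a) = 𝓕 a
    rw [← J_fourier, h𝓕, hg]
  refine ⟨Complex.reCLM.compLp a, ?_⟩
  rw [hat, ← h𝓕]
  congr 1
  refine Lp.ext ?_
  filter_upwards [coeFn_emb (Complex.reCLM.compLp a), Complex.reCLM.coeFn_compLp a,
    coeFn_conjL a] with x h1 h2 h3
  rw [hc] at h3
  rw [h1, h2]
  exact Complex.conj_eq_iff_re.1 h3.symm

/-! ### Weak derivatives on the Fourier side -/

/-- The symbol of `∂ₓᵏ`. -/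
def symW (k : ℕ) (ξ : ℝ) : ℂ := (((2 * Real.pi * ξ : ℝ) : ℂ) * Complex.I) ^ k

theorem chk_iteratedDeriv' {ψ : ℝ → ℝ} (h : IsTest ψ) (k : ℕ) (ξ : ℝ) :
    chk (iteratedDeriv k ψ) ξ = (-1) ^ k * (symW k ξ * chk ψ ξ) := by
  rw [chk_iteratedDeriv h, symW, ← mul_assoc, ← mul_pow]
  congr 2
  push_cast
  ring

/-- Both pairings are rewritten by Parseval; the transforms of test functions separate functions
almost everywhere. -/
theorem isWeakDeriv_iff {k : ℕ} {f g : L2} :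
    IsWeakDeriv k f g ↔ hat g =ᵐ[volume] fun ξ => symW k ξ * hat f ξ := by
  have key : ∀ ψ, IsTest ψ → ((∫ x, f x * iteratedDeriv k ψ x : ℝ) : ℂ) =
      (-1) ^ k * ∫ ξ, symW k ξ * hat f ξ * chk ψ ξ := by
    intro ψ hψ
    rw [integral_mul_test f (hψ.iteratedDeriv k), ← integral_const_mul]
    congr 1
    ext ξ
    rw [chk_iteratedDeriv' hψ]
    ring
  constructor
  · intro h
    have hint : ∀ ψ, IsTest ψ → Integrable fun ξ => symW k ξ * hat f ξ * chk ψ ξ := by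
      intro ψ hψ
      have h1 := ((Lp.memLp (hat f)).integrable_mul
        (memLp_chk (hψ.iteratedDeriv k))).const_mul ((-1 : ℂ) ^ k)
      refine h1.congr (ae_of_all _ fun ξ => ?_)
      have : ((-1 : ℂ) ^ k) * (-1) ^ k = 1 := by rw [← mul_pow]; simp
      simp only [Pi.mul_apply, chk_iteratedDeriv' hψ]
      linear_combination (hat f ξ * symW k ξ * chk ψ ξ) * this
    have hint' : ∀ ψ, IsTest ψ → Integrable fun ξ => hat g ξ * chk ψ ξ := fun ψ hψ =>
      (Lp.memLp (hat g)).integrable_mul (memLp_chk hψ)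
    have h0 := ae_zero_of_chk (h := fun ξ => symW k ξ * hat f ξ - hat g ξ)
      (fun ψ hψ => ((hint ψ hψ).sub (hint' ψ hψ)).congr (ae_of_all _ fun ξ => by
        simp only [Pi.sub_apply]; ring))
      (fun ψ hψ => by
        simp only [sub_mul]
        rw [integral_sub (hint ψ hψ) (hint' ψ hψ), ← integral_mul_test g hψ]
        have h1 := key ψ hψ
        rw [h ψ hψ] at h1
        push_cast at h1
        rw [← mul_left_cancel₀ (pow_ne_zero k (by norm_num : (-1 : ℂ) ≠ 0)) h1, sub_self])
    filter_upwards [h0] with ξ hξ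
    exact (sub_eq_zero.1 hξ).symm
  · intro h ψ hψ
    have h1 := key ψ hψ
    have h2 : ∫ ξ, symW k ξ * hat f ξ * chk ψ ξ = ∫ ξ, hat g ξ * chk ψ ξ := by
      refine integral_congr_ae ?_
      filter_upwards [h] with ξ hξ
      rw [hξ]
    rw [h2, ← integral_mul_test g hψ] at h1
    exact_mod_cast h1

/-- The symbol of `∂ₓᵏ (1 - ∂ₓ²)^{-n/2}`. -/
def symWi (k n : ℕ) (ξ : ℝ) : ℂ := symW k ξ * Wi n ξ

theorem norm_symW (k : ℕ) (ξ : ℝ) : ‖symW k ξ‖ = |2 * Real.pi * ξ| ^ k := by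
  rw [symW, norm_pow, norm_mul, Complex.norm_I, mul_one, Complex.norm_real, Real.norm_eq_abs]

theorem norm_symWi (k n : ℕ) (ξ : ℝ) :
    ‖symWi k n ξ‖ = |2 * Real.pi * ξ| ^ k * (jb ξ ^ n)⁻¹ := by
  rw [symWi, norm_mul, norm_symW, norm_Wi]

theorem norm_symWi_le {k n : ℕ} (h : k ≤ n) (ξ : ℝ) : ‖symWi k n ξ‖ ≤ 1 := by
  rw [norm_symWi, ← div_eq_mul_inv, div_le_one (pow_pos (jb_pos ξ) n)]
  exact (pow_le_pow_left₀ (abs_nonneg _) (abs_le_jb ξ) k).trans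
    (pow_le_pow_right₀ (one_le_jb ξ) h)

theorem isSymbol_symWi {k n : ℕ} (h : k ≤ n) : IsSymbol (symWi k n) :=
  .of_le ((by unfold symW; fun_prop : Measurable (symW k)).mul (isSymbol_Wi n).measurable)
    (norm_symWi_le h)

theorem symWi_herm (k n : ℕ) (ξ : ℝ) : (starRingEnd ℂ) (symWi k n (-ξ)) = symWi k n ξ := by
  rw [symWi, map_mul, Wi_herm, symWi, symW, symW, map_pow, map_mul, Complex.conj_I,
    Complex.conj_ofReal]
  congr 2
  push_cast
  ring

theorem isWeakDeriv_of_hat {k n : ℕ} (hk : k ≤ n) {f g : L2} {v : L2c} (hf : hat f = M (Wi n) v)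
    (hg : hat g = M (symWi k n) v) : IsWeakDeriv k f g := by
  rw [isWeakDeriv_iff, hf, hg]
  filter_upwards [coeFn_M (isSymbol_symWi hk) v, coeFn_M (isSymbol_Wi n) v] with ξ h1 h2
  rw [h1, h2, symWi, mul_assoc]

theorem J_of_hat {n : ℕ} {f : L2} {v : L2c} (hf : hat f = M (Wi n) v) : J v = v := by
  refine M_injective (isSymbol_Wi n) (Wi_ne_zero n) ?_
  rw [← J_Wi, ← hf, J_hat]

theorem exists_weakDeriv {k n : ℕ} (hk : k ≤ n) {f : L2} {v : L2c} (hf : hat f = M (Wi n) v) :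
    ∃ g : L2, IsWeakDeriv k f g ∧ hat g = M (symWi k n) v := by
  have hJ : J (M (symWi k n) v) = M (symWi k n) v := by
    rw [J_M (isSymbol_symWi hk) (symWi_herm k n), J_of_hat hf]
  obtain ⟨g, hg⟩ := exists_hat_eq hJ
  exact ⟨g, isWeakDeriv_of_hat hk hf hg, hg⟩

theorem hat_weakDeriv {k n : ℕ} (hk : k ≤ n) {f : L2} {v : L2c} (hf : hat f = M (Wi n) v) :
    hat (weakDeriv k f) = M (symWi k n) v := by
  obtain ⟨g, hg, e⟩ := exists_weakDeriv hk hf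
  rw [hg.weakDeriv_eq, e]

/-- Only the top derivative is needed to build v, since ⟨ξ⟩ⁿ ≤ 2ⁿ(1 + |2πξ|ⁿ). The intermediate
derivatives then come from bounded symbols. -/
theorem memH_iff {n : ℕ} {f : L2} : MemH n f ↔ ∃ v, hat f = M (Wi n) v := by
  constructor
  · intro h
    obtain ⟨g, hg⟩ := h n le_rfl
    rw [isWeakDeriv_iff] at hg
    have hm : MemLp (fun ξ => ((jb ξ ^ n : ℝ) : ℂ) * hat f ξ) 2 volume := by
      have h1 : MemLp (fun ξ => ‖hat f ξ‖ + ‖hat g ξ‖) 2 volume :=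
        (Lp.memLp (hat f)).norm.add (Lp.memLp (hat g)).norm
      refine MemLp.of_le_mul (c := 2 ^ n) h1 ?_ ?_
      · have := measurable_jb_pow n
        exact (by fun_prop : Measurable fun ξ => ((jb ξ ^ n : ℝ) : ℂ)).aestronglyMeasurable.mul
          (Lp.aestronglyMeasurable _)
      · filter_upwards [hg] with ξ hξ
        rw [hξ, norm_mul, norm_mul, norm_symW, Complex.norm_real, Real.norm_of_nonneg
          (pow_nonneg (jb_pos ξ).le n), Real.norm_of_nonneg (by positivity)]
        set y := |2 * Real.pi * ξ|
        have h2 : jb ξ ≤ 1 + y := by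
          have h3 := jb_sq ξ
          rw [← sq_abs (2 * Real.pi * ξ)] at h3
          nlinarith [abs_nonneg (2 * Real.pi * ξ), jb_pos ξ]
        have h3 : jb ξ ^ n ≤ 2 ^ n * (1 + y ^ n) := by
          have h4 := add_pow_le zero_le_one (abs_nonneg (2 * Real.pi * ξ)) n
          rw [one_pow] at h4
          have h5 : (2 : ℝ) ^ (n - 1) ≤ 2 ^ n :=
            pow_le_pow_right₀ (by norm_num) (Nat.sub_le n 1)
          calc _ ≤ (1 + y) ^ n := pow_le_pow_left₀ (jb_pos ξ).le h2 n
            _ ≤ _ := h4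
            _ ≤ _ := mul_le_mul_of_nonneg_right h5 (by positivity)
        calc _ ≤ 2 ^ n * (1 + y ^ n) * ‖hat f ξ‖ := by gcongr
          _ = _ := by ring
    refine ⟨hm.toLp _, (M_eq_of_ae (isSymbol_Wi n) ?_).symm⟩
    filter_upwards [hm.coeFn_toLp] with ξ hξ
    rw [hξ, ← mul_assoc, Wi, ← Complex.ofReal_mul,
      inv_mul_cancel₀ (pow_ne_zero n (jb_pos ξ).ne'), Complex.ofReal_one, one_mul]
  · rintro ⟨v, hv⟩ k hk
    obtain ⟨g, hg, -⟩ := exists_weakDeriv hk hv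
    exact ⟨g, hg⟩

theorem norm_sq_eq_integral (f : L2c) : ‖f‖ ^ 2 = ∫ x, ‖f x‖ ^ 2 := by
  rw [← inner_self_eq_norm_sq (𝕜 := ℂ), L2.inner_def, ← integral_re (L2.integrable_inner _ _)]
  simp only [inner_self_eq_norm_sq (𝕜 := ℂ)]

/-- The binomial expansion of (1 + (2πξ)²)ⁿ under the integral. -/
theorem hNorm_eq {n : ℕ} {f : L2} {v : L2c} (hf : hat f = M (Wi n) v) : hNorm n f = ‖v‖ := by
  rw [hNorm, ← Real.sqrt_sq (norm_nonneg v)]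
  congr 1
  have h1 : ∀ k ∈ Finset.range (n + 1), (n.choose k : ℝ) * ‖weakDeriv k f‖ ^ 2 =
      ∫ ξ, (n.choose k : ℝ) * ‖M (symWi k n) v ξ‖ ^ 2 := by
    intro k hk
    rw [integral_const_mul, ← norm_sq_eq_integral, ← norm_hat,
      hat_weakDeriv (Nat.lt_succ_iff.1 (Finset.mem_range.1 hk)) hf]
  rw [Finset.sum_congr rfl h1, ← integral_finsetSum _ fun k _ =>
    ((Lp.memLp _).norm.integrable_sq).const_mul _, norm_sq_eq_integral]
  refine integral_congr_ae ?_
  have h2 : ∀ k, ∀ᵐ ξ, k ≤ n → M (symWi k n) v ξ = symWi k n ξ * v ξ := by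
    intro k
    by_cases hk : k ≤ n
    · filter_upwards [coeFn_M (isSymbol_symWi hk) v] with ξ hξ _
      exact hξ
    · exact ae_of_all _ fun ξ h => absurd h hk
  filter_upwards [ae_all_iff.2 h2] with ξ hξ
  have h3 : ∀ k ∈ Finset.range (n + 1), (n.choose k : ℝ) * ‖M (symWi k n) v ξ‖ ^ 2 =
      ((2 * Real.pi * ξ) ^ 2) ^ k * 1 ^ (n - k) * (n.choose k : ℝ) *
        (((jb ξ ^ 2) ^ n)⁻¹ * ‖v ξ‖ ^ 2) := by
    intro k hk
    rw [hξ k (Nat.lt_succ_iff.1 (Finset.mem_range.1 hk)), norm_mul, norm_symWi, mul_pow, mul_pow,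
      inv_pow, ← pow_mul, ← pow_mul, mul_comm k 2, mul_comm n 2, pow_mul, sq_abs, pow_mul (jb ξ),
      one_pow]
    ring
  rw [Finset.sum_congr rfl h3, ← Finset.sum_mul, ← add_pow, ← mul_assoc, jb_sq,
    add_comm 1 ((2 * Real.pi * ξ) ^ 2), mul_inv_cancel₀ (by positivity), one_mul]

theorem norm_weakDeriv_one {f : L2} {v : L2c} (hf : hat f = M (Wi 1) v) :
    ‖weakDeriv 1 f‖ = ‖M Di v‖ := by
  rw [← norm_hat, hat_weakDeriv le_rfl hf]
  have h : ∀ ξ, ‖symWi 1 1 ξ‖ = ‖Di ξ‖ := by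
    intro ξ
    rw [norm_symWi, Di, Complex.norm_real, norm_mul, norm_inv,
      Real.norm_of_nonneg (jb_pos ξ).le, pow_one, pow_one, Real.norm_eq_abs]
  exact le_antisymm (norm_M_mono (isSymbol_symWi le_rfl) isSymbol_Di (fun ξ => (h ξ).le) v)
    (norm_M_mono isSymbol_Di (isSymbol_symWi le_rfl) (fun ξ => (h ξ).ge) v)

/-! ### Products -/

theorem integral_fourierInv_mul_test {c : ℝ → ℂ} (hc : Integrable c) {ψ : ℝ → ℝ} (hψ : IsTest ψ) :
    ∫ x, 𝓕⁻ c x * (ψ x : ℂ) = ∫ ξ, c ξ * chk ψ ξ := by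
  have key := VectorFourier.integral_fourierIntegral_smul_eq_flip (L := innerₗ ℝ)
    (f := c) (g := fun x => (ψ (-x) : ℂ)) (μ := volume) (ν := volume) Real.continuous_fourierChar
    continuous_inner hc hψ.integrable.comp_neg
  have e1 : ∫ x, 𝓕⁻ c x * (ψ x : ℂ) = ∫ x, 𝓕 c x * (ψ (-x) : ℂ) := by
    rw [← integral_neg_eq_self]
    simp only [Real.fourierInv_eq_fourier_neg, neg_neg]
  have e2 : ∀ ξ, chk ψ ξ = 𝓕 (fun x => (ψ (-x) : ℂ)) ξ := by
    intro ξ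
    rw [chk, Real.fourierInv_eq_fourier_comp_neg]
  rw [e1]
  simp only [e2]
  rw [flip_innerₗ] at key
  exact key

theorem coe_eq_fourierInv {f : L2} (hi : Integrable (hat f : ℝ → ℂ)) :
    (fun x => (f x : ℂ)) =ᵐ[volume] 𝓕⁻ (hat f : ℝ → ℂ) := by
  have hcont : Continuous (𝓕⁻ (hat f : ℝ → ℂ)) := by
    have h1 : Continuous (𝓕 (hat f : ℝ → ℂ)) :=
      VectorFourier.fourierIntegral_continuous Real.continuous_fourierChar continuous_inner hi
    have h2 : 𝓕⁻ (hat f : ℝ → ℂ) = fun x => 𝓕 (hat f : ℝ → ℂ) (-x) :=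
      funext fun x => Real.fourierInv_eq_fourier_neg _ _
    rw [h2]
    exact h1.comp continuous_neg
  have hloc : LocallyIntegrable (fun x => (f x : ℂ)) (volume : Measure ℝ) :=
    ((Lp.memLp f).ofReal (K := ℂ)).locallyIntegrable (by norm_num)
  refine ae_eq_of_integral_contDiff_smul_eq hloc hcont.locallyIntegrable fun g hg hgc => ?_
  have hψ : IsTest g := ⟨hg, hgc⟩
  have h1 := (integral_mul_test f hψ).trans (integral_fourierInv_mul_test hi hψ).symm
  rw [← integral_complex_ofReal] at h1
  refine Eq.trans ?_ (h1.trans ?_)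
  · refine integral_congr_ae (ae_of_all _ fun x => ?_)
    simp only [Complex.real_smul, Complex.ofReal_mul, mul_comm]
  · refine integral_congr_ae (ae_of_all _ fun x => ?_)
    simp only [Complex.real_smul, mul_comm]

/-- The transform of w² is ŵ ⋆ ŵ. Integrability of ŵ makes w the pointwise inverse transform of ŵ,
so the convolution theorem in L¹ applies. -/
theorem integral_sq_mul_test {f : L2} (hi : Integrable (hat f : ℝ → ℂ)) {ψ : ℝ → ℝ}
    (hψ : IsTest ψ) :
    ((∫ x, f x ^ 2 * ψ x : ℝ) : ℂ) = ∫ ξ, conv (hat f) (hat f) ξ * chk ψ ξ := by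
  rw [← integral_fourierInv_mul_test (integrable_conv hi hi) hψ, ← integral_complex_ofReal]
  refine integral_congr_ae ?_
  filter_upwards [coe_eq_fourierInv hi] with x hx
  rw [Real.fourierInv_eq_fourier_neg, conv_eq, Real.fourier_mul_convolution_eq hi hi,
    ← Real.fourierInv_eq_fourier_neg, ← hx]
  push_cast
  ring

end Bridge

/-! ### The equation in distributions and on the Fourier side -/

/-- The symbol of `ε∂ₓ² (1 - ∂ₓ²)⁻¹`. -/
def regA (ε ξ : ℝ) : ℂ := ((-(ε * (2 * Real.pi * ξ) ^ 2) * (jb ξ ^ 2)⁻¹ : ℝ) : ℂ)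

/-- The symbol of `-∂ₓ (1 - ∂ₓ²)⁻¹ / 2`. -/
def regD (ξ : ℝ) : ℂ := ((-(Real.pi * ξ) * (jb ξ ^ 2)⁻¹ : ℝ) : ℂ) * Complex.I

theorem isSymbol_regA (ε : ℝ) : IsSymbol (regA ε) := by
  refine .of_le (C := |ε|) ?_ fun ξ => ?_
  · have := measurable_jb_pow 2
    exact Complex.measurable_ofReal.comp ((by fun_prop : Measurable fun ξ : ℝ =>
      -(ε * (2 * Real.pi * ξ) ^ 2)).mul this.inv)
  · have h : (2 * Real.pi * ξ) ^ 2 * (jb ξ ^ 2)⁻¹ ≤ 1 := by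
      rw [jb_sq, ← div_eq_mul_inv, div_le_one (by positivity)]
      linarith
    rw [regA, Complex.norm_real, Real.norm_eq_abs, ← neg_mul, mul_assoc, abs_mul, abs_neg,
      abs_of_nonneg (by positivity : 0 ≤ (2 * Real.pi * ξ) ^ 2 * (jb ξ ^ 2)⁻¹)]
    exact mul_le_of_le_one_right (abs_nonneg ε) h

theorem isSymbol_regD : IsSymbol regD := by
  refine .of_le (C := 1) ?_ fun ξ => ?_
  · have := measurable_jb_pow 2
    exact (Complex.measurable_ofReal.comp ((by fun_prop : Measurable fun ξ : ℝ =>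
      -(Real.pi * ξ)).mul this.inv)).mul_const _
  · rw [regD, norm_mul, Complex.norm_I, mul_one, Complex.norm_real, Real.norm_eq_abs, abs_mul,
      abs_neg, abs_inv, abs_of_nonneg (sq_nonneg (jb ξ)), ← div_eq_mul_inv,
      div_le_one (pow_pos (jb_pos ξ) 2), jb_sq]
    have h := sq_abs (2 * Real.pi * ξ)
    rw [mul_assoc, abs_mul, abs_two] at h
    nlinarith [abs_nonneg (Real.pi * ξ), sq_nonneg (2 * |Real.pi * ξ| - 1)]

/-- The right-hand side `ε u_xx - F_x / 2` under `(1 - ∂ₓ²)⁻¹`. -/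
def regRhs (ε : ℝ) (u F : L2c) : L2c := M (regA ε) u + M regD F

theorem M_cut_regRhs (ε : ℝ) (K : ℕ) (u F : L2c) :
    M (cut K) (regRhs ε u F) = M (Wi 2) (rhs ε K u F) := by
  rw [regRhs, rhs, map_add, map_add, M_M (isSymbol_cut K) (isSymbol_regA ε),
    M_M (isSymbol_cut K) isSymbol_regD, M_M (isSymbol_Wi 2) (isSymbol_symA ε K),
    M_M (isSymbol_Wi 2) (isSymbol_symD K)]
  congr 3
  · ext ξ
    simp only [regA, Wi, symA]
    push_cast
    ring
  · ext ξ
    simp only [regD, Wi, symD]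
    push_cast
    ring

variable {ε T : ℝ} {u F : ℝ → L2c}

theorem continuous_regRhs (ε : ℝ) (hu : Continuous u) (hF : Continuous F) :
    Continuous fun s => regRhs ε (u s) (F s) := by
  unfold regRhs
  fun_prop

theorem M_cut_injective {f g : L2c} (h : ∀ K, M (cut K) f = M (cut K) g) : f = g :=
  tendsto_nhds_unique (tendsto_M_cut f) ((tendsto_M_cut g).congr fun K => (h K).symm)

/-- (1 - ∂ₓ²)⁻¹ also makes the right-hand side bounded, without truncating. Its symbol never
vanishes, and the cut-offs jointly determine a function, so no information is lost. -/
theorem solvesEq_iff (hu : Continuous u) (hF : Continuous F) : SolvesEq ε T u F ↔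
    ∀ t ∈ Set.Icc 0 T,
      M (Wi 2) (u t) = M (Wi 2) (u 0) + ∫ s in (0 : ℝ)..t, regRhs ε (u s) (F s) := by
  have key : ∀ K : ℕ, ∀ t, M (Wi 2) (M (cut K) (u 0) + ∫ s in (0 : ℝ)..t, rhs ε K (u s) (F s)) =
      M (cut K) (M (Wi 2) (u 0) + ∫ s in (0 : ℝ)..t, regRhs ε (u s) (F s)) := by
    intro K t
    rw [map_add, map_add, M_comm (isSymbol_Wi 2) (isSymbol_cut K),
      ← ContinuousLinearMap.intervalIntegral_comp_comm _
        ((continuous_rhs ε K hu hF).intervalIntegrable _ _),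
      ← ContinuousLinearMap.intervalIntegral_comp_comm _
        ((continuous_regRhs ε hu hF).intervalIntegrable _ _)]
    simp only [M_cut_regRhs]
  constructor
  · intro h t ht
    refine M_cut_injective fun K => ?_
    rw [← key, ← h K t ht, M_comm (isSymbol_Wi 2) (isSymbol_cut K)]
  · intro h K t ht
    refine M_injective (isSymbol_Wi 2) (Wi_ne_zero 2) ?_
    rw [key, ← h t ht, M_comm (isSymbol_Wi 2) (isSymbol_cut K)]

/-- Pairing with a test function on the Fourier side. -/
def pair {ψ : ℝ → ℝ} (hψ : IsTest ψ) : L2c →L[ℂ] ℂ :=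
  innerSL ℂ ((memLp_chk hψ).star.toLp _)

theorem pair_apply {ψ : ℝ → ℝ} (hψ : IsTest ψ) (f : L2c) :
    pair hψ f = ∫ ξ, f ξ * chk ψ ξ := by
  rw [pair, innerSL_apply_apply, L2.inner_def]
  refine integral_congr_ae ?_
  filter_upwards [(memLp_chk hψ).star.coeFn_toLp] with ξ hξ
  rw [hξ]
  simp [RCLike.inner_apply]

theorem integrable_mul_chk (f : L2c) {ψ : ℝ → ℝ} (hψ : IsTest ψ) :
    Integrable fun ξ => f ξ * chk ψ ξ :=
  (Lp.memLp f).integrable_mul (memLp_chk hψ)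

/-- Testing against ψ - ψ'' produces the factor ⟨ξ⟩², which undoes (1 - ∂ₓ²)⁻¹. -/
theorem chk_sub_iteratedDeriv {ψ : ℝ → ℝ} (hψ : IsTest ψ) (ξ : ℝ) :
    chk (ψ - iteratedDeriv 2 ψ) ξ = ((jb ξ ^ 2 : ℝ) : ℂ) * chk ψ ξ := by
  have h : chk (ψ - iteratedDeriv 2 ψ) ξ = chk ψ ξ - chk (iteratedDeriv 2 ψ) ξ := by
    rw [eq_sub_iff_add_eq, ← sch_chk hψ, ← sch_chk (hψ.iteratedDeriv 2),
      ← sch_chk (hψ.sub (hψ.iteratedDeriv 2)), ← add_apply, ← FourierTransform.fourierInv_add]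
    congr 2
    ext x
    simp [IsTest.sch_apply]
  rw [h, chk_iteratedDeriv hψ, jb_sq, mul_pow, Complex.I_sq]
  push_cast
  ring

/-- Pairing with `ψ - ψ''`. -/
def pairReg {ψ : ℝ → ℝ} (hψ : IsTest ψ) : L2c →L[ℂ] ℂ := pair (hψ.sub (hψ.iteratedDeriv 2))

theorem pairReg_apply {ψ : ℝ → ℝ} (hψ : IsTest ψ) (f : L2c) :
    pairReg hψ f = ∫ ξ, f ξ * (((jb ξ ^ 2 : ℝ) : ℂ) * chk ψ ξ) := by
  simp only [pairReg, pair_apply, chk_sub_iteratedDeriv hψ]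

theorem pairReg_Wi {ψ : ℝ → ℝ} (hψ : IsTest ψ) (f : L2) :
    pairReg hψ (M (Wi 2) (hat f)) = ((∫ x, f x * ψ x : ℝ) : ℂ) := by
  rw [pairReg_apply, integral_mul_test f hψ]
  refine integral_congr_ae ?_
  filter_upwards [coeFn_M (isSymbol_Wi 2) (hat f)] with ξ hξ
  have h : Wi 2 ξ * ((jb ξ ^ 2 : ℝ) : ℂ) = 1 := by
    rw [Wi, ← Complex.ofReal_mul, inv_mul_cancel₀ (pow_pos (jb_pos ξ) 2).ne', Complex.ofReal_one]
  rw [hξ]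
  linear_combination (hat f ξ * chk ψ ξ) * h

theorem eq_zero_of_pairReg {f : L2c} (h : ∀ ψ, ∀ hψ : IsTest ψ, pairReg hψ f = 0) : f = 0 := by
  have h0 := ae_zero_of_chk (h := fun ξ => f ξ * ((jb ξ ^ 2 : ℝ) : ℂ))
    (fun ψ hψ => (integrable_mul_chk f (hψ.sub (hψ.iteratedDeriv 2))).congr
      (ae_of_all _ fun ξ => by simp only [chk_sub_iteratedDeriv hψ, mul_assoc]))
    (fun ψ hψ => by
      rw [← h ψ hψ, pairReg_apply]
      simp only [mul_assoc])
  refine Lp.ext ?_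
  filter_upwards [h0, Lp.coeFn_zero ℂ 2 (volume : Measure ℝ)] with ξ h1 h2
  rw [h2]
  exact (mul_eq_zero.1 h1).resolve_right (Complex.ofReal_ne_zero.2 (pow_pos (jb_pos ξ) 2).ne')

/-- Integration by parts in Fourier form: the regularizing factor cancels ⟨ξ⟩² and the derivatives
fall on ψ. -/
theorem pairReg_regRhs {ψ : ℝ → ℝ} (hψ : IsTest ψ) (ε : ℝ) {f : L2} {v : L2c}
    (hf : hat f = M (Wi 1) v) :
    pairReg hψ (regRhs ε (hat f) (M (Wi 1) (bil le_rfl v v))) =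
      ((∫ x, (f x ^ 2 / 2 * deriv ψ x + ε * (f x * iteratedDeriv 2 ψ x)) : ℝ) : ℂ) := by
  have hi : Integrable (hat f : ℝ → ℂ) := by
    rw [hf]
    exact integrable_Wi le_rfl v
  set F : L2c := M (Wi 1) (bil le_rfl v v) with hF
  have hFc : F =ᵐ[volume] conv (hat f) (hat f) := by
    rw [hf]
    exact coeFn_Wi_bil le_rfl v v
  have e1 : pairReg hψ (regRhs ε (hat f) F) =
      ∫ ξ, ((ε : ℂ) * (hat f ξ * chk (iteratedDeriv 2 ψ) ξ) +
        (1 / 2 : ℂ) * (F ξ * chk (deriv ψ) ξ)) := by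
    rw [pairReg_apply]
    refine integral_congr_ae ?_
    filter_upwards [Lp.coeFn_add (M (regA ε) (hat f)) (M regD F),
      coeFn_M (isSymbol_regA ε) (hat f), coeFn_M isSymbol_regD F] with ξ h1 h2 h3
    have h : ((jb ξ : ℂ) ^ 2)⁻¹ * (jb ξ : ℂ) ^ 2 = 1 :=
      inv_mul_cancel₀ (pow_ne_zero 2 (Complex.ofReal_ne_zero.2 (jb_pos ξ).ne'))
    rw [regRhs, h1, Pi.add_apply, h2, h3, chk_iteratedDeriv hψ, chk_deriv hψ, regA, regD,
      mul_pow _ Complex.I, Complex.I_sq]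
    push_cast
    linear_combination (-(ε * (2 * Real.pi * ξ) ^ 2) * hat f ξ * chk ψ ξ -
      Real.pi * ξ * Complex.I * F ξ * chk ψ ξ) * h
  have e2 : ∫ ξ, F ξ * chk (deriv ψ) ξ = ((∫ x, f x ^ 2 * deriv ψ x : ℝ) : ℂ) := by
    rw [integral_sq_mul_test hi hψ.deriv]
    refine integral_congr_ae ?_
    filter_upwards [hFc] with ξ hξ
    rw [hξ]
  have i1 : Integrable fun x => f x ^ 2 * deriv ψ x := by
    obtain ⟨C, hC⟩ := hψ.deriv.1.continuous.bounded_above_of_compact_support hψ.deriv.2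
    exact (Lp.memLp f).integrable_sq.mul_bdd (c := C) hψ.deriv.1.continuous.aestronglyMeasurable
      (ae_of_all _ hC)
  have i2 : Integrable fun x => f x * iteratedDeriv 2 ψ x :=
    (Lp.memLp f).integrable_mul
      ((hψ.iteratedDeriv 2).1.continuous.memLp_of_hasCompactSupport (p := 2)
        (hψ.iteratedDeriv 2).2)
  have e3 : ∫ x, (f x ^ 2 / 2 * deriv ψ x + ε * (f x * iteratedDeriv 2 ψ x)) =
      1 / 2 * (∫ x, f x ^ 2 * deriv ψ x) + ε * ∫ x, f x * iteratedDeriv 2 ψ x := by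
    rw [← integral_const_mul, ← integral_const_mul, ← integral_add (i1.const_mul _)
      (i2.const_mul _)]
    congr 1
    ext x
    ring
  rw [e1, integral_add ((integrable_mul_chk _ (hψ.iteratedDeriv 2)).const_mul _)
    ((integrable_mul_chk _ hψ.deriv).const_mul _), integral_const_mul, integral_const_mul, e2,
    ← integral_mul_test f (hψ.iteratedDeriv 2), e3]
  push_cast
  ring

/-- The equation in distributions, at every positive time. -/
def DistribEq (ε : ℝ) (f : ℝ → L2) : Prop :=
  ∀ ψ : ℝ → ℝ, IsTest ψ → ∀ t : ℝ, 0 < t →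
    HasDerivAt (fun s : ℝ => ∫ x, f s x * ψ x)
      (∫ x, (f t x ^ 2 / 2 * deriv ψ x + ε * (f t x * iteratedDeriv 2 ψ x))) t

/-- Paired with ψ - ψ'', the (1 - ∂ₓ²)⁻¹ form becomes the distributional equation for ψ, integrated
in time. Both directions are the fundamental theorem of calculus, as the right-hand side is
continuous in time. -/
theorem distribEq_iff {f : ℝ → L2} {v : ℝ → L2c} (hv : Continuous v)
    (hf : ∀ t, 0 ≤ t → hat (f t) = M (Wi 1) (v t)) :
    DistribEq ε f ↔ ∀ T, SolvesEq ε T v fun t => bil le_rfl (v t) (v t) := by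
  have hF : Continuous fun t => bil le_rfl (v t) (v t) := continuous_bil_self le_rfl hv
  have hWv : Continuous fun t => M (Wi 1) (v t) := by fun_prop
  have hWF : Continuous fun t => M (Wi 1) (bil le_rfl (v t) (v t)) := by fun_prop
  set g : ℝ → L2c := fun t => regRhs ε (M (Wi 1) (v t)) (M (Wi 1) (bil le_rfl (v t) (v t))) with hg
  have hgc : Continuous g := continuous_regRhs ε hWv hWF
  have hpair : ∀ ψ, ∀ hψ : IsTest ψ, ∀ t, 0 ≤ t → pairReg hψ (M (Wi 2) (M (Wi 1) (v t))) =
      ((∫ x, f t x * ψ x : ℝ) : ℂ) := by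
    intro ψ hψ t ht
    rw [← hf t ht, pairReg_Wi]
  have hrhs : ∀ ψ, ∀ hψ : IsTest ψ, ∀ t, 0 ≤ t → pairReg hψ (g t) =
      ((∫ x, (f t x ^ 2 / 2 * deriv ψ x + ε * (f t x * iteratedDeriv 2 ψ x)) : ℝ) : ℂ) := by
    intro ψ hψ t ht
    rw [hg, ← pairReg_regRhs hψ ε (hf t ht), hf t ht]
  constructor
  · intro h T
    refine SolvesEq.of_map (isSymbol_Wi 1) (Wi_ne_zero 1) hv hF ?_
    rw [solvesEq_iff hWv hWF]
    intro t ht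
    rw [← sub_eq_zero]
    refine eq_zero_of_pairReg fun ψ hψ => ?_
    -- The derivative is known only for positive times; continuity of v at 0 lets the integration
    -- start there.
    have hint := intervalIntegral.integral_eq_sub_of_hasDerivAt_of_le ht.1
      (f := fun s => pairReg hψ (M (Wi 2) (M (Wi 1) (v s)))) (f' := fun s => pairReg hψ (g s))
      (by fun_prop) (fun s hs => by
        rw [hrhs ψ hψ s hs.1.le]
        refine (h ψ hψ s hs.1).ofReal_comp.congr_of_eventuallyEq ?_
        filter_upwards [lt_mem_nhds hs.1] with r hr
        exact hpair ψ hψ r hr.le)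
      ((by fun_prop : Continuous fun s => pairReg hψ (g s)).intervalIntegrable _ _)
    rw [ContinuousLinearMap.intervalIntegral_comp_comm _ (hgc.intervalIntegrable _ _)] at hint
    rw [map_sub, map_add, hint]
    ring
  · intro h ψ hψ t ht
    have h1 := (solvesEq_iff hWv hWF).1 ((h (t + 1)).map hv hF (isSymbol_Wi 1))
    have h2 : HasDerivAt (fun s => pairReg hψ (M (Wi 2) (M (Wi 1) (v 0)) + ∫ r in (0 : ℝ)..s, g r))
        (pairReg hψ (g t)) t :=
      ((pairReg hψ).restrictScalars ℝ).hasFDerivAt.comp_hasDerivAt t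
        ((intervalIntegral.integral_hasDerivAt_right (hgc.intervalIntegrable _ _)
          (hgc.stronglyMeasurableAtFilter _ _) hgc.continuousAt).const_add _)
    have h3 := Complex.reCLM.hasFDerivAt.comp_hasDerivAt t h2
    rw [hrhs ψ hψ t ht.le] at h3
    refine HasDerivAt.congr_of_eventuallyEq (f := Complex.re ∘ fun s => pairReg hψ
      (M (Wi 2) (M (Wi 1) (v 0)) + ∫ r in (0 : ℝ)..s, g r)) h3 ?_
    filter_upwards [Ioo_mem_nhds ht (lt_add_one t)] with s hs
    rw [Function.comp_apply, ← h1 s ⟨hs.1.le, hs.2.le⟩, hpair ψ hψ s hs.1.le, Complex.ofReal_re]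

/-! ### Solutions and the Sobolev spaces -/

theorem continuousInH_of_hat {n : ℕ} {w : ℝ≥0 → L2} {v : ℝ → L2c} (hv : Continuous v)
    (h : ∀ t : ℝ≥0, hat (w t) = M (Wi n) (v t)) : ContinuousInH n w := by
  refine ⟨fun t => memH_iff.2 ⟨_, h t⟩, fun t₀ => ?_⟩
  have e : ∀ t : ℝ≥0, hNorm n (w t - w t₀) = ‖v t - v t₀‖ := fun t =>
    hNorm_eq (by rw [hat_sub, h, h, map_sub])
  simp only [e]
  have hc : Continuous fun t : ℝ≥0 => ‖v t - v t₀‖ := by fun_prop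
  simpa using hc.tendsto t₀

theorem exists_continuous_of_continuousInH {n : ℕ} {w : ℝ≥0 → L2} (h : ContinuousInH n w) :
    ∃ v : ℝ≥0 → L2c, Continuous v ∧ ∀ t, hat (w t) = M (Wi n) (v t) := by
  choose v hv using fun t => memH_iff.1 (h.1 t)
  refine ⟨v, continuous_iff_continuousAt.2 fun t₀ => ?_, hv⟩
  rw [ContinuousAt, tendsto_iff_norm_sub_tendsto_zero]
  refine (h.2 t₀).congr fun t => hNorm_eq ?_
  rw [hat_sub, hv, hv, map_sub]

theorem isSolution_of_FSol {w₀ : L2} {w : ℝ≥0 → L2} {v : ℝ → L2c}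
    (hv : ∀ T, FSol le_rfl ε T v) (hw : ∀ t : ℝ≥0, hat (w t) = M (Wi 1) (v t)) (h0 : w 0 = w₀) :
    IsSolution ε w₀ w := by
  refine ⟨continuousInH_of_hat (hv 0).cont hw, h0, ?_⟩
  refine (distribEq_iff (f := fun t => w t.toNNReal) (hv 0).cont fun t ht => ?_).2
    fun T => (hv T).eq
  rw [hw, Real.coe_toNNReal t ht]

/-- Time is extended to ℝ by freezing the initial value, so any distributional solution enters the
Fourier framework and uniqueness covers the whole class. -/
theorem IsSolution.exists_FSol {w₀ : L2} {w : ℝ≥0 → L2} (h : IsSolution ε w₀ w) :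
    ∃ v : ℝ → L2c, (∀ T, FSol le_rfl ε T v) ∧ ∀ t : ℝ≥0, hat (w t) = M (Wi 1) (v t) := by
  obtain ⟨v, hv, hw⟩ := exists_continuous_of_continuousInH h.continuousInH
  have hc : Continuous fun t : ℝ => v t.toNNReal := hv.comp continuous_real_toNNReal
  have heq := (distribEq_iff (f := fun t => w t.toNNReal) hc fun t _ => hw _).1 h.equation
  exact ⟨fun t => v t.toNNReal, fun T => ⟨hc, fun t => J_of_hat (hw _), heq T⟩,
    fun t => by simp only [Real.toNNReal_coe, hw]⟩

theorem FSol.eq_of_initial {v v' : ℝ → L2c} (hε : 0 < ε) {n : ℕ} {hn : 1 ≤ n}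
    (h : ∀ T, FSol hn ε T v) (h' : ∀ T, FSol hn ε T v') (h0 : v 0 = v' 0) {t : ℝ} (ht : 0 ≤ t) :
    v t = v' t :=
  SolvesEq.unique hε (h t).cont (h' t).cont (h t).eq (h' t).eq h0 ⟨ht, le_rfl⟩

theorem IsSolution.unique {w₀ : L2} {w w' : ℝ≥0 → L2} (hε : 0 < ε) (h : IsSolution ε w₀ w)
    (h' : IsSolution ε w₀ w') : w = w' := by
  obtain ⟨v, hv, hw⟩ := h.exists_FSol
  obtain ⟨v', hv', hw'⟩ := h'.exists_FSol
  have h0 : v 0 = v' 0 := by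
    refine M_injective (isSymbol_Wi 1) (Wi_ne_zero 1) ?_
    have e := hw 0
    have e' := hw' 0
    rw [h.initial] at e
    rw [h'.initial] at e'
    exact e.symm.trans e'
  ext1 t
  refine hat_injective ?_
  rw [hw, hw', FSol.eq_of_initial hε hv hv' h0 t.coe_nonneg]

theorem exists_isSolution {w₀ : L2} {v₀ : L2c} (hε : 0 < ε) (h₀ : hat w₀ = M (Wi 1) v₀) :
    ∃ (w : ℝ≥0 → L2) (v : ℝ → L2c), IsSolution ε w₀ w ∧ v 0 = v₀ ∧ (∀ T, FSol le_rfl ε T v) ∧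
      ∀ t : ℝ≥0, hat (w t) = M (Wi 1) (v t) := by
  obtain ⟨v, hv0, hv⟩ := ViscousBurgers.exists_FSol (k := 0) le_rfl hε (J_of_hat h₀)
  choose w hw using fun t : ℝ≥0 => exists_hat_eq (g := M (Wi 1) (v t)) (by
    rw [J_Wi, (hv 0).real])
  refine ⟨w, v, isSolution_of_FSol hv hw (hat_injective ?_), hv0, hv, hw⟩
  rw [hw, h₀, NNReal.coe_zero, hv0]

/-- Persistence of higher regularity. -/
theorem exists_lift {w₀ : L2} {w : ℝ≥0 → L2} {v : ℝ → L2c} {k : ℕ} {v₀ : L2c} (hε : 0 < ε)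
    (hv : ∀ T, FSol le_rfl ε T v) (hw : ∀ t : ℝ≥0, hat (w t) = M (Wi 1) (v t)) (h0 : w 0 = w₀)
    (h₀ : hat w₀ = M (Wi (k + 1)) v₀) :
    ∃ z : ℝ → L2c, z 0 = v₀ ∧ (∀ T, FSol (Nat.le_add_left 1 k) ε T z) ∧
      ∀ t : ℝ≥0, hat (w t) = M (Wi (k + 1)) (z t) := by
  obtain ⟨z, hz0, hz⟩ := ViscousBurgers.exists_FSol (Nat.le_add_left 1 k) hε (J_of_hat h₀)
  have hl : ∀ T, FSol le_rfl ε T fun t => M (Wi k) (z t) := fun T => (hz T).lower le_rfl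
  have e0 : v 0 = M (Wi k) (z 0) := by
    refine M_injective (isSymbol_Wi 1) (Wi_ne_zero 1) ?_
    have := hw 0
    rw [h0, h₀] at this
    rw [← M_Wi_add, add_comm 1 k, hz0]
    exact this.symm
  refine ⟨z, hz0, hz, fun t => ?_⟩
  rw [hw, FSol.eq_of_initial hε hv hl e0 t.coe_nonneg, ← M_Wi_add, add_comm 1 k]

theorem hNorm_le_of_le {m n : ℕ} (h : m ≤ n) {f : L2} (hf : MemH n f) :
    hNorm m f ≤ hNorm n f := by
  obtain ⟨k, rfl⟩ := Nat.exists_eq_add_of_le h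
  obtain ⟨v, hv⟩ := memH_iff.1 hf
  rw [hNorm_eq hv, hNorm_eq (hv.trans (M_Wi_add m k v))]
  exact norm_M_le_norm (isSymbol_Wi k) (norm_Wi_le k) v

/-! ### Monotonicity of the constants -/

section Constants

variable {R R' : ℝ}

theorem rate_mono_right (hε : 0 < ε) (hR : 0 ≤ R) (h : R ≤ R') : rate ε R ≤ rate ε R' := by
  unfold rate
  have := cEmb_nonneg
  gcongr

theorem hBound_mono_right (hε : 0 < ε) (hT : 0 ≤ T) (hR : 0 ≤ R) (h : R ≤ R') :
    hBound ε T R ≤ hBound ε T R' := by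
  unfold hBound
  have := rate_mono_right hε hR h
  gcongr

theorem gradConst_nonneg (hε : 0 < ε) (R : ℝ) : 0 ≤ gradConst ε R := by
  unfold gradConst
  have := cEmb_nonneg
  have := hBound_nonneg ε 1 R
  have := rate_nonneg hε R
  positivity

theorem gradConst_mono (hε : 0 < ε) (hR : 0 ≤ R) (h : R ≤ R') :
    gradConst ε R ≤ gradConst ε R' := by
  unfold gradConst
  have := cEmb_nonneg
  have := hBound_mono_right hε zero_le_one hR h
  have := rate_mono_right hε hR h
  gcongr

theorem regConst_mono_right (n : ℕ) (hε : 0 < ε) (hT : 0 ≤ T) (hR : 0 ≤ R) (h : R ≤ R') :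
    regConst n ε T R ≤ regConst n ε T R' := by
  unfold regConst
  have := cEmb_nonneg
  have := hBound_mono_right hε hT hR h
  gcongr

end Constants

end ViscousBurgers

end

/-! ### Main theorem -/

open ViscousBurgers in
theorem mainTheorem3 :
    ∃ (C : ℝ → ℝ → ℝ) (M : ℕ → ℝ → ℝ → ℝ → ℝ),
      (∀ ε R, 0 < C ε R) ∧ (∀ ε, Monotone (C ε)) ∧
      (∀ n ε T R, 0 < M n ε T R) ∧
      (∀ n ε T T' R R', T ≤ T' → R ≤ R' → M n ε T R ≤ M n ε T' R') ∧
      ∀ ε : ℝ, 0 < ε → ∀ w₀ : L2, MemH 1 w₀ →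
        ∃ w : ℝ≥0 → L2,
          IsSolution ε w₀ w ∧
          (∀ w' : ℝ≥0 → L2, IsSolution ε w₀ w' → w' = w) ∧
          Antitone (fun t => ‖w t‖) ∧
          (∀ t : ℝ≥0,
            ‖w t‖ ≤ ‖w₀‖ ∧
            ‖weakDeriv 1 (w t)‖ ≤
              ‖weakDeriv 1 w₀‖ *
                Real.exp (C ε (hNorm 1 w₀) * ((t : ℝ) ^ (5 / 8 : ℝ) + (t : ℝ)))) ∧
          (∀ n : ℕ, 2 ≤ n → MemH n w₀ →
            ContinuousInH n w ∧
            ∀ T : ℝ, 0 < T → ∀ t : ℝ≥0, (t : ℝ) ≤ T →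
              hNorm n (w t) ≤
                hNorm n w₀ * Real.exp (M n ε T (hNorm 2 w₀) * (t : ℝ))) := by
  classical
  -- The constants must be positive and monotone for all real arguments: negative T and R are
  -- replaced by 0, the value 1 is used when ε ≤ 0, and adding 1 makes the constants strictly
  -- positive.
  refine ⟨fun ε R => if 0 < ε then gradConst ε (max R 0) + 1 else 1,
    fun n ε T R => if 0 < ε then regConst n ε (max T 0) (max R 0) + 1 else 1,
    fun ε R => ?_, fun ε R R' hR => ?_, fun n ε T R => ?_, fun n ε T T' R R' hT hR => ?_,
    fun ε hε w₀ hw₀ => ?_⟩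
  · dsimp only
    split_ifs with hε
    · linarith [gradConst_nonneg hε (max R 0)]
    · exact one_pos
  · dsimp only
    split_ifs with hε
    · linarith [gradConst_mono hε (le_max_right R 0) (max_le_max_right 0 hR)]
    · exact le_rfl
  · dsimp only
    split_ifs with hε
    · linarith [regConst_nonneg n hε (max T 0) (max R 0)]
    · exact one_pos
  · dsimp only
    split_ifs with hε
    · linarith [regConst_mono n hε (max_le_max_right 0 hT) (max R 0),
        regConst_mono_right n hε (le_max_right T' 0) (le_max_right R 0) (max_le_max_right 0 hR)]
    · exact le_rfl
  simp only [if_pos hε]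
  obtain ⟨v₀, hv₀⟩ := memH_iff.1 hw₀
  obtain ⟨w, v, hsol, rfl, hv, hw⟩ := exists_isSolution hε hv₀
  have hw0 : hat w₀ = M (Wi 1) (v 0) := hv₀
  have hanti : Antitone fun t => ‖w t‖ := by
    intro s t hst
    dsimp only
    rw [← norm_hat, ← norm_hat (w s), hw, hw]
    exact (hv t).norm_Wi_antitone hε s.coe_nonneg hst le_rfl
  refine ⟨w, hsol, fun w' hw' => hw'.unique hε hsol, hanti, fun t => ⟨?_, ?_⟩,
    fun n hn hnw₀ => ?_⟩
  · rw [← hsol.initial]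
    exact hanti zero_le
  · rw [norm_weakDeriv_one (hw t), norm_weakDeriv_one hw0, hNorm_eq hw0,
      max_eq_left (norm_nonneg _)]
    -- The estimate holds already with exponent linear in t; the term t^{5/8} only weakens it.
    refine ((hv t).gradient_le_exp hε le_rfl ⟨t.coe_nonneg, le_rfl⟩).trans ?_
    have h1 := gradConst_nonneg hε ‖v 0‖
    have h2 : (0 : ℝ) ≤ (t : ℝ) ^ (5 / 8 : ℝ) := Real.rpow_nonneg t.coe_nonneg _
    have h3 : (0 : ℝ) ≤ t := t.coe_nonneg
    gcongr
    · linarith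
    · linarith
  · obtain ⟨k, rfl⟩ : ∃ k, n = k + 1 := ⟨n - 1, by omega⟩
    obtain ⟨z₀, hz₀⟩ := memH_iff.1 hnw₀
    obtain ⟨z, rfl, hz, hwz⟩ := exists_lift hε hv hw hsol.initial hz₀
    refine ⟨continuousInH_of_hat (hz 0).cont hwz, fun T hT t ht => ?_⟩
    have h2 : hNorm 1 w₀ ≤ hNorm 2 w₀ :=
      hNorm_le_of_le one_le_two fun j hj => hnw₀ j (hj.trans hn)
    -- The rate needs only the H¹ norm of the data, which the H² norm dominates.
    have h1 : ‖M (Wi k) (z 0)‖ ≤ hNorm 2 w₀ := by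
      rwa [hNorm_eq (v := M (Wi k) (z 0)) (by rw [hz₀, ← M_Wi_add, add_comm])] at h2
    have h0 : 0 ≤ hNorm 2 w₀ := Real.sqrt_nonneg _
    rw [hNorm_eq (hwz t), hNorm_eq hz₀, max_eq_left hT.le, max_eq_left h0]
    refine ((hz T).norm_le_exp hε h1 ⟨t.coe_nonneg, ht⟩).trans ?_
    have h3 : (0 : ℝ) ≤ t := t.coe_nonneg
    gcongr
    linarith
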